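/- **Theorem (conformally rescaled noncommutative tori are spectrally closed).** Let $\theta$ be a real antisymmetric $n\times n$ matrix, write $\theta(p,q)=\sum_{i,j}\theta_{ij}p_iq_j$, and let $\mathcal A=C^\infty(\mathbb T^n_\theta)$ be the algebra of rapidly decreasing series $\sum_{p\in\mathbb Z^n}a_pU^p$ with $U^pU^q=e^{\pi i\theta(p,q)}U^{p+q}$, with trace $\tau(\sum_p a_pU^p)=a_0$ and derivations $\delta_jU^p=p_jU^p$. Assume that the torus is strictly irrational: no $U^p$ with $p\neq0$ is central, i.e. if $\theta(p,q)\in\mathbb Z$ for all $q\in\mathbb Z^n$, then $p=0$. Let $\gamma^1,\dots,\gamma^n$ be self-adjoint $N\times N$ matrices with $\gamma^i\gamma^j+\gamma^j\gamma^i=2\delta_{ij}$, let $\mathcal H=L^2(\mathbb T^n_\theta,\tau)\otimes\mathbb C^N$, on which $\mathcal A$ acts by left multiplication, let $D=\sum_j\gamma^j\delta_j$, and let $k$ be a strictly positive element of the copy $\mathcal A^o$ of $\mathcal A$ in the commutant of $\mathcal A$ (acting by right multiplication). Put $D_k=kDk$, on the space $\mathcal A\otimes\mathbb C^N$ of smooth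 spinors, and let $|D_k|^{-n}$ be the bounded operator that multiplies each eigenvector of $D_k$ of eigenvalue $\mu\ne0$ by $|\mu|^{-n}$ and vanishes on $\ker D_k$. Let $\hat{\mathcal A}$ be the algebra of operators $f\mapsto\sum_{p,q}c_{p,q}U^pfU^q$ with rapidly decreasing coefficients (generated by $\mathcal A$ and $\mathcal A^o$), with the product trace $\hat\tau(c)=c_{0,0}$. A classical pseudodifferential operator of order $d\in\mathbb Z$ is an operator $P$ on smooth spinors with $$P(U^m\otimes v)\sim\sum_{r\le d}\sigma_r(m)\,(U^m\otimes v)\qquad(m\in\mathbb Z^n,\ |m|\to\infty),$$ where $\sigma_r:\mathbb R^n\setminus\{0\}\to\hat{\mathcal A}\otimes M_N(\mathbb C)$ is smooth and homogeneous of degree $r$, and the remainder after the terms of degree $>r$ is $O(|m|^r)\,\|v\|$ in $(\mathcal A U^m)\otimes\mathbb C^N$, in every seminorm of $\mathcal A$. Its Wodzicki residue is $$\mathcal W(P)=\int_{|\xi|=1}(\hat\tau\otimes\mathrm{Tr})(\sigma_{-n}(\xi))\,d\xi .$$ Then $|D_k|^{-n}$ exists, is unique and preserves the smooth spinors. For every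 operator $T$ of order zero, i.e. in the algebra generated by all $a$ and $[D_k,b]$ with $a,b\in\mathcal A$, the operator $TD_k|D_k|^{-n}$ is a classical pseudodifferential operator of order $1-n$, and $$\mathcal W\bigl(TD_k|D_k|^{-n}\bigr)=0,$$ whichever symbol expansion of the operator is used to compute the residue. This holds in every dimension $n$. -/

import Mathlib

open scoped ContDiff

noncomputable section

namespace NCTorus

/-- The lattice `ℤⁿ` labelling the monomials `U^p`, with the sup norm. -/
abbrev Idx (n : ℕ) : Type := Fin n → ℤ

/-- The cotangent space `ℝⁿ` with its Euclidean norm. -/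
abbrev Cov (n : ℕ) : Type := EuclideanSpace ℝ (Fin n)

/-- The space `ℂ^N` on which the gamma matrices act. -/
abbrev Spin (N : ℕ) : Type := EuclideanSpace ℂ (Fin N)

/-- The `N × N` matrices, as operators on `ℂ^N`. -/
abbrev Mat (N : ℕ) : Type := Spin N →L[ℂ] Spin N

/-! ### Rapidly decreasing families and the Hilbert space -/

/-- Rapidly decreasing `V`-valued families `f = ∑ f_l U^l`. For `V = ℂ` this is the smooth algebra
`C^∞(𝕋ⁿ_θ)` in Fourier coefficients; for `V = ℂ^N` it is the space of smooth spinors. -/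
def Schw (n : ℕ) (V : Type) [NormedAddCommGroup V] [NormedSpace ℂ V] :
    Submodule ℂ (Idx n → V) where
  carrier := {f | ∀ s : ℕ, Summable fun p => (1 + ‖p‖) ^ s * ‖f p‖}
  zero_mem' := by
    intro s
    simp [summable_zero]
  add_mem' := by
    intro f g hf hg s
    refine Summable.of_nonneg_of_le (fun p => by positivity) (fun p => ?_) ((hf s).add (hg s))
    have h : 0 ≤ (1 + ‖p‖) ^ s := by positivity
    calc (1 + ‖p‖) ^ s * ‖(f + g) p‖ ≤ (1 + ‖p‖) ^ s * (‖f p‖ + ‖g p‖) :=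
          mul_le_mul_of_nonneg_left (norm_add_le _ _) h
      _ = _ := by ring
  smul_mem' := by
    intro c f hf s
    refine ((hf s).mul_left ‖c‖).congr (fun p => ?_)
    rw [Pi.smul_apply, norm_smul]
    ring

/-- The algebra `𝒜 = C^∞(𝕋ⁿ_θ)` as a vector space (the product depends on `θ`). -/
abbrev SmoothAlg (n : ℕ) : Type := Schw n ℂ

/-- The smooth spinors. -/
abbrev SmoothSpinor (n N : ℕ) : Type := Schw n (Spin N)

/-- The space `L²(𝕋ⁿ_θ, τ) ⊗ V`; the `U^l` form an orthonormal basis of `L²(𝕋ⁿ_θ, τ)`. -/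
abbrev L2 (n : ℕ) (V : Type) [NormedAddCommGroup V] : Type := lp (fun _ : Idx n => V) 2

section
variable {n : ℕ} {V : Type} [NormedAddCommGroup V] [NormedSpace ℂ V]

theorem schw_summable_norm (f : Schw n V) : Summable fun p => ‖f.1 p‖ := by
  simpa using f.2 0

theorem schw_memlp (f : Schw n V) : Memℓp f.1 2 := by
  have h : Memℓp f.1 1 := memℓp_gen (by simpa using schw_summable_norm f)
  exact h.of_exponent_ge (by norm_num)

/-- The inclusion of the smooth vectors into the Hilbert space. -/
def toL2 : Schw n V →ₗ[ℂ] L2 n V where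
  toFun f := ⟨f.1, schw_memlp f⟩
  map_add' _ _ := rfl
  map_smul' _ _ := rfl

/-! ### Multiplication operators -/

/-- `p, q ↦ θ(p, q) = ∑ θ_{ij} p_i q_j`. -/
def pairing (θ : Matrix (Fin n) (Fin n) ℝ) (p q : Idx n) : ℝ :=
  ∑ i, ∑ j, θ i j * (p i : ℝ) * (q j : ℝ)

/-- The cocycle `ω(p, q) = exp(π i θ(p, q))` of the relation `U^p U^q = ω(p, q) U^(p+q)`. Hence
`U^p U^q = exp(2π i θ(p, q)) U^q U^p` and `(U^p)^* = U^(-p)` when `θ` is antisymmetric. -/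
def cocycle (θ : Matrix (Fin n) (Fin n) ℝ) (p q : Idx n) : ℂ :=
  Complex.exp ((Real.pi * pairing θ p q : ℝ) * Complex.I)

theorem norm_cocycle (θ : Matrix (Fin n) (Fin n) ℝ) (p q : Idx n) : ‖cocycle θ p q‖ = 1 :=
  Complex.norm_exp_ofReal_mul_I _

/-- Twisted convolution of rapidly decreasing families by a bounded twist `w`. -/
def conv (w : Idx n → Idx n → ℂ) (a : Idx n → ℂ) (f : Idx n → V) (l : Idx n) : V :=
  ∑' p, (w p (l - p) * a p) • f (l - p)

theorem summable_weighted (s : ℕ) (a : SmoothAlg n) (f : Schw n V) :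
    Summable fun x : Idx n × Idx n =>
      ((1 + ‖x.1‖) ^ s * ‖a.1 x.1‖) * ((1 + ‖x.2 - x.1‖) ^ s * ‖f.1 (x.2 - x.1)‖) := by
  have h := (a.2 s).mul_of_nonneg (f.2 s) (fun p => by positivity) (fun p => by positivity)
  let e : Idx n × Idx n ≃ Idx n × Idx n :=
    { toFun := fun x => (x.1, x.2 - x.1)
      invFun := fun x => (x.1, x.2 + x.1)
      left_inv := fun x => by simp
      right_inv := fun x => by simp }
  exact (e.summable_iff).2 h

theorem norm_conv_term (w : Idx n → Idx n → ℂ) (hw : ∀ p q, ‖w p q‖ = 1)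
    (a : Idx n → ℂ) (f : Idx n → V) (l p : Idx n) :
    ‖(w p (l - p) * a p) • f (l - p)‖ = ‖a p‖ * ‖f (l - p)‖ := by
  rw [norm_smul, norm_mul, hw, one_mul]

theorem summable_conv (w : Idx n → Idx n → ℂ) (hw : ∀ p q, ‖w p q‖ = 1)
    (a : SmoothAlg n) (f : Schw n V) (l : Idx n) :
    Summable fun p => ‖(w p (l - p) * a.1 p) • f.1 (l - p)‖ := by
  have h := summable_weighted 0 a f
  have h2 := h.comp_injective (i := fun p : Idx n => (p, l)) (fun p q hpq => by simpa using hpq)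
  refine h2.congr (fun p => ?_)
  simp [norm_conv_term w hw]

theorem conv_mem [CompleteSpace V] (w : Idx n → Idx n → ℂ) (hw : ∀ p q, ‖w p q‖ = 1)
    (a : SmoothAlg n) (f : Schw n V) : conv w a.1 f.1 ∈ Schw n V := by
  intro s
  have h := summable_weighted s a f
  have h1 : Summable fun x : Idx n × Idx n =>
      ((1 + ‖x.2‖) ^ s * ‖a.1 x.2‖) * ((1 + ‖x.1 - x.2‖) ^ s * ‖f.1 (x.1 - x.2)‖) :=
    ((Equiv.prodComm (Idx n) (Idx n)).summable_iff).2 h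
  have h2 := (summable_prod_of_nonneg (fun x => by positivity)).1 h1
  refine Summable.of_nonneg_of_le (fun l => by positivity) (fun l => ?_) h2.2
  have h3 : ‖conv w a.1 f.1 l‖ ≤ ∑' p, ‖(w p (l - p) * a.1 p) • f.1 (l - p)‖ :=
    norm_tsum_le_tsum_norm (summable_conv w hw a f l)
  calc (1 + ‖l‖) ^ s * ‖conv w a.1 f.1 l‖
      ≤ (1 + ‖l‖) ^ s * ∑' p, ‖(w p (l - p) * a.1 p) • f.1 (l - p)‖ :=
        mul_le_mul_of_nonneg_left h3 (by positivity)
    _ = ∑' p, (1 + ‖l‖) ^ s * ‖(w p (l - p) * a.1 p) • f.1 (l - p)‖ := tsum_mul_left.symm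
    _ ≤ _ := by
      refine ((summable_conv w hw a f l).mul_left _).tsum_le_tsum (fun p => ?_) (h2.1 l)
      rw [norm_conv_term w hw]
      have h4 : (1 + ‖l‖) ^ s ≤ (1 + ‖p‖) ^ s * (1 + ‖l - p‖) ^ s := by
        rw [← mul_pow]
        refine pow_le_pow_left₀ (by positivity) ?_ s
        have h5 : ‖l‖ ≤ ‖p‖ + ‖l - p‖ := by
          calc ‖l‖ = ‖p + (l - p)‖ := by congr 1; abel
            _ ≤ _ := norm_add_le _ _
        nlinarith [norm_nonneg p, norm_nonneg (l - p)]
      calc (1 + ‖l‖) ^ s * (‖a.1 p‖ * ‖f.1 (l - p)‖)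
          ≤ ((1 + ‖p‖) ^ s * (1 + ‖l - p‖) ^ s) * (‖a.1 p‖ * ‖f.1 (l - p)‖) :=
            mul_le_mul_of_nonneg_right h4 (by positivity)
        _ = _ := by ring

/-- Twisted convolution as an operator on rapidly decreasing families. -/
def convOp [CompleteSpace V] (w : Idx n → Idx n → ℂ) (hw : ∀ p q, ‖w p q‖ = 1) (a : SmoothAlg n) :
    Module.End ℂ (Schw n V) where
  toFun f := ⟨conv w a.1 f.1, conv_mem w hw a f⟩
  map_add' f g := by
    apply Subtype.ext
    funext l
    change conv w a.1 (f.1 + g.1) l = conv w a.1 f.1 l + conv w a.1 g.1 l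
    have hf := (summable_conv w hw a f l).of_norm
    have hg := (summable_conv w hw a g l).of_norm
    simp only [conv, Pi.add_apply, smul_add]
    exact hf.tsum_add hg
  map_smul' c f := by
    apply Subtype.ext
    funext l
    change conv w a.1 (c • f.1) l = c • conv w a.1 f.1 l
    simp only [conv, Pi.smul_apply]
    rw [← tsum_const_smul'' c]
    exact tsum_congr fun p => smul_comm _ _ _

/-- Left multiplication `f ↦ a f`, the representation of `𝒜`. -/
def lmul [CompleteSpace V] (θ : Matrix (Fin n) (Fin n) ℝ) (a : SmoothAlg n) : Module.End ℂ (Schw n V) :=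
  convOp (fun p q => cocycle θ p q) (fun p q => norm_cocycle θ p q) a

/-- Right multiplication `f ↦ f b`, the copy `𝒜ᵒ` of `𝒜` in the commutant of `𝒜`. -/
def rmul [CompleteSpace V] (θ : Matrix (Fin n) (Fin n) ℝ) (b : SmoothAlg n) : Module.End ℂ (Schw n V) :=
  convOp (fun p q => cocycle θ q p) (fun p q => norm_cocycle θ q p) b

/-! ### Derivations, gamma matrices and the Dirac operator -/

/-- The standard derivation `δ_j`, with `δ_j U^l = l_j U^l`. -/
def delta (j : Fin n) : Module.End ℂ (Schw n V) where
  toFun f := ⟨fun l => (l j : ℂ) • f.1 l, by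
    intro s
    refine Summable.of_nonneg_of_le (fun l => by positivity) (fun l => ?_) (f.2 (s + 1))
    have h1 : ‖(l j : ℂ)‖ ≤ 1 + ‖l‖ := by
      have h2 : ‖l j‖ ≤ ‖l‖ := norm_le_pi_norm l j
      have h3 : ‖(l j : ℂ)‖ = ‖l j‖ := by simp [Int.norm_eq_abs]
      linarith
    rw [norm_smul, pow_succ]
    calc (1 + ‖l‖) ^ s * (‖(l j : ℂ)‖ * ‖f.1 l‖)
        ≤ (1 + ‖l‖) ^ s * ((1 + ‖l‖) * ‖f.1 l‖) := by gcongr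
      _ = _ := by ring⟩
  map_add' f g := by
    apply Subtype.ext
    funext l
    exact smul_add _ _ _
  map_smul' c f := by
    apply Subtype.ext
    funext l
    exact smul_comm _ _ _

end

section
variable {n N : ℕ}

/-- The action `1 ⊗ φ` of a matrix on smooth spinors. -/
def spinMap (φ : Mat N) : Module.End ℂ (SmoothSpinor n N) where
  toFun f := ⟨fun l => φ (f.1 l), by
    intro s
    refine Summable.of_nonneg_of_le (fun l => by positivity) (fun l => ?_)
      ((f.2 s).mul_left ‖φ‖)
    calc (1 + ‖l‖) ^ s * ‖φ (f.1 l)‖ ≤ (1 + ‖l‖) ^ s * (‖φ‖ * ‖f.1 l‖) := by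
          gcongr
          exact φ.le_opNorm _
      _ = _ := by ring⟩
  map_add' f g := by
    apply Subtype.ext
    funext l
    exact map_add φ _ _
  map_smul' c f := by
    apply Subtype.ext
    funext l
    exact map_smul φ _ _

/-- Gamma matrices: self-adjoint, with `γ^i γ^j + γ^j γ^i = 2 δ_{ij}`. -/
structure IsGamma (γ : Fin n → Mat N) : Prop where
  selfAdjoint : ∀ j, IsSelfAdjoint (γ j)
  clifford : ∀ i j, γ i * γ j + γ j * γ i = if i = j then 2 else 0

/-- The flat Dirac operator `D = ∑ γ^j δ_j` on smooth spinors. -/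
def dirac (γ : Fin n → Mat N) : Module.End ℂ (SmoothSpinor n N) :=
  ∑ j, spinMap (γ j) * delta j

/-- The rescaled Dirac operator `D_k = k D k`, with `k ∈ 𝒜ᵒ` acting from the right. -/
def diracK (θ : Matrix (Fin n) (Fin n) ℝ) (γ : Fin n → Mat N) (k : SmoothAlg n) :
    Module.End ℂ (SmoothSpinor n N) :=
  rmul θ k * dirac γ * rmul θ k

/-- The torus is strictly irrational: no `U^p` with `p ≠ 0` is central, that is, the centre of
the algebra is trivial. -/
def StrictlyIrrational (θ : Matrix (Fin n) (Fin n) ℝ) : Prop :=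
  ∀ p : Idx n, (∀ q : Idx n, ∃ z : ℤ, pairing θ p q = z) → p = 0

/-- `k > 0`: the element `k` is self-adjoint and its spectrum is bounded below by some `ε > 0`. -/
def IsStrictlyPositive (θ : Matrix (Fin n) (Fin n) ℝ) (k : SmoothAlg n) : Prop :=
  (∀ p, k.1 (-p) = star (k.1 p)) ∧
    ∃ ε : ℝ, 0 < ε ∧ ∀ f : Schw n ℂ,
      ε * ‖toL2 f‖ ^ 2 ≤ (inner ℂ (toL2 f) (toL2 (rmul θ k f)) : ℂ).re

/-- The operators of order zero: the algebra generated by all `a` and `[D_k, b]`, `a, b ∈ 𝒜`. -/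
def zeroOrder (θ : Matrix (Fin n) (Fin n) ℝ) (γ : Fin n → Mat N) (k : SmoothAlg n) :
    Subalgebra ℂ (Module.End ℂ (SmoothSpinor n N)) :=
  Algebra.adjoin ℂ (Set.range (fun a : SmoothAlg n => lmul θ a) ∪
    Set.range (fun b : SmoothAlg n => ⁅diracK θ γ k, lmul θ b⁆))

/-- `R` is the operator `|D|^{-t}` on smooth spinors: it is the restriction of a bounded operator
of the Hilbert space, it multiplies by `|μ|^{-t}` the eigenvectors of `D` of eigenvalue `μ ≠ 0`, and
it vanishes on the kernel of `D`. (For `D = D_k` the eigenvectors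
in the smooth spinors span a dense subspace, so this determines `R`.) -/
structure IsInvAbsPow (D : Module.End ℂ (SmoothSpinor n N)) (t : ℕ)
    (R : Module.End ℂ (SmoothSpinor n N)) : Prop where
  bounded : ∃ B : L2 n (Spin N) →L[ℂ] L2 n (Spin N), ∀ f, toL2 (R f) = B (toL2 f)
  eigen : ∀ (μ : ℝ) (f : SmoothSpinor n N), μ ≠ 0 → D f = (μ : ℂ) • f →
    R f = (((|μ|⁻¹ ^ t : ℝ)) : ℂ) • f
  kernel : ∀ f : SmoothSpinor n N, D f = 0 → R f = 0

/-! ### Pseudodifferential operators and the residue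

The algebra `Â` generated by `𝒜` and `𝒜ᵒ` consists of the operators
`f ↦ ∑ c_{p,q} U^p f U^q` with rapidly decreasing `c`. Its trace is the product of the two traces,
`c ↦ c_{0,0}`. Symbols are functions on `ℝⁿ \ {0}` with values in `Â ⊗ M_N(ℂ)`, written
`c : Cov n → Idx n → Idx n → Mat N`. -/

/-- The lattice point `m` as a covector. -/
def toCov (m : Idx n) : Cov n := WithLp.toLp 2 fun j => (m j : ℝ)

/-- The spinor `U^m ⊗ v`. -/
def mono (m : Idx n) (v : Spin N) : SmoothSpinor n N :=
  ⟨Pi.single m v, by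
    intro s
    refine summable_of_ne_finset_zero (s := {m}) (fun p hp => ?_)
    have h : p ≠ m := by simpa using hp
    simp [Pi.single_eq_of_ne h]⟩

/-- The `U^l`-coefficient of `∑ c_{p,q} U^p U^m U^q ⊗ v`; only `q = l - p - m` contributes. -/
def symbolCoeff (θ : Matrix (Fin n) (Fin n) ℝ) (c : Idx n → Idx n → Mat N) (m l : Idx n)
    (v : Spin N) : Spin N :=
  ∑' p, (cocycle θ p m * cocycle θ (p + m) (l - p - m)) • c p (l - p - m) v

/-- `c` is a smooth symbol on `ℝⁿ \ {0}` with values in `Â ⊗ M_N(ℂ)` (smooth for the Fréchet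
topology), positively homogeneous of degree `r`. -/
structure IsHomogeneousSymbol (r : ℤ) (c : Cov n → Idx n → Idx n → Mat N) : Prop where
  smooth : ∀ p q, ContDiffOn ℝ ∞ (fun ξ => c ξ p q) {0}ᶜ
  bound : ∀ K : Set (Cov n), IsCompact K → K ⊆ {0}ᶜ → ∀ i s : ℕ, ∃ C : ℝ,
    ∀ ξ ∈ K, ∀ p q, (1 + ‖p‖ + ‖q‖) ^ s * ‖iteratedFDeriv ℝ i (fun η => c η p q) ξ‖ ≤ C
  homogeneous : ∀ t : ℝ, 0 < t → ∀ ξ : Cov n, ξ ≠ 0 → ∀ p q, c (t • ξ) p q = t ^ r • c ξ p q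

/-- `P` is a classical pseudodifferential operator of order `d` with symbol
`σ ~ ∑_{r ≤ d} σ_r`, where `σ_r` is homogeneous of degree `r`: one has
`P (U^m ⊗ v) ~ ∑_{r ≤ d} σ_r(m) (U^m ⊗ v)`, where the remainder after the terms of degree `> r` is
`O(|m|^r)` in `𝒜 · U^m`, in each seminorm of `𝒜`. -/
structure HasSymbol (θ : Matrix (Fin n) (Fin n) ℝ) (P : Module.End ℂ (SmoothSpinor n N)) (d : ℤ)
    (σ : ℤ → Cov n → Idx n → Idx n → Mat N) : Prop where
  homogeneous : ∀ r, IsHomogeneousSymbol r (σ r)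
  order : ∀ r, d < r → ∀ ξ p q, σ r ξ p q = 0
  expansion : ∀ r ≤ d, ∀ s : ℕ, ∃ C : ℝ, ∀ (m l : Idx n) (v : Spin N), m ≠ 0 →
    (1 + ‖l - m‖) ^ s *
      ‖(P (mono m v)).1 l - ∑ i ∈ Finset.Ioc r d, symbolCoeff θ (σ i (toCov m)) m l v‖
        ≤ C * ‖m‖ ^ r * ‖v‖

/-- The Wodzicki residue of an operator with symbol `σ`: the integral over the unit sphere of
`(τ ⊗ τ ⊗ Tr)(σ_{-n}(ξ))`. -/
def residue (σ : ℤ → Cov n → Idx n → Idx n → Mat N) : ℂ :=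
  ∫ ξ : Metric.sphere (0 : Cov n) 1,
    LinearMap.trace ℂ (Spin N) (σ (-(n : ℤ)) ξ.1 0 0).toLinearMap
      ∂((MeasureTheory.volume : MeasureTheory.Measure (Cov n)).toSphere)

end

end NCTorus

end

noncomputable section

namespace NCTorus

theorem lp_hasSum_sq {ι : Type} {V : Type} [NormedAddCommGroup V]
    (x : lp (fun _ : ι => V) 2) : HasSum (fun l => ‖x l‖ ^ 2) (‖x‖ ^ 2) := by
  have h := lp.hasSum_norm (p := 2) (by simp) x
  simpa using h

/-! ### The defining seminorms of the space of rapidly decreasing families -/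

section Seminorms
variable {n : ℕ} {V : Type} [NormedAddCommGroup V] [NormedSpace ℂ V]

/-- The weighted `ℓ¹` seminorm `∑ (1 + ‖p‖)^s ‖f p‖`. -/
def sn (s : ℕ) (f : Schw n V) : ℝ := ∑' p, (1 + ‖p‖) ^ s * ‖f.1 p‖

theorem sn_nonneg (s : ℕ) (f : Schw n V) : 0 ≤ sn s f :=
  tsum_nonneg fun p => by positivity

theorem le_sn (s : ℕ) (f : Schw n V) (l : Idx n) : (1 + ‖l‖) ^ s * ‖f.1 l‖ ≤ sn s f :=
  (f.2 s).le_tsum l fun p _ => by positivity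

theorem sn_add_le (s : ℕ) (f g : Schw n V) : sn s (f + g) ≤ sn s f + sn s g := by
  unfold sn
  rw [← (f.2 s).tsum_add (g.2 s)]
  refine ((f + g).2 s).tsum_le_tsum (fun p => ?_) ((f.2 s).add (g.2 s))
  rw [← mul_add]
  exact mul_le_mul_of_nonneg_left (norm_add_le _ _) (by positivity)

theorem sn_smul (s : ℕ) (c : ℂ) (f : Schw n V) : sn s (c • f) = ‖c‖ * sn s f := by
  unfold sn
  rw [← tsum_mul_left]
  refine tsum_congr fun p => ?_
  change (1 + ‖p‖) ^ s * ‖c • f.1 p‖ = _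
  rw [norm_smul]
  ring

@[simp] theorem sn_zero (s : ℕ) : sn s (0 : Schw n V) = 0 := by
  simpa using sn_smul s 0 (0 : Schw n V)

theorem sn_neg (s : ℕ) (f : Schw n V) : sn s (-f) = sn s f := by
  rw [← neg_one_smul ℂ f, sn_smul]
  simp

theorem sn_sub_le (s : ℕ) (f g : Schw n V) : sn s (f - g) ≤ sn s f + sn s g := by
  rw [sub_eq_add_neg, ← sn_neg s g]
  exact sn_add_le s f (-g)

theorem sn_mono {s t : ℕ} (h : s ≤ t) (f : Schw n V) : sn s f ≤ sn t f := by
  refine (f.2 s).tsum_le_tsum (fun p => ?_) (f.2 t)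
  have : (1 + ‖p‖) ^ s ≤ (1 + ‖p‖) ^ t :=
    pow_le_pow_right₀ (by linarith [norm_nonneg p]) h
  exact mul_le_mul_of_nonneg_right this (norm_nonneg _)

theorem summable_prod_pi {g : ℤ → ℝ} (hg : ∀ k, 0 ≤ g k) (h : Summable g) :
    ∀ m : ℕ, Summable fun l : Fin m → ℤ => ∏ i, g (l i)
  | 0 => Summable.of_finite
  | m + 1 => by
    have h2 := h.mul_of_nonneg (summable_prod_pi hg h m) hg
      (fun l => Finset.prod_nonneg fun i _ => hg _)
    refine ((Fin.consEquiv (fun _ : Fin (m + 1) => ℤ)).summable_iff).1 (h2.congr fun x => ?_)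
    simp [Fin.prod_univ_succ, Fin.consEquiv]

theorem summable_weight (n : ℕ) : Summable fun l : Idx n => ((1 + ‖l‖) ^ (2 * n))⁻¹ := by
  have h1 : Summable fun k : ℤ => ((1 + |(k : ℝ)|) ^ 2)⁻¹ := by
    have h0 : Summable fun k : ℤ => 1 / |(k : ℝ)| ^ 2 := by
      simpa using Real.summable_one_div_int_pow.2 (le_refl 2)
    have h3 : Summable fun k : ℤ => ∑ j ∈ ({0} : Finset ℤ), if k = j then (1 : ℝ) else 0 :=
      summable_of_ne_finset_zero (s := {0}) (by intro b hb; simpa using hb)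
    refine Summable.of_nonneg_of_le (fun k => by positivity) (fun k => ?_) (h0.add h3)
    by_cases hk : k = 0
    · simp [hk]
    · have : 0 < |(k : ℝ)| := by simpa using hk
      simp only [Finset.sum_singleton, hk, if_false, add_zero]
      rw [one_div]
      gcongr
      linarith
  refine Summable.of_nonneg_of_le (fun l => by positivity) (fun l => ?_)
    (summable_prod_pi (fun k => by positivity) h1 n)
  rw [Finset.prod_inv_distrib]
  refine inv_anti₀ (Finset.prod_pos fun i _ => by positivity) ?_
  rw [pow_mul]
  calc ∏ i, (1 + |((l i : ℤ) : ℝ)|) ^ 2 ≤ ∏ _i : Fin n, (1 + ‖l‖) ^ 2 := by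
        refine Finset.prod_le_prod (fun i _ => by positivity) fun i _ => ?_
        have := norm_le_pi_norm l i
        rw [Int.norm_eq_abs] at this
        gcongr
    _ = _ := by simp [← pow_mul]

/-- The sum of the summable weight used to pass from suprema to `ℓ¹` seminorms. -/
def weightSum (n : ℕ) : ℝ := ∑' l : Idx n, ((1 + ‖l‖) ^ (2 * n))⁻¹

theorem weightSum_nonneg (n : ℕ) : 0 ≤ weightSum n := tsum_nonneg fun l => by positivity

theorem weighted_le {y : ℝ} {s : ℕ} {C : ℝ} {l : Idx n}
    (h : (1 + ‖l‖) ^ (s + 2 * n) * y ≤ C) :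
    (1 + ‖l‖) ^ s * y ≤ C * ((1 + ‖l‖) ^ (2 * n))⁻¹ := by
  have h1 : 0 < (1 + ‖l‖) ^ (2 * n) := by positivity
  rw [← div_eq_mul_inv, le_div_iff₀ h1]
  calc _ = (1 + ‖l‖) ^ (s + 2 * n) * y := by rw [pow_add]; ring
    _ ≤ C := h

theorem mem_schw_of_bound {f : Idx n → V} (h : ∀ s : ℕ, ∃ C : ℝ, ∀ l, (1 + ‖l‖) ^ s * ‖f l‖ ≤ C) :
    f ∈ Schw n V := by
  intro s
  obtain ⟨C, hC⟩ := h (s + 2 * n)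
  exact Summable.of_nonneg_of_le (fun l => by positivity) (fun l => weighted_le (hC l))
    ((summable_weight n).mul_left C)

theorem sn_le_of_bound {f : Schw n V} {s : ℕ} {C : ℝ}
    (h : ∀ l, (1 + ‖l‖) ^ (s + 2 * n) * ‖f.1 l‖ ≤ C) : sn s f ≤ weightSum n * C := by
  rw [weightSum, ← tsum_mul_right]
  refine (f.2 s).tsum_le_tsum (fun l => ?_) ((summable_weight n).mul_right C)
  rw [mul_comm _ C]
  exact weighted_le (h l)

theorem toL2_apply (f : Schw n V) (l : Idx n) : toL2 f l = f.1 l := rfl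

theorem toL2_injective : Function.Injective (toL2 : Schw n V →ₗ[ℂ] L2 n V) := by
  intro f g h
  apply Subtype.ext
  funext l
  rw [← toL2_apply, h, toL2_apply]

theorem norm_toL2_le (f : Schw n V) : ‖toL2 f‖ ≤ sn 0 f := by
  refine lp.norm_le_of_forall_sum_le (by simp) (sn_nonneg _ _) fun t => ?_
  have h1 : ∀ l, ‖f.1 l‖ ≤ sn 0 f := fun l => by simpa using le_sn 0 f l
  have h2 : ∑ l ∈ t, ‖f.1 l‖ ≤ sn 0 f := by
    simpa [sn] using (f.2 0).sum_le_tsum t (fun p _ => by positivity)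
  simp only [ENNReal.toReal_ofNat, Real.rpow_ofNat, toL2_apply]
  calc ∑ l ∈ t, ‖f.1 l‖ ^ 2 ≤ ∑ l ∈ t, sn 0 f * ‖f.1 l‖ := by
        refine Finset.sum_le_sum fun l _ => ?_
        rw [sq]
        exact mul_le_mul_of_nonneg_right (h1 l) (norm_nonneg _)
    _ = sn 0 f * ∑ l ∈ t, ‖f.1 l‖ := by rw [Finset.mul_sum]
    _ ≤ sn 0 f * sn 0 f := mul_le_mul_of_nonneg_left h2 (sn_nonneg _ _)
    _ = _ := by ring

theorem sn_conv_le [CompleteSpace V] (w : Idx n → Idx n → ℂ) (hw : ∀ p q, ‖w p q‖ = 1)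
    (s : ℕ) (a : SmoothAlg n) (f : Schw n V) : sn s (convOp w hw a f) ≤ sn s a * sn s f := by
  have h := summable_weighted s a f
  have h1 : Summable fun x : Idx n × Idx n =>
      ((1 + ‖x.2‖) ^ s * ‖a.1 x.2‖) * ((1 + ‖x.1 - x.2‖) ^ s * ‖f.1 (x.1 - x.2)‖) :=
    ((Equiv.prodComm (Idx n) (Idx n)).summable_iff).2 h
  have h2 := (summable_prod_of_nonneg (fun x => by positivity)).1 h1
  have h6 : sn s (convOp w hw a f) ≤ ∑' l, ∑' p,
      ((1 + ‖p‖) ^ s * ‖a.1 p‖) * ((1 + ‖l - p‖) ^ s * ‖f.1 (l - p)‖) := by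
    refine ((convOp w hw a f).2 s).tsum_le_tsum (fun l => ?_) h2.2
    have h3 : ‖conv w a.1 f.1 l‖ ≤ ∑' p, ‖(w p (l - p) * a.1 p) • f.1 (l - p)‖ :=
      norm_tsum_le_tsum_norm (summable_conv w hw a f l)
    calc (1 + ‖l‖) ^ s * ‖conv w a.1 f.1 l‖
        ≤ (1 + ‖l‖) ^ s * ∑' p, ‖(w p (l - p) * a.1 p) • f.1 (l - p)‖ :=
          mul_le_mul_of_nonneg_left h3 (by positivity)
      _ = ∑' p, (1 + ‖l‖) ^ s * ‖(w p (l - p) * a.1 p) • f.1 (l - p)‖ := tsum_mul_left.symm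
      _ ≤ _ := by
        refine ((summable_conv w hw a f l).mul_left _).tsum_le_tsum (fun p => ?_) (h2.1 l)
        rw [norm_conv_term w hw]
        have h4 : (1 + ‖l‖) ^ s ≤ (1 + ‖p‖) ^ s * (1 + ‖l - p‖) ^ s := by
          rw [← mul_pow]
          refine pow_le_pow_left₀ (by positivity) ?_ s
          have h5 : ‖l‖ ≤ ‖p‖ + ‖l - p‖ := by
            calc ‖l‖ = ‖p + (l - p)‖ := by congr 1; abel
              _ ≤ _ := norm_add_le _ _
          nlinarith [norm_nonneg p, norm_nonneg (l - p)]
        calc (1 + ‖l‖) ^ s * (‖a.1 p‖ * ‖f.1 (l - p)‖)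
            ≤ ((1 + ‖p‖) ^ s * (1 + ‖l - p‖) ^ s) * (‖a.1 p‖ * ‖f.1 (l - p)‖) :=
              mul_le_mul_of_nonneg_right h4 (by positivity)
          _ = _ := by ring
  refine h6.trans (le_of_eq ?_)
  rw [← h1.tsum_prod' h2.1]
  have h7 : ∑' x : Idx n × Idx n, ((1 + ‖x.1‖) ^ s * ‖a.1 x.1‖) * ((1 + ‖x.2‖) ^ s * ‖f.1 x.2‖)
      = sn s a * sn s f :=
    (Summable.tsum_mul_tsum (a.2 s) (f.2 s) ((a.2 s).mul_of_nonneg (f.2 s)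
      (fun p => by positivity) (fun p => by positivity))).symm
  rw [← h7]
  let e : Idx n × Idx n ≃ Idx n × Idx n :=
    { toFun := fun x => (x.2, x.1 - x.2)
      invFun := fun x => (x.2 + x.1, x.1)
      left_inv := fun x => by simp
      right_inv := fun x => by simp }
  exact e.tsum_eq (fun x : Idx n × Idx n =>
    ((1 + ‖x.1‖) ^ s * ‖a.1 x.1‖) * ((1 + ‖x.2‖) ^ s * ‖f.1 x.2‖))

end Seminorms

/-! ### Bounded operators on the Hilbert space -/

section HilbertOps
variable {n : ℕ} {V : Type} [NormedAddCommGroup V] [NormedSpace ℂ V]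

theorem memLp_of_le {V V' : Type} [NormedAddCommGroup V] [NormedAddCommGroup V'] {f : Idx n → V}
    (g : L2 n V')
    {C : ℝ} (h : ∀ l, ‖f l‖ ≤ C * ‖g l‖) : Memℓp f 2 := by
  have h1 := (lp.memℓp g).norm.const_mul C
  exact h1.mono h

theorem norm_le_of_pointwise {V V' : Type} [NormedAddCommGroup V] [NormedAddCommGroup V'] {f : L2 n V} {g : L2 n V'}
    {C : ℝ} (hC : 0 ≤ C) (h : ∀ l, ‖f l‖ ≤ C * ‖g l‖) : ‖f‖ ≤ C * ‖g‖ := by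
  have h1 := (lp_hasSum_sq g).mul_left (C ^ 2)
  have h2 : ‖f‖ ^ 2 ≤ C ^ 2 * ‖g‖ ^ 2 := by
    refine hasSum_le (fun l => ?_) (lp_hasSum_sq f) h1
    rw [← mul_pow]
    exact pow_le_pow_left₀ (norm_nonneg _) (h l) 2
  rw [← mul_pow] at h2
  exact le_of_sq_le_sq h2 (by positivity)

/-- The diagonal operator with bounded matrix entries `φ l`. -/
def diagOp (φ : Idx n → V →L[ℂ] V) (C : ℝ) (h : ∀ l, ‖φ l‖ ≤ C) : L2 n V →L[ℂ] L2 n V :=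
  have h1 : ∀ (x : L2 n V) l, ‖φ l (x l)‖ ≤ C * ‖x l‖ := fun _ l => (φ l).le_of_opNorm_le (h l) _
  LinearMap.mkContinuous
    { toFun := fun x => ⟨fun l => φ l (x l), memLp_of_le x (h1 x)⟩
      map_add' := fun x y => lp.ext (funext fun l => map_add (φ l) (x l) (y l))
      map_smul' := fun c x => lp.ext (funext fun l => map_smul (φ l) c (x l)) } C
    (fun x => norm_le_of_pointwise ((norm_nonneg _).trans (h 0)) (h1 x))

theorem diagOp_apply (φ : Idx n → V →L[ℂ] V) (C : ℝ) (h : ∀ l, ‖φ l‖ ≤ C) (x : L2 n V)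
    (l : Idx n) : diagOp φ C h x l = φ l (x l) := rfl

/-- The translation by `p`, twisted by `w`. -/
def shiftOp (w : Idx n → Idx n → ℂ) (hw : ∀ p q, ‖w p q‖ = 1) (p : Idx n) :
    L2 n V →L[ℂ] L2 n V :=
  have h0 : ∀ x : L2 n V, HasSum (fun l => ‖w p (l - p) • x (l - p)‖ ^ 2) (‖x‖ ^ 2) := fun x => by
    have h := ((Equiv.subRight p).hasSum_iff).2 (lp_hasSum_sq x)
    refine h.congr_fun ?_
    intro l
    simp [norm_smul, hw]
  LinearMap.mkContinuous
    { toFun := fun x => ⟨fun l => w p (l - p) • x (l - p),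
        memℓp_gen (by simpa using (h0 x).summable)⟩
      map_add' := fun x y => lp.ext (funext fun l => smul_add (w p (l - p)) (x (l - p)) (y (l - p)))
      map_smul' := fun c x => lp.ext (funext fun l => smul_comm (w p (l - p)) c (x (l - p))) } 1
    (fun x => by
      rw [one_mul]
      refine le_of_sq_le_sq (le_of_eq ?_) (norm_nonneg _)
      exact (lp_hasSum_sq _).unique (h0 x))

theorem shiftOp_apply (w : Idx n → Idx n → ℂ) (hw : ∀ p q, ‖w p q‖ = 1) (p : Idx n)
    (x : L2 n V) (l : Idx n) : shiftOp w hw p x l = w p (l - p) • x (l - p) := rfl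

theorem norm_shiftOp_le (w : Idx n → Idx n → ℂ) (hw : ∀ p q, ‖w p q‖ = 1) (p : Idx n) :
    ‖(shiftOp w hw p : L2 n V →L[ℂ] L2 n V)‖ ≤ 1 := by
  unfold shiftOp
  exact LinearMap.mkContinuous_norm_le _ zero_le_one _

theorem summable_shift (w : Idx n → Idx n → ℂ) (hw : ∀ p q, ‖w p q‖ = 1) (a : SmoothAlg n) :
    Summable fun p => ‖a.1 p • (shiftOp w hw p : L2 n V →L[ℂ] L2 n V)‖ := by
  refine Summable.of_nonneg_of_le (fun p => norm_nonneg _) (fun p => ?_) (schw_summable_norm a)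
  rw [norm_smul]
  exact mul_le_of_le_one_right (norm_nonneg _) (norm_shiftOp_le w hw p)

theorem convL2_apply_norm_summable (w : Idx n → Idx n → ℂ) (hw : ∀ p q, ‖w p q‖ = 1)
    (a : SmoothAlg n) (x : L2 n V) (l : Idx n) :
    Summable fun p => ‖(w p (l - p) * a.1 p) • x (l - p)‖ := by
  refine Summable.of_nonneg_of_le (fun p => norm_nonneg _) (fun p => ?_)
    ((schw_summable_norm a).mul_right ‖x‖)
  rw [norm_smul, norm_mul, hw, one_mul]
  exact mul_le_mul_of_nonneg_left (lp.norm_apply_le_norm (by simp) _ _) (norm_nonneg _)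

/-- Twisted convolution as a bounded operator. -/
def convL2 (w : Idx n → Idx n → ℂ) (hw : ∀ p q, ‖w p q‖ = 1) (a : SmoothAlg n) :
    L2 n V →L[ℂ] L2 n V := ∑' p, a.1 p • shiftOp w hw p

theorem norm_convL2_le (w : Idx n → Idx n → ℂ) (hw : ∀ p q, ‖w p q‖ = 1) (a : SmoothAlg n) :
    ‖(convL2 w hw a : L2 n V →L[ℂ] L2 n V)‖ ≤ sn 0 a := by
  have hs := summable_shift (V := V) w hw a
  refine (norm_tsum_le_tsum_norm hs).trans ?_
  have h0 : Summable fun p => ‖a.1 p‖ := schw_summable_norm a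
  have : sn 0 a = ∑' p, ‖a.1 p‖ := by simp [sn]
  rw [this]
  refine hs.tsum_le_tsum (fun p => ?_) h0
  rw [norm_smul]
  exact mul_le_of_le_one_right (norm_nonneg _) (norm_shiftOp_le w hw p)

variable [CompleteSpace V]

theorem convL2_hasSum (w : Idx n → Idx n → ℂ) (hw : ∀ p q, ‖w p q‖ = 1) (a : SmoothAlg n)
    (x : L2 n V) : HasSum (fun p => a.1 p • shiftOp w hw p x) (convL2 w hw a x) := by
  have h := (summable_shift (V := V) w hw a).of_norm.hasSum
  exact h.mapL (ContinuousLinearMap.apply ℂ (L2 n V) x)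

theorem convL2_apply_hasSum (w : Idx n → Idx n → ℂ) (hw : ∀ p q, ‖w p q‖ = 1) (a : SmoothAlg n)
    (x : L2 n V) (l : Idx n) :
    HasSum (fun p => (w p (l - p) * a.1 p) • x (l - p)) (convL2 w hw a x l) := by
  have h := (convL2_hasSum w hw a x).mapL (lp.evalCLM ℂ (fun _ : Idx n => V) 2 l)
  refine h.congr_fun fun p => ?_
  change _ = a.1 p • (w p (l - p) • x (l - p))
  rw [smul_smul, mul_comm]

theorem convL2_toL2 (w : Idx n → Idx n → ℂ) (hw : ∀ p q, ‖w p q‖ = 1) (a : SmoothAlg n)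
    (f : Schw n V) : convL2 w hw a (toL2 f) = toL2 (convOp w hw a f) :=
  lp.ext (funext fun l => (convL2_apply_hasSum w hw a (toL2 f) l).tsum_eq.symm)

/-- Young's inequality `‖b * z‖₂ ≤ ‖b‖₁ ‖z‖₂`, for a function dominated by a convolution. -/
theorem young {V : Type} [NormedAddCommGroup V] (b : SmoothAlg n) (z y : L2 n V)
    (h : ∀ l, ‖y l‖ ≤ ∑' p, ‖b.1 p‖ * ‖z (l - p)‖) :
    ‖y‖ ≤ sn 0 b * ‖z‖ := by
  let b' : SmoothAlg n := ⟨fun p => (‖b.1 p‖ : ℂ), fun s => by simpa using b.2 s⟩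
  let z' : L2 n ℂ := ⟨fun p => (‖z p‖ : ℂ), (lp.memℓp z).norm.mono fun l => by simp⟩
  have hz : ‖z'‖ ≤ ‖z‖ := by
    simpa using norm_le_of_pointwise (f := z') (g := z) zero_le_one (fun l => by simp [z'])
  let c := convL2 (V := ℂ) (fun _ _ => 1) (fun _ _ => by simp) b' z'
  have hc : ∀ l, c l = ((∑' p, ‖b.1 p‖ * ‖z (l - p)‖ : ℝ) : ℂ) := fun l => by
    have := convL2_apply_hasSum (V := ℂ) (fun _ _ => 1) (fun _ _ => by simp) b' z' l
    rw [Complex.ofReal_tsum]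
    refine (this.congr_fun fun p => ?_).tsum_eq.symm
    simp [b', z']
  have h1 : ‖y‖ ≤ 1 * ‖c‖ := by
    refine norm_le_of_pointwise zero_le_one fun l => ?_
    rw [hc, one_mul, Complex.norm_real]
    exact (h l).trans (Real.le_norm_self _)
  have h2 : ‖c‖ ≤ sn 0 b' * ‖z'‖ :=
    ContinuousLinearMap.le_of_opNorm_le _ (norm_convL2_le _ _ b') z'
  have h3 : sn 0 b' = sn 0 b := by simp [sn, b']
  rw [h3] at h2
  calc ‖y‖ ≤ ‖c‖ := by simpa using h1
    _ ≤ _ := h2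
    _ ≤ _ := mul_le_mul_of_nonneg_left hz (sn_nonneg _ _)

end HilbertOps

/-! ### Truncated weights -/

section Weights
variable {n : ℕ} {V : Type} [NormedAddCommGroup V] [NormedSpace ℂ V]

/-- The truncation `min (1 + ‖l‖) (M + 1)` of the weight `1 + ‖l‖`. -/
def wt (M : ℕ) (l : Idx n) : ℝ := min (1 + ‖l‖) (M + 1)

theorem one_le_wt (M : ℕ) (l : Idx n) : 1 ≤ wt M l :=
  le_min (by linarith [norm_nonneg l]) (by linarith [(Nat.cast_nonneg M : (0 : ℝ) ≤ M)])

theorem wt_pos (M : ℕ) (l : Idx n) : 0 < wt M l := zero_lt_one.trans_le (one_le_wt M l)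

theorem wt_le (M : ℕ) (l : Idx n) : wt M l ≤ 1 + ‖l‖ := min_le_left _ _

theorem norm_le_norm_add_norm_sub (l p : Idx n) : ‖l‖ ≤ ‖p‖ + ‖l - p‖ := by
  calc ‖l‖ = ‖p + (l - p)‖ := by congr 1; abel
    _ ≤ _ := norm_add_le _ _

theorem wt_le_add (M : ℕ) (l p : Idx n) : wt M l ≤ ‖p‖ + wt M (l - p) := by
  have h := norm_le_norm_add_norm_sub l p
  unfold wt
  rcases min_cases (1 + ‖l - p‖) ((M : ℝ) + 1) with ⟨h1, -⟩ | ⟨h1, -⟩ <;> rw [h1]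
  · exact (min_le_left _ _).trans (by linarith)
  · exact (min_le_right _ _).trans (by linarith [norm_nonneg p])

theorem wt_sub_le (M : ℕ) (l p : Idx n) : wt M (l - p) ≤ ‖p‖ + wt M l := by
  simpa using wt_le_add M (l - p) (-p)

theorem wt_le_mul (M : ℕ) (l p : Idx n) : wt M l ≤ (1 + ‖p‖) * wt M (l - p) := by
  nlinarith [wt_le_add M l p, one_le_wt M (l - p), norm_nonneg p]

theorem abs_wt_pow_sub_le (M s : ℕ) (l p : Idx n) :
    |wt M l ^ (s + 1) - wt M (l - p) ^ (s + 1)| ≤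
      ((s + 1 : ℕ) * (1 + ‖p‖) ^ (s + 1)) * wt M (l - p) ^ s := by
  have h0 : |wt M l - wt M (l - p)| ≤ 1 + ‖p‖ := by
    rw [abs_le]
    constructor <;> linarith [wt_le_add M l p, wt_sub_le M l p]
  have h1 : max |wt M l| |wt M (l - p)| ≤ (1 + ‖p‖) * wt M (l - p) := by
    rw [abs_of_pos (wt_pos _ _), abs_of_pos (wt_pos _ _)]
    refine max_le (wt_le_mul M l p) ?_
    nlinarith [one_le_wt M (l - p), norm_nonneg p]
  calc _ ≤ |wt M l - wt M (l - p)| * (s + 1 : ℕ) * max |wt M l| |wt M (l - p)| ^ s :=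
        abs_pow_sub_pow_le _ _ _
    _ ≤ (1 + ‖p‖) * (s + 1 : ℕ) * ((1 + ‖p‖) * wt M (l - p)) ^ s := by gcongr
    _ = _ := by rw [mul_pow]; ring

/-- Multiplication by the truncated weight to the power `s`. -/
def W (M s : ℕ) : L2 n V →L[ℂ] L2 n V :=
  diagOp (fun l => ((wt M l ^ s : ℝ) : ℂ) • ContinuousLinearMap.id ℂ V) ((M + 1 : ℝ) ^ s)
    (fun l => by
      rw [norm_smul, Complex.norm_real, Real.norm_of_nonneg (pow_nonneg (wt_pos M l).le s)]
      calc _ ≤ wt M l ^ s * 1 :=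
            mul_le_mul_of_nonneg_left ContinuousLinearMap.norm_id_le (pow_nonneg (wt_pos M l).le s)
        _ ≤ _ := by
            rw [mul_one]
            exact pow_le_pow_left₀ (wt_pos M l).le (min_le_right _ _) s)

theorem W_apply (M s : ℕ) (x : L2 n V) (l : Idx n) :
    W M s x l = ((wt M l ^ s : ℝ) : ℂ) • x l := rfl

theorem norm_W_apply (M s : ℕ) (x : L2 n V) (l : Idx n) :
    ‖W M s x l‖ = wt M l ^ s * ‖x l‖ := by
  rw [W_apply, norm_smul, Complex.norm_real, Real.norm_of_nonneg (pow_nonneg (wt_pos M l).le s)]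

theorem W_zero (M : ℕ) (x : L2 n V) : W M 0 x = x :=
  lp.ext (funext fun l => by simp [W_apply])

theorem norm_W_mono (M : ℕ) {s t : ℕ} (h : s ≤ t) (x : L2 n V) : ‖W M s x‖ ≤ ‖W M t x‖ := by
  refine lp.norm_mono (by simp) fun l => ?_
  rw [norm_W_apply, norm_W_apply]
  exact mul_le_mul_of_nonneg_right (pow_le_pow_right₀ (one_le_wt M l) h) (norm_nonneg _)

theorem norm_le_norm_W (M s : ℕ) (x : L2 n V) : ‖x‖ ≤ ‖W M s x‖ := by
  simpa [W_zero] using norm_W_mono M (Nat.zero_le s) x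

/-- The family `(1 + ‖p‖)^s a_p`. -/
def weightMul (s : ℕ) (a : Schw n V) : Schw n V :=
  ⟨fun p => (((1 + ‖p‖) ^ s : ℝ) : ℂ) • a.1 p, fun t => by
    refine (a.2 (t + s)).congr fun p => ?_
    rw [norm_smul, Complex.norm_real, Real.norm_of_nonneg (by positivity), pow_add]
    ring⟩

theorem norm_weightMul (s : ℕ) (a : Schw n V) (p : Idx n) :
    ‖(weightMul s a).1 p‖ = (1 + ‖p‖) ^ s * ‖a.1 p‖ := by
  change ‖(((1 + ‖p‖) ^ s : ℝ) : ℂ) • a.1 p‖ = _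
  rw [norm_smul, Complex.norm_real, Real.norm_of_nonneg (by positivity)]

theorem sn_weightMul (s t : ℕ) (a : Schw n V) : sn t (weightMul s a) = sn (t + s) a := by
  unfold sn
  refine tsum_congr fun p => ?_
  rw [norm_weightMul, pow_add]
  ring

theorem norm_W_toL2_le (M s : ℕ) (f : Schw n V) : ‖W M s (toL2 f)‖ ≤ sn s f := by
  have h1 : ‖W M s (toL2 f)‖ ≤ ‖toL2 (weightMul s f)‖ := by
    refine lp.norm_mono (by simp) fun l => ?_
    rw [norm_W_apply, toL2_apply, toL2_apply, norm_weightMul]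
    exact mul_le_mul_of_nonneg_right (pow_le_pow_left₀ (wt_pos M l).le (wt_le M l) s)
      (norm_nonneg _)
  refine h1.trans ((norm_toL2_le _).trans ?_)
  rw [sn_weightMul, zero_add]

theorem pointwise_of_W_bound {s : ℕ} {x : L2 n V} {C : ℝ} (h : ∀ M, ‖W M s x‖ ≤ C) (l : Idx n) :
    (1 + ‖l‖) ^ s * ‖x l‖ ≤ C := by
  obtain ⟨M, hM⟩ := exists_nat_ge ‖l‖
  have h1 : wt M l = 1 + ‖l‖ := min_eq_left (by linarith)
  calc _ = ‖W M s x l‖ := by rw [norm_W_apply, h1]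
    _ ≤ ‖W M s x‖ := lp.norm_apply_le_norm (by simp) _ _
    _ ≤ C := h M

/-- A vector with bounds on all truncated weighted norms is smooth. -/
theorem exists_schw_of_W_bound {x : L2 n V} (h : ∀ s, ∃ C, ∀ M, ‖W M s x‖ ≤ C) :
    ∃ f : Schw n V, toL2 f = x := by
  refine ⟨⟨x, mem_schw_of_bound fun s => ?_⟩, rfl⟩
  obtain ⟨C, hC⟩ := h s
  exact ⟨C, pointwise_of_W_bound hC⟩

theorem sn_le_of_W_bound {f : Schw n V} {s : ℕ} {C : ℝ}
    (h : ∀ M, ‖W M (s + 2 * n) (toL2 f)‖ ≤ C) : sn s f ≤ weightSum n * C :=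
  sn_le_of_bound fun l => pointwise_of_W_bound h l

/-- `A` gains `a` derivatives. -/
def Gains (a : ℕ) (A : L2 n V →L[ℂ] L2 n V) : Prop :=
  ∀ s, ∃ C, 0 ≤ C ∧ ∀ M x, ‖W M (s + a) (A x)‖ ≤ C * ‖W M s x‖

/-- The commutators of `A` with the weights are of lower order. -/
def CommLower (A : L2 n V →L[ℂ] L2 n V) : Prop :=
  ∀ s, ∃ C, 0 ≤ C ∧ ∀ M x, ‖W M (s + 1) (A x) - A (W M (s + 1) x)‖ ≤ C * ‖W M s x‖

theorem Gains.comp {a b : ℕ} {A B : L2 n V →L[ℂ] L2 n V} (hA : Gains a A) (hB : Gains b B) :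
    Gains (b + a) (A * B) := by
  intro s
  obtain ⟨C, hC, h⟩ := hB s
  obtain ⟨C', hC', h'⟩ := hA (s + b)
  refine ⟨C' * C, by positivity, fun M x => ?_⟩
  rw [← add_assoc, mul_assoc]
  calc _ ≤ C' * ‖W M (s + b) (B x)‖ := h' M (B x)
    _ ≤ C' * (C * ‖W M s x‖) := by gcongr; exact h M x

theorem Gains.comp' {a b : ℕ} {A B : L2 n V →L[ℂ] L2 n V} (hA : Gains a A) (hB : Gains b B) :
    Gains (a + b) (A * B) := by
  rw [add_comm]
  exact hA.comp hB

theorem Gains.mono {a b : ℕ} (hab : a ≤ b) {A : L2 n V →L[ℂ] L2 n V} (hA : Gains b A) :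
    Gains a A := fun s => by
  obtain ⟨C, hC, h⟩ := hA s
  exact ⟨C, hC, fun M x => (norm_W_mono M (by omega) _).trans (h M x)⟩

theorem Gains.sub {a : ℕ} {A B : L2 n V →L[ℂ] L2 n V} (hA : Gains a A) (hB : Gains a B) :
    Gains a (A - B) := by
  intro s
  obtain ⟨C, hC, h⟩ := hB s
  obtain ⟨C', hC', h'⟩ := hA s
  refine ⟨C' + C, by positivity, fun M x => ?_⟩
  rw [sub_apply, map_sub, add_mul]
  exact (norm_sub_le _ _).trans (add_le_add (h' M x) (h M x))

theorem gains_one : Gains 0 (1 : L2 n V →L[ℂ] L2 n V) :=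
  fun _ => ⟨1, zero_le_one, fun M x => by simp⟩

theorem Gains.pow {a : ℕ} {A : L2 n V →L[ℂ] L2 n V} (hA : Gains a A) :
    ∀ j : ℕ, Gains (j * a) (A ^ j)
  | 0 => by simpa using gains_one
  | j + 1 => by
    rw [pow_succ', add_mul, one_mul]
    exact hA.comp (hA.pow j)

theorem CommLower.comp {A B : L2 n V →L[ℂ] L2 n V} (hA : CommLower A) (hB : CommLower B)
    (hB0 : Gains 0 B) : CommLower (A * B) := by
  intro s
  obtain ⟨C, hC, h⟩ := hA s
  obtain ⟨C', hC', h'⟩ := hB s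
  obtain ⟨C0, hC0, h0⟩ := hB0 s
  refine ⟨C * C0 + ‖A‖ * C', by positivity, fun M x => ?_⟩
  have e : W M (s + 1) ((A * B) x) - (A * B) (W M (s + 1) x) =
      (W M (s + 1) (A (B x)) - A (W M (s + 1) (B x)))
        + A (W M (s + 1) (B x) - B (W M (s + 1) x)) := by
    rw [map_sub]
    simp
  rw [e]
  calc _ ≤ C * ‖W M s (B x)‖ + ‖A‖ * (C' * ‖W M s x‖) := by
        refine (norm_add_le _ _).trans (add_le_add (h M (B x)) ?_)
        exact (A.le_opNorm _).trans (by gcongr; exact h' M x)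
    _ ≤ C * (C0 * ‖W M s x‖) + ‖A‖ * (C' * ‖W M s x‖) := by gcongr; exact h0 M x
    _ = _ := by ring

/-- A weighted estimate for operators bounded below, with constants that depend only on the
constants of the hypotheses. -/
theorem weighted_estimate_of_bounded_below {c : ℝ} (hc : 0 < c) (D : ℕ → ℝ) (hD : ∀ s, 0 ≤ D s)
    (s : ℕ) : ∃ C, 0 ≤ C ∧ ∀ (ρ : ℝ) (L : L2 n V →L[ℂ] L2 n V), 0 < ρ →
      (∀ x, c * ρ * ‖x‖ ≤ ‖L x‖) →
      (∀ s M x, ‖W M (s + 1) (L x) - L (W M (s + 1) x)‖ ≤ ρ * D s * ‖W M s x‖) →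
      ∀ M x, ρ * ‖W M s x‖ ≤ C * ‖W M s (L x)‖ := by
  induction s with
  | zero =>
    refine ⟨c⁻¹, by positivity, fun ρ L hρ h1 h2 M x => ?_⟩
    rw [W_zero, W_zero, inv_mul_eq_div, le_div_iff₀ hc]
    linarith [h1 x]
  | succ s ih =>
    obtain ⟨C, hC, h⟩ := ih
    refine ⟨c⁻¹ * (1 + D s * C), by have := hD s; positivity, fun ρ L hρ h1 h2 M x => ?_⟩
    have h3 := h ρ L hρ h1 h2 M x
    have h4 := h1 (W M (s + 1) x)
    have h5 : ‖L (W M (s + 1) x)‖ ≤ ‖W M (s + 1) (L x)‖ + ρ * D s * ‖W M s x‖ := by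
      have e : L (W M (s + 1) x) =
          W M (s + 1) (L x) - (W M (s + 1) (L x) - L (W M (s + 1) x)) := by abel
      rw [e]
      exact (norm_sub_le _ _).trans (add_le_add le_rfl (h2 s M x))
    have h6 : ‖W M s (L x)‖ ≤ ‖W M (s + 1) (L x)‖ := norm_W_mono M (Nat.le_succ s) _
    rw [mul_assoc, inv_mul_eq_div, le_div_iff₀ hc]
    have h7 : ρ * D s * ‖W M s x‖ ≤ D s * (C * ‖W M (s + 1) (L x)‖) := by
      calc _ = D s * (ρ * ‖W M s x‖) := by ring
        _ ≤ D s * (C * ‖W M s (L x)‖) := mul_le_mul_of_nonneg_left h3 (hD s)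
        _ ≤ _ := mul_le_mul_of_nonneg_left (mul_le_mul_of_nonneg_left h6 hC) (hD s)
    linarith

variable [CompleteSpace V]

theorem convL2_gains (w : Idx n → Idx n → ℂ) (hw : ∀ p q, ‖w p q‖ = 1) (a : SmoothAlg n) :
    Gains 0 (convL2 w hw a : L2 n V →L[ℂ] L2 n V) := by
  intro s
  refine ⟨sn 0 (weightMul s a), sn_nonneg _ _, fun M x => young _ _ _ fun l => ?_⟩
  have hs := convL2_apply_hasSum w hw a x l
  have hz := convL2_apply_norm_summable w hw (weightMul s a) (W M s x) l
  have e : ∀ p, ‖(w p (l - p) * (weightMul s a).1 p) • W M s x (l - p)‖ =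
      ‖(weightMul s a).1 p‖ * ‖W M s x (l - p)‖ := fun p => norm_conv_term w hw _ _ l p
  rw [norm_W_apply, add_zero, ← hs.tsum_eq]
  simp only [e] at hz
  have hn : Summable fun p => wt M l ^ s * ‖(w p (l - p) * a.1 p) • x (l - p)‖ :=
    (convL2_apply_norm_summable w hw a x l).mul_left _
  refine (mul_le_mul_of_nonneg_left (norm_tsum_le_tsum_norm
    (convL2_apply_norm_summable w hw a x l))
    (pow_nonneg (wt_pos M l).le s)).trans ?_
  rw [← tsum_mul_left]
  refine hn.tsum_le_tsum (fun p => ?_) hz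
  rw [norm_conv_term w hw a.1 x l p, norm_weightMul, norm_W_apply]
  have h2 : wt M l ^ s ≤ (1 + ‖p‖) ^ s * wt M (l - p) ^ s := by
    rw [← mul_pow]
    exact pow_le_pow_left₀ (wt_pos M l).le (wt_le_mul M l p) s
  calc _ ≤ ((1 + ‖p‖) ^ s * wt M (l - p) ^ s) * (‖a.1 p‖ * ‖x (l - p)‖) := by gcongr
    _ = _ := by ring

theorem convL2_commLower (w : Idx n → Idx n → ℂ) (hw : ∀ p q, ‖w p q‖ = 1) (a : SmoothAlg n) :
    CommLower (convL2 w hw a : L2 n V →L[ℂ] L2 n V) := by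
  intro s
  set b : SmoothAlg n := ((s + 1 : ℕ) : ℂ) • weightMul (s + 1) a with hb
  have hbn : ∀ p, ‖b.1 p‖ = (s + 1 : ℕ) * ((1 + ‖p‖) ^ (s + 1) * ‖a.1 p‖) := fun p => by
    change ‖((s + 1 : ℕ) : ℂ) • (weightMul (s + 1) a).1 p‖ = _
    rw [norm_smul, norm_weightMul, Complex.norm_natCast]
  refine ⟨sn 0 b, sn_nonneg _ _, fun M x => young _ _ _ fun l => ?_⟩
  have hs := (convL2_apply_hasSum w hw a x l).const_smul (((wt M l ^ (s + 1) : ℝ) : ℂ))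
  have hs2 := convL2_apply_hasSum w hw a (W M (s + 1) x) l
  have hz := convL2_apply_norm_summable w hw b (W M s x) l
  have e : ∀ p, ‖(w p (l - p) * b.1 p) • W M s x (l - p)‖ =
      ‖b.1 p‖ * ‖W M s x (l - p)‖ := fun p => norm_conv_term w hw _ _ l p
  simp only [e] at hz
  have hd := hs.sub hs2
  change ‖W M (s + 1) (convL2 w hw a x) l - convL2 w hw a (W M (s + 1) x) l‖ ≤ _
  rw [W_apply, ← hd.tsum_eq]
  refine tsum_of_norm_bounded hz.hasSum fun p => ?_
  have e2 : ((wt M l ^ (s + 1) : ℝ) : ℂ) • ((w p (l - p) * a.1 p) • x (l - p)) -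
      (w p (l - p) * a.1 p) • W M (s + 1) x (l - p) =
      ((wt M l ^ (s + 1) - wt M (l - p) ^ (s + 1) : ℝ) : ℂ) •
        ((w p (l - p) * a.1 p) • x (l - p)) := by
    rw [W_apply, smul_comm (w p (l - p) * a.1 p), ← sub_smul, Complex.ofReal_sub]
  rw [e2, norm_smul, norm_conv_term w hw a.1 x l p, Complex.norm_real, Real.norm_eq_abs, hbn,
    norm_W_apply]
  calc _ ≤ (((s + 1 : ℕ) * (1 + ‖p‖) ^ (s + 1)) * wt M (l - p) ^ s) * (‖a.1 p‖ * ‖x (l - p)‖) :=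
        mul_le_mul_of_nonneg_right (abs_wt_pow_sub_le M s l p) (by positivity)
    _ = _ := by ring

end Weights

/-! ### The cocycle -/

section Cocycle
variable {n : ℕ} (θ : Matrix (Fin n) (Fin n) ℝ)

theorem pairing_add_left (p p' q : Idx n) :
    pairing θ (p + p') q = pairing θ p q + pairing θ p' q := by
  simp only [pairing, ← Finset.sum_add_distrib]
  refine Finset.sum_congr rfl fun i _ => Finset.sum_congr rfl fun j _ => ?_
  simp only [Pi.add_apply, Int.cast_add]
  ring

theorem pairing_add_right (p q q' : Idx n) :
    pairing θ p (q + q') = pairing θ p q + pairing θ p q' := by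
  simp only [pairing, ← Finset.sum_add_distrib]
  refine Finset.sum_congr rfl fun i _ => Finset.sum_congr rfl fun j _ => ?_
  simp only [Pi.add_apply, Int.cast_add]
  ring

theorem pairing_swap (hθ : θ.transpose = -θ) (p q : Idx n) : pairing θ p q = -pairing θ q p := by
  simp only [pairing, ← Finset.sum_neg_distrib]
  rw [Finset.sum_comm]
  refine Finset.sum_congr rfl fun i _ => Finset.sum_congr rfl fun j _ => ?_
  have h : θ j i = -θ i j := congrFun (congrFun hθ i) j
  rw [h]
  ring

theorem cocycle_add_left (p p' q : Idx n) :
    cocycle θ (p + p') q = cocycle θ p q * cocycle θ p' q := by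
  simp only [cocycle, pairing_add_left, ← Complex.exp_add]
  congr 1
  push_cast
  ring

theorem cocycle_add_right (p q q' : Idx n) :
    cocycle θ p (q + q') = cocycle θ p q * cocycle θ p q' := by
  simp only [cocycle, pairing_add_right, ← Complex.exp_add]
  congr 1
  push_cast
  ring

@[simp] theorem cocycle_zero_left (q : Idx n) : cocycle θ 0 q = 1 := by
  simp [cocycle, pairing]

@[simp] theorem cocycle_zero_right (q : Idx n) : cocycle θ q 0 = 1 := by
  simp [cocycle, pairing]

theorem cocycle_ne_zero (p q : Idx n) : cocycle θ p q ≠ 0 := Complex.exp_ne_zero _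

theorem cocycle_neg_left (p q : Idx n) : cocycle θ (-p) q = (cocycle θ p q)⁻¹ := by
  refine eq_inv_of_mul_eq_one_left ?_
  rw [← cocycle_add_left, neg_add_cancel, cocycle_zero_left]

theorem cocycle_neg_right (p q : Idx n) : cocycle θ p (-q) = (cocycle θ p q)⁻¹ := by
  refine eq_inv_of_mul_eq_one_left ?_
  rw [← cocycle_add_right, neg_add_cancel, cocycle_zero_right]

theorem star_cocycle (p q : Idx n) : star (cocycle θ p q) = (cocycle θ p q)⁻¹ :=
  (Complex.inv_eq_conj (norm_cocycle θ p q)).symm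

theorem cocycle_self (hθ : θ.transpose = -θ) (p : Idx n) : cocycle θ p p = 1 := by
  have h : pairing θ p p = 0 := by linarith [pairing_swap θ hθ p p]
  simp [cocycle, h]

theorem cocycle_swap (hθ : θ.transpose = -θ) (p q : Idx n) :
    cocycle θ p q = (cocycle θ q p)⁻¹ := by
  rw [← star_cocycle]
  simp only [cocycle, pairing_swap θ hθ p q]
  change _ = (starRingEnd ℂ) _
  rw [← Complex.exp_conj]
  simp

end Cocycle

/-! ### Adjoints, density and positivity -/

section Adjoint
variable {n : ℕ} {V : Type} [NormedAddCommGroup V] [InnerProductSpace ℂ V]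

theorem inner_shiftOp (w : Idx n → Idx n → ℂ) (hw : ∀ p q, ‖w p q‖ = 1)
    (hadj : ∀ p l, star (w p l) = w (-p) (l + p)) (p : Idx n) (x y : L2 n V) :
    inner ℂ (shiftOp w hw p x) y = inner ℂ x (shiftOp w hw (-p) y) := by
  have h1 := lp.hasSum_inner (𝕜 := ℂ) (shiftOp w hw p x) y
  have h2 := lp.hasSum_inner (𝕜 := ℂ) x (shiftOp w hw (-p) y)
  refine h1.unique (((Equiv.subRight p).hasSum_iff).2 h2 |>.congr_fun fun l => ?_)
  simp only [shiftOp_apply, Function.comp_apply, Equiv.subRight_apply, sub_neg_eq_add,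
    sub_add_cancel, inner_smul_left, inner_smul_right]
  congr 1
  have := hadj p (l - p)
  rw [sub_add_cancel] at this
  exact this

theorem inner_convL2 [CompleteSpace V] (w : Idx n → Idx n → ℂ) (hw : ∀ p q, ‖w p q‖ = 1)
    (hadj : ∀ p l, star (w p l) = w (-p) (l + p)) (a : SmoothAlg n)
    (ha : ∀ p, a.1 (-p) = star (a.1 p)) (x y : L2 n V) :
    inner ℂ (convL2 w hw a x) y = inner ℂ x (convL2 w hw a y) := by
  have h1 := (convL2_hasSum w hw a x).mapL (innerSL ℂ y)
  have h2 := ((Equiv.neg (Idx n)).hasSum_iff).2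
    ((convL2_hasSum w hw a y).mapL (innerSL ℂ x))
  have h3 := congrArg (starRingEnd ℂ) h1.tsum_eq
  rw [← inner_conj_symm, ← innerSL_apply_apply, ← h1.tsum_eq, ← innerSL_apply_apply,
    ← h2.tsum_eq, Complex.conj_tsum]
  refine tsum_congr fun p => ?_
  simp only [innerSL_apply_apply, Function.comp_apply, Equiv.neg_apply, inner_smul_right, map_mul,
    inner_conj_symm]
  rw [inner_shiftOp w hw hadj, ha p]
  rfl

theorem denseRange_toL2 {V : Type} [NormedAddCommGroup V] [NormedSpace ℂ V] :
    DenseRange (toL2 : Schw n V →ₗ[ℂ] L2 n V) := by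
  classical
  intro x
  have h := lp.hasSum_single (p := 2) (by simp) x
  refine mem_closure_of_tendsto h (Filter.Eventually.of_forall fun t => ?_)
  refine ⟨⟨fun l => if l ∈ t then x l else 0, fun s => ?_⟩, lp.ext (funext fun l => ?_)⟩
  · exact summable_of_ne_finset_zero (s := t) fun l hl => by simp [hl]
  · change (if l ∈ t then x l else 0) = _
    rw [lp.coeFn_sum, Finset.sum_apply]
    simp only [lp.single_apply, Finset.sum_pi_single]

/-- A component of a spinor. -/
def component {N : ℕ} (i : Fin N) (x : L2 n (Spin N)) : L2 n ℂ :=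
  ⟨fun l => x l i, memLp_of_le (C := 1) x fun l => by
    rw [one_mul]; exact PiLp.norm_apply_le (x l) i⟩

theorem sum_inner_component {N : ℕ} (x y : L2 n (Spin N)) :
    inner ℂ x y = ∑ i, inner ℂ (component i x) (component i y) := by
  have h : ∀ i, HasSum (fun l => inner ℂ (x l i) (y l i))
      (inner ℂ (component i x) (component i y) : ℂ) := fun i =>
    lp.hasSum_inner (component i x) (component i y)
  refine (lp.hasSum_inner x y).unique ?_
  refine (hasSum_sum fun i _ => h i).congr_fun fun l => ?_
  rw [PiLp.inner_apply]

theorem component_convL2 {N : ℕ} (w : Idx n → Idx n → ℂ) (hw : ∀ p q, ‖w p q‖ = 1)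
    (a : SmoothAlg n) (i : Fin N) (x : L2 n (Spin N)) :
    component i (convL2 w hw a x) = convL2 w hw a (component i x) := by
  refine lp.ext (funext fun l => ?_)
  have h := (convL2_apply_hasSum w hw a x l).mapL (EuclideanSpace.proj (𝕜 := ℂ) i)
  exact h.unique (convL2_apply_hasSum w hw a (component i x) l)

/-- A symmetric operator that is bounded below is invertible. -/
theorem isUnit_of_bounded_below {H : Type*} [NormedAddCommGroup H] [InnerProductSpace ℂ H]
    [CompleteSpace H] {L : H →L[ℂ] H} {c : ℝ} (hc : 0 < c) (h : ∀ x, c * ‖x‖ ≤ ‖L x‖)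
    (hs : ∀ x y, inner ℂ (L x) y = inner ℂ x (L y)) : IsUnit L := by
  have h2 : IsUnit (L * L) := by
    refine ContinuousLinearMap.isUnit_of_forall_le_norm_inner_map (L * L) (c := ⟨c ^ 2, by positivity⟩)
      (by change (0 : ℝ) < c ^ 2; positivity) fun x => ?_
    change ‖x‖ ^ 2 * c ^ 2 ≤ ‖inner ℂ (L (L x)) x‖
    rw [hs, inner_self_eq_norm_sq_to_K]
    simp only [Complex.coe_algebraMap, norm_pow, Complex.norm_real, norm_norm]
    rw [← mul_pow, mul_comm]
    exact pow_le_pow_left₀ (by positivity) (h x) 2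
  exact ((Commute.refl L).isUnit_mul_iff.1 h2).1

end Adjoint

/-! ### Compact diagonal operators and restrictions to smooth vectors -/

section General
variable {n N : ℕ}

theorem isCompactOperator_diagOp (φ : Idx n → Mat N) (C : ℝ) (h : ∀ l, ‖φ l‖ ≤ C)
    (h0 : Filter.Tendsto (fun l => ‖φ l‖) Filter.cofinite (nhds 0)) :
    IsCompactOperator (diagOp φ C h) := by
  classical
  let A : Finset (Idx n) → L2 n (Spin N) →L[ℂ] L2 n (Spin N) := fun F =>
    ∑ l ∈ F, (lp.singleContinuousLinearMap ℂ (fun _ : Idx n => Spin N) 2 l).comp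
      ((φ l).comp (lp.evalCLM ℂ (fun _ : Idx n => Spin N) 2 l))
  have hA : ∀ F x l, A F x l = if l ∈ F then φ l (x l) else 0 := fun F x l => by
    change (∑ l ∈ F, (lp.singleContinuousLinearMap ℂ (fun _ : Idx n => Spin N) 2 l).comp
      ((φ l).comp (lp.evalCLM ℂ (fun _ : Idx n => Spin N) 2 l)) :
        L2 n (Spin N) →L[ℂ] L2 n (Spin N)) x l = _
    rw [sum_apply, lp.coeFn_sum, Finset.sum_apply]
    change ∑ c ∈ F, (lp.single 2 c (φ c (x c)) : L2 n (Spin N)) l = _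
    simp only [lp.single_apply, Finset.sum_pi_single]
  have hc : ∀ F, IsCompactOperator (A F) := fun F => by
    refine Finset.sum_induction _ (fun B : L2 n (Spin N) →L[ℂ] L2 n (Spin N) => IsCompactOperator B)
      (fun _ _ h1 h2 => h1.add h2) isCompactOperator_zero fun l _ => ?_
    have h1 : IsCompactOperator (φ l) := by
      have : LocallyCompactSpace (Spin N) := by
        have := FiniteDimensional.proper ℂ (Spin N)
        infer_instance
      exact isCompactOperator_of_locallyCompactSpace_dom (φ l)
    have h2 := (h1.comp_clm (lp.evalCLM ℂ (fun _ : Idx n => Spin N) 2 l)).clm_comp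
      (lp.singleContinuousLinearMap ℂ (fun _ : Idx n => Spin N) 2 l)
    exact h2
  refine isCompactOperator_of_tendsto (F := A) (l := Filter.atTop) ?_
    (Filter.Eventually.of_forall hc)
  rw [Metric.tendsto_nhds]
  intro ε hε
  have h1 : {l | ¬ ‖φ l‖ < ε / 2}.Finite := by
    have := h0.eventually (gt_mem_nhds (half_pos hε))
    exact this
  filter_upwards [Filter.eventually_ge_atTop h1.toFinset] with F hF
  rw [dist_eq_norm]
  refine lt_of_le_of_lt (ContinuousLinearMap.opNorm_le_bound _ (half_pos hε).le fun x => ?_)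
    (half_lt_self hε)
  refine norm_le_of_pointwise (half_pos hε).le fun l => ?_
  change ‖A F x l - diagOp φ C h x l‖ ≤ _
  rw [hA, diagOp_apply]
  by_cases hl : l ∈ F
  · simp only [hl, if_true, sub_self, norm_zero]
    positivity
  · have : ‖φ l‖ < ε / 2 := by
      by_contra hcon
      exact hl (hF (by simpa using hcon))
    simp only [hl, if_false, zero_sub, norm_neg]
    exact (φ l).le_of_opNorm_le this.le _

theorem tendsto_norm_idx : Filter.Tendsto (fun l : Idx n => ‖l‖) Filter.cofinite Filter.atTop := by
  rw [← Filter.cocompact_eq_cofinite]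
  exact tendsto_norm_cocompact_atTop

variable {V : Type} [NormedAddCommGroup V] [NormedSpace ℂ V]

/-- `A` maps smooth vectors to smooth vectors. -/
def PreservesSmooth (A : L2 n V →L[ℂ] L2 n V) : Prop := ∀ f : Schw n V, ∃ g, toL2 g = A (toL2 f)

/-- The action of a bounded operator on a smooth vector. -/
def restrFun (A : L2 n V →L[ℂ] L2 n V) (h : PreservesSmooth A) (f : Schw n V) : Schw n V :=
  (h f).choose

theorem toL2_restrFun (A : L2 n V →L[ℂ] L2 n V) (h : PreservesSmooth A) (f : Schw n V) :
    toL2 (restrFun A h f) = A (toL2 f) := (h f).choose_spec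

/-- The restriction of a bounded operator to the smooth vectors. -/
def restr (A : L2 n V →L[ℂ] L2 n V) (h : PreservesSmooth A) : Module.End ℂ (Schw n V) where
  toFun f := restrFun A h f
  map_add' f g := toL2_injective (by simp only [map_add, toL2_restrFun])
  map_smul' c f := toL2_injective (by
    simp only [map_smul, toL2_restrFun, RingHom.id_apply])

theorem toL2_restr (A : L2 n V →L[ℂ] L2 n V) (h : PreservesSmooth A) (f : Schw n V) :
    toL2 (restr A h f) = A (toL2 f) := toL2_restrFun A h f

theorem Gains.preserves {A : L2 n V →L[ℂ] L2 n V} (h : Gains 0 A) : PreservesSmooth A := by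
  intro f
  refine exists_schw_of_W_bound fun s => ?_
  obtain ⟨C, hC, hA⟩ := h s
  exact ⟨C * sn s f, fun M => (hA M _).trans (by gcongr; exact norm_W_toL2_le M s f)⟩

/-- Linear operators on smooth vectors that are continuous for the seminorms. -/
def Tempered (A : Module.End ℂ (Schw n V)) : Prop :=
  ∀ s, ∃ s' C, 0 ≤ C ∧ ∀ f, sn s (A f) ≤ C * sn s' f

theorem Gains.tempered {A : L2 n V →L[ℂ] L2 n V} (h : Gains 0 A) :
    Tempered (restr A h.preserves) := by
  intro s
  obtain ⟨C, hC, hA⟩ := h (s + 2 * n)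
  refine ⟨s + 2 * n, weightSum n * C, mul_nonneg (weightSum_nonneg n) hC, fun f => ?_⟩
  rw [mul_assoc]
  refine sn_le_of_W_bound fun M => ?_
  rw [toL2_restr]
  exact (hA M _).trans (by gcongr; exact norm_W_toL2_le M _ f)

theorem Tempered.mul {A B : Module.End ℂ (Schw n V)} (hA : Tempered A) (hB : Tempered B) :
    Tempered (A * B) := by
  intro s
  obtain ⟨s1, C1, h1, hA⟩ := hA s
  obtain ⟨s2, C2, h2, hB⟩ := hB s1
  refine ⟨s2, C1 * C2, by positivity, fun f => (hA (B f)).trans ?_⟩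
  rw [mul_assoc]
  gcongr
  exact hB f

theorem Tempered.add {A B : Module.End ℂ (Schw n V)} (hA : Tempered A) (hB : Tempered B) :
    Tempered (A + B) := by
  intro s
  obtain ⟨s1, C1, h1, hA⟩ := hA s
  obtain ⟨s2, C2, h2, hB⟩ := hB s
  refine ⟨max s1 s2, C1 + C2, by positivity, fun f => (sn_add_le s _ _).trans ?_⟩
  rw [add_mul]
  refine add_le_add ((hA f).trans ?_) ((hB f).trans ?_)
  · gcongr; exact sn_mono (le_max_left _ _) f
  · gcongr; exact sn_mono (le_max_right _ _) f

theorem Tempered.smul (c : ℂ) {A : Module.End ℂ (Schw n V)} (hA : Tempered A) :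
    Tempered (c • A) := by
  intro s
  obtain ⟨s1, C1, h1, hA⟩ := hA s
  refine ⟨s1, ‖c‖ * C1, by positivity, fun f => ?_⟩
  rw [LinearMap.smul_apply, sn_smul, mul_assoc]
  gcongr
  exact hA f

theorem tempered_one : Tempered (1 : Module.End ℂ (Schw n V)) :=
  fun s => ⟨s, 1, zero_le_one, fun f => by simp⟩

theorem tempered_zero : Tempered (0 : Module.End ℂ (Schw n V)) :=
  fun s => ⟨s, 1, zero_le_one, fun f => by simpa using sn_nonneg s f⟩

theorem Tempered.sum {ι : Type*} (t : Finset ι) (A : ι → Module.End ℂ (Schw n V))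
    (h : ∀ i ∈ t, Tempered (A i)) : Tempered (∑ i ∈ t, A i) :=
  Finset.sum_induction A Tempered (fun _ _ => Tempered.add) tempered_zero h

theorem Tempered.pow {A : Module.End ℂ (Schw n V)} (hA : Tempered A) :
    ∀ j : ℕ, Tempered (A ^ j)
  | 0 => by simpa using tempered_one
  | j + 1 => by
    rw [pow_succ]
    exact (hA.pow j).mul hA

theorem tempered_convOp [CompleteSpace V] (w : Idx n → Idx n → ℂ) (hw : ∀ p q, ‖w p q‖ = 1)
    (a : SmoothAlg n) : Tempered (convOp w hw a : Module.End ℂ (Schw n V)) :=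
  fun s => ⟨s, sn s a, sn_nonneg _ _, fun f => sn_conv_le w hw s a f⟩

theorem delta_apply (j : Fin n) (f : Schw n V) (l : Idx n) :
    (delta j f).1 l = (l j : ℂ) • f.1 l := rfl

theorem tempered_delta (j : Fin n) : Tempered (delta j : Module.End ℂ (Schw n V)) := by
  intro s
  refine ⟨s + 1, 1, zero_le_one, fun f => ?_⟩
  rw [one_mul]
  refine ((delta j f).2 s).tsum_le_tsum (fun l => ?_) (f.2 (s + 1))
  have h2 : ‖l j‖ ≤ ‖l‖ := norm_le_pi_norm l j
  rw [delta_apply, norm_smul, pow_succ]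
  have h3 : ‖(l j : ℂ)‖ = ‖l j‖ := by simp [Int.norm_eq_abs]
  calc (1 + ‖l‖) ^ s * (‖(l j : ℂ)‖ * ‖f.1 l‖)
      ≤ (1 + ‖l‖) ^ s * ((1 + ‖l‖) * ‖f.1 l‖) := by gcongr; linarith
    _ = _ := by ring

theorem tempered_spinMap (φ : Mat N) : Tempered (spinMap φ : Module.End ℂ (SmoothSpinor n N)) := by
  intro s
  refine ⟨s, ‖φ‖, norm_nonneg _, fun f => ?_⟩
  unfold sn
  rw [← tsum_mul_left]
  refine ((spinMap φ f).2 s).tsum_le_tsum (fun l => ?_) ((f.2 s).mul_left _)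
  calc (1 + ‖l‖) ^ s * ‖φ (f.1 l)‖ ≤ (1 + ‖l‖) ^ s * (‖φ‖ * ‖f.1 l‖) := by
        gcongr
        exact φ.le_opNorm _
    _ = _ := by ring

end General

/-! ### Clifford multiplication -/

section Clifford
variable {n N : ℕ}

/-- Clifford multiplication by a covector. -/
def slash (γ : Fin n → Mat N) (ξ : Cov n) : Mat N := ∑ j, (ξ j : ℂ) • γ j

theorem clifford_sum_mul_self {R ι : Type*} [Ring R] [Algebra ℂ R] [Fintype ι] [DecidableEq ι]
    (g : ι → R) (h : ∀ i j, g i * g j + g j * g i = if i = j then 2 else 0) (x : ι → ℂ) :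
    (∑ j, x j • g j) * (∑ j, x j • g j) = (∑ j, x j ^ 2) • (1 : R) := by
  have h1 : (∑ j, x j • g j) * (∑ j, x j • g j) = ∑ i, ∑ j, (x i * x j) • (g i * g j) := by
    simp only [Finset.sum_mul, Finset.mul_sum, smul_mul_smul_comm]
    exact Finset.sum_comm
  have h2 : (∑ j, x j • g j) * (∑ j, x j • g j) = ∑ i, ∑ j, (x i * x j) • (g j * g i) := by
    rw [h1, Finset.sum_comm]
    refine Finset.sum_congr rfl fun i _ => Finset.sum_congr rfl fun j _ => ?_
    rw [mul_comm]
  have h3 : (2 : ℂ) • ((∑ j, x j • g j) * (∑ j, x j • g j)) =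
      (2 : ℂ) • ((∑ j, x j ^ 2) • (1 : R)) := by
    rw [two_smul]
    nth_rewrite 1 [h1]
    rw [h2, ← Finset.sum_add_distrib]
    simp only [← Finset.sum_add_distrib, ← smul_add, h]
    simp only [smul_ite, smul_zero, Finset.sum_ite_eq, Finset.mem_univ, if_true]
    rw [← Finset.sum_smul]
    have : (2 : R) = (2 : ℂ) • (1 : R) := by rw [two_smul]; norm_num
    rw [this, smul_comm]
    simp only [sq]
  exact (smul_right_injective R (two_ne_zero (α := ℂ))) h3

theorem slash_mul_self {γ : Fin n → Mat N} (hγ : IsGamma γ) (ξ : Cov n) :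
    slash γ ξ * slash γ ξ = ((‖ξ‖ ^ 2 : ℝ) : ℂ) • (1 : Mat N) := by
  have h : ((‖ξ‖ ^ 2 : ℝ) : ℂ) = ∑ j, (ξ j : ℂ) ^ 2 := by
    rw [EuclideanSpace.norm_sq_eq]
    push_cast
    simp only [Real.norm_eq_abs, ← Complex.ofReal_pow, sq_abs]
  rw [h]
  exact clifford_sum_mul_self γ hγ.clifford fun j => (ξ j : ℂ)

theorem slash_inner {γ : Fin n → Mat N} (hγ : IsGamma γ) (ξ : Cov n) (v w : Spin N) :
    inner ℂ (slash γ ξ v) w = inner ℂ v (slash γ ξ w) := by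
  simp only [slash, sum_apply, smul_apply, sum_inner, inner_sum, inner_smul_left, inner_smul_right,
    Complex.conj_ofReal]
  refine Finset.sum_congr rfl fun j _ => ?_
  congr 1
  have := (hγ.selfAdjoint j).isSymmetric v w
  exact this

theorem norm_slash {γ : Fin n → Mat N} (hγ : IsGamma γ) (ξ : Cov n) (v : Spin N) :
    ‖slash γ ξ v‖ = ‖ξ‖ * ‖v‖ := by
  have h : ((‖slash γ ξ v‖ ^ 2 : ℝ) : ℂ) = (((‖ξ‖ * ‖v‖) ^ 2 : ℝ) : ℂ) := by
    have h1 : slash γ ξ (slash γ ξ v) = ((‖ξ‖ ^ 2 : ℝ) : ℂ) • v :=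
      congrArg (fun A : Mat N => A v) (slash_mul_self hγ ξ)
    have h2 := inner_self_eq_norm_sq_to_K (𝕜 := ℂ) (slash γ ξ v)
    rw [slash_inner hγ, h1, inner_smul_right, inner_self_eq_norm_sq_to_K] at h2
    simp only [Complex.coe_algebraMap] at h2
    push_cast at h2 ⊢
    rw [← h2]
    ring
  have h3 : ‖slash γ ξ v‖ ^ 2 = (‖ξ‖ * ‖v‖) ^ 2 := Complex.ofReal_injective h
  exact (pow_left_inj₀ (norm_nonneg _) (by positivity) two_ne_zero).1 h3

theorem norm_le_norm_toCov (m : Idx n) : ‖m‖ ≤ ‖toCov m‖ := by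
  refine (pi_norm_le_iff_of_nonneg (norm_nonneg _)).2 fun j => ?_
  have := PiLp.norm_apply_le (toCov m) j
  rw [Int.norm_eq_abs]
  exact this

theorem one_le_norm_idx {m : Idx n} (hm : m ≠ 0) : 1 ≤ ‖m‖ := by
  obtain ⟨j, hj⟩ := Function.ne_iff.1 hm
  refine le_trans ?_ (norm_le_pi_norm m j)
  rw [Int.norm_eq_abs]
  exact_mod_cast Int.one_le_abs hj

theorem toCov_zero : toCov (0 : Idx n) = 0 := by
  ext j
  simp [toCov]

theorem toCov_add (m m' : Idx n) : toCov (m + m') = toCov m + toCov m' := by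
  ext j
  simp [toCov]

theorem slash_zero (γ : Fin n → Mat N) : slash γ 0 = 0 :=
  Finset.sum_eq_zero fun j _ => by
    change ((0 : ℝ) : ℂ) • γ j = 0
    rw [Complex.ofReal_zero]
    exact zero_smul ℂ (γ j)

theorem slash_add (γ : Fin n → Mat N) (ξ η : Cov n) :
    slash γ (ξ + η) = slash γ ξ + slash γ η := by
  simp only [slash, ← Finset.sum_add_distrib]
  refine Finset.sum_congr rfl fun j _ => ?_
  rw [PiLp.add_apply, Complex.ofReal_add]
  exact add_smul (ξ j : ℂ) (η j : ℂ) (γ j)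

theorem dirac_apply (γ : Fin n → Mat N) (f : SmoothSpinor n N) (l : Idx n) :
    (dirac γ f).1 l = slash γ (toCov l) (f.1 l) := by
  have h : (dirac γ f).1 l = ∑ j, γ j ((l j : ℂ) • f.1 l) := by
    simp only [dirac, LinearMap.sum_apply, AddSubmonoidClass.coe_finsetSum, Finset.sum_apply]
    rfl
  rw [h, slash, sum_apply]
  refine Finset.sum_congr rfl fun j _ => ?_
  rw [map_smul]
  simp [toCov]

end Clifford

/-- The data of a conformally rescaled noncommutative torus. -/
structure ConfData (n N : ℕ) where
  /-- the deformation matrix -/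
  θ : Matrix (Fin n) (Fin n) ℝ
  /-- the gamma matrices -/
  γ : Fin n → Mat N
  /-- the conformal factor -/
  k : SmoothAlg n
  skew : θ.transpose = -θ
  gamma : IsGamma γ
  pos : IsStrictlyPositive θ k

namespace ConfData
variable {n N : ℕ} (X : ConfData n N)

/-! ### The conformal factor as an operator -/

theorem right_adj (p l : Idx n) :
    star (cocycle X.θ l p) = cocycle X.θ (l + p) (-p) := by
  rw [star_cocycle, cocycle_neg_right, cocycle_add_left, cocycle_self _ X.skew, mul_one]

theorem left_adj (p l : Idx n) :
    star (cocycle X.θ p l) = cocycle X.θ (-p) (l + p) := by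
  rw [star_cocycle, cocycle_neg_left, cocycle_add_right, cocycle_self _ X.skew, mul_one]

/-- Right multiplication by the conformal factor. -/
def K : L2 n (Spin N) →L[ℂ] L2 n (Spin N) :=
  convL2 (fun p q => cocycle X.θ q p) (fun p q => norm_cocycle X.θ q p) X.k

theorem K_toL2 (f : SmoothSpinor n N) : X.K (toL2 f) = toL2 (rmul X.θ X.k f) :=
  convL2_toL2 _ _ _ _

theorem K_symm (x y : L2 n (Spin N)) : inner ℂ (X.K x) y = inner ℂ x (X.K y) :=
  inner_convL2 _ _ X.right_adj _ X.pos.1 x y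

theorem K_gains : Gains 0 X.K := convL2_gains _ _ _

theorem K_commLower : CommLower X.K := convL2_commLower _ _ _

theorem K_bounded_below : ∃ ε : ℝ, 0 < ε ∧ ∀ x, ε * ‖x‖ ≤ ‖X.K x‖ := by
  obtain ⟨ε, hε, h⟩ := X.pos.2
  have h1 : ∀ y : L2 n ℂ, ε * ‖y‖ ^ 2 ≤ (inner ℂ y (convL2 (fun p q => cocycle X.θ q p)
      (fun p q => norm_cocycle X.θ q p) X.k y) : ℂ).re := by
    intro y
    refine denseRange_toL2.induction_on (p := fun y : L2 n ℂ => ε * ‖y‖ ^ 2 ≤ (inner ℂ y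
      (convL2 (fun p q => cocycle X.θ q p) (fun p q => norm_cocycle X.θ q p) X.k y) : ℂ).re)
      y ?_ fun f => ?_
    · refine isClosed_le (by fun_prop) (Complex.continuous_re.comp ?_)
      exact continuous_id.inner (ContinuousLinearMap.continuous _)
    · rw [convL2_toL2]
      exact h f
  have h2 : ∀ x : L2 n (Spin N), ε * ‖x‖ ^ 2 ≤ (inner ℂ x (X.K x) : ℂ).re := by
    intro x
    have h3 : ‖x‖ ^ 2 = ∑ i, ‖component i x‖ ^ 2 := by
      have h4 := sum_inner_component x x
      simp only [inner_self_eq_norm_sq_to_K, Complex.coe_algebraMap] at h4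
      exact_mod_cast h4
    rw [h3, sum_inner_component, Complex.re_sum, Finset.mul_sum]
    refine Finset.sum_le_sum fun i _ => ?_
    rw [K, component_convL2]
    exact h1 _
  refine ⟨ε, hε, fun x => ?_⟩
  have h3 : ε * ‖x‖ * ‖x‖ ≤ ‖X.K x‖ * ‖x‖ := by
    calc _ = ε * ‖x‖ ^ 2 := by ring
      _ ≤ _ := h2 x
      _ ≤ ‖(inner ℂ x (X.K x) : ℂ)‖ := Complex.re_le_norm _
      _ ≤ ‖x‖ * ‖X.K x‖ := norm_inner_le_norm _ _
      _ = _ := mul_comm _ _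
  by_cases hx : x = 0
  · simp [hx]
  · exact le_of_mul_le_mul_right h3 (norm_pos_iff.2 hx)

theorem K_isUnit : IsUnit X.K := by
  obtain ⟨ε, hε, h⟩ := X.K_bounded_below
  exact isUnit_of_bounded_below hε h X.K_symm

/-- Right multiplication by the inverse of the conformal factor. -/
def Kinv : L2 n (Spin N) →L[ℂ] L2 n (Spin N) := Ring.inverse X.K

theorem K_Kinv (x : L2 n (Spin N)) : X.K (X.Kinv x) = x :=
  congrArg (fun A : L2 n (Spin N) →L[ℂ] L2 n (Spin N) => A x) (Ring.mul_inverse_cancel _ X.K_isUnit)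

theorem Kinv_K (x : L2 n (Spin N)) : X.Kinv (X.K x) = x :=
  congrArg (fun A : L2 n (Spin N) →L[ℂ] L2 n (Spin N) => A x) (Ring.inverse_mul_cancel _ X.K_isUnit)

theorem Kinv_symm (x y : L2 n (Spin N)) : inner ℂ (X.Kinv x) y = inner ℂ x (X.Kinv y) := by
  conv_lhs => rw [← X.K_Kinv y, ← X.K_symm, X.K_Kinv]

theorem Kinv_gains : Gains 0 X.Kinv := by
  obtain ⟨ε, hε, h⟩ := X.K_bounded_below
  choose D hD h2 using X.K_commLower
  intro s
  obtain ⟨C, hC, h3⟩ := weighted_estimate_of_bounded_below (n := n) (V := Spin N) hε D hD s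
  refine ⟨C, hC, fun M x => ?_⟩
  have := h3 1 X.K one_pos (by simpa using h) (by simpa using h2) M (X.Kinv x)
  rwa [one_mul, K_Kinv] at this

/-- Right multiplication by the conformal factor, on smooth spinors. -/
abbrev kS : Module.End ℂ (SmoothSpinor n N) := rmul X.θ X.k

/-- Right multiplication by the inverse of the conformal factor, on smooth spinors. -/
def kinvS : Module.End ℂ (SmoothSpinor n N) := restr X.Kinv X.Kinv_gains.preserves

theorem toL2_kinvS (f : SmoothSpinor n N) : toL2 (X.kinvS f) = X.Kinv (toL2 f) :=
  toL2_restr _ _ _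

theorem kS_kinvS (f : SmoothSpinor n N) : X.kS (X.kinvS f) = f :=
  toL2_injective (by rw [← K_toL2, toL2_kinvS, K_Kinv])

theorem kinvS_kS (f : SmoothSpinor n N) : X.kinvS (X.kS f) = f :=
  toL2_injective (by rw [toL2_kinvS, ← K_toL2, Kinv_K])

theorem tempered_kS : Tempered X.kS := tempered_convOp _ _ _

theorem tempered_kinvS : Tempered X.kinvS := X.Kinv_gains.tempered

/-! ### The inverse of the flat Dirac operator away from constants -/

/-- The Fourier coefficients of the inverse of the flat Dirac operator. -/
def diracInvSymbol (l : Idx n) : Mat N := (((‖toCov l‖ ^ 2)⁻¹ : ℝ) : ℂ) • slash X.γ (toCov l)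

theorem norm_diracInvSymbol_apply (l : Idx n) (v : Spin N) :
    ‖X.diracInvSymbol l v‖ = ‖toCov l‖⁻¹ * ‖v‖ := by
  change ‖(((‖toCov l‖ ^ 2)⁻¹ : ℝ) : ℂ) • slash X.γ (toCov l) v‖ = _
  rw [norm_smul, norm_slash X.gamma, Complex.norm_real, Real.norm_of_nonneg (by positivity)]
  by_cases h : ‖toCov l‖ = 0
  · simp [h]
  · field_simp

theorem norm_diracInvSymbol_le (l : Idx n) : ‖X.diracInvSymbol l‖ ≤ ‖l‖⁻¹ := by
  refine ContinuousLinearMap.opNorm_le_bound _ (by positivity) fun v => ?_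
  rw [norm_diracInvSymbol_apply]
  by_cases h : l = 0
  · simp [h, toCov_zero]
  · have : 0 < ‖l‖ := norm_pos_iff.2 h
    gcongr
    exact norm_le_norm_toCov l

theorem norm_diracInvSymbol_le_one (l : Idx n) : ‖X.diracInvSymbol l‖ ≤ 1 := by
  refine (X.norm_diracInvSymbol_le l).trans ?_
  by_cases h : l = 0
  · simp [h]
  · exact inv_le_one_of_one_le₀ (one_le_norm_idx h)

/-- The inverse of the flat Dirac operator, vanishing on constants. -/
def diracInv : L2 n (Spin N) →L[ℂ] L2 n (Spin N) :=
  diagOp X.diracInvSymbol 1 X.norm_diracInvSymbol_le_one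

theorem diracInv_apply (x : L2 n (Spin N)) (l : Idx n) :
    X.diracInv x l = X.diracInvSymbol l (x l) := rfl

theorem isCompactOperator_diracInv : IsCompactOperator X.diracInv := by
  refine isCompactOperator_diagOp _ _ _ ?_
  refine squeeze_zero (fun l => norm_nonneg _) X.norm_diracInvSymbol_le ?_
  exact tendsto_inv_atTop_zero.comp tendsto_norm_idx

theorem diracInv_symm (x y : L2 n (Spin N)) :
    inner ℂ (X.diracInv x) y = inner ℂ x (X.diracInv y) := by
  refine (lp.hasSum_inner (𝕜 := ℂ) (X.diracInv x) y).unique ?_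
  refine (lp.hasSum_inner (𝕜 := ℂ) x (X.diracInv y)).congr_fun fun l => ?_
  change inner ℂ ((((‖toCov l‖ ^ 2)⁻¹ : ℝ) : ℂ) • slash X.γ (toCov l) (x l)) (y l) =
    inner ℂ (x l) ((((‖toCov l‖ ^ 2)⁻¹ : ℝ) : ℂ) • slash X.γ (toCov l) (y l))
  rw [inner_smul_left, inner_smul_right, slash_inner X.gamma, Complex.conj_ofReal]

theorem diracInv_gains : Gains 1 X.diracInv := by
  intro s
  refine ⟨2, by norm_num, fun M x => norm_le_of_pointwise (by norm_num) fun l => ?_⟩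
  rw [norm_W_apply, norm_W_apply, diracInv_apply, norm_diracInvSymbol_apply]
  by_cases h : l = 0
  · have h0 := wt_pos M l
    rw [h, toCov_zero]
    simp only [norm_zero, inv_zero, zero_mul, mul_zero]
    have := pow_nonneg (wt_pos M (0 : Idx n)).le s
    positivity
  · have h1 := norm_le_norm_toCov l
    have h2 := one_le_norm_idx h
    have h3 : wt M l ≤ 2 * ‖toCov l‖ := (wt_le M l).trans (by linarith)
    have h4 : 0 < ‖toCov l‖ := by linarith
    have h5 : wt M l * ‖toCov l‖⁻¹ ≤ 2 := by
      rw [← div_eq_mul_inv, div_le_iff₀ h4]; exact h3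
    have h6 := pow_nonneg (wt_pos M l).le s
    calc _ = (wt M l * ‖toCov l‖⁻¹) * (wt M l ^ s * ‖x l‖) := by rw [pow_succ]; ring
      _ ≤ _ := by gcongr

/-- The inverse of the flat Dirac operator on smooth spinors. -/
def diracInvS : Module.End ℂ (SmoothSpinor n N) :=
  restr X.diracInv (X.diracInv_gains.mono (Nat.zero_le 1)).preserves

theorem diracInvS_apply (f : SmoothSpinor n N) (l : Idx n) :
    (X.diracInvS f).1 l = X.diracInvSymbol l (f.1 l) := by
  rw [← toL2_apply, diracInvS, toL2_restr]
  rfl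

theorem slash_slash (ξ : Cov n) (v : Spin N) :
    slash X.γ ξ (slash X.γ ξ v) = ((‖ξ‖ ^ 2 : ℝ) : ℂ) • v :=
  congrArg (fun A : Mat N => A v) (slash_mul_self X.gamma ξ)

theorem norm_toCov_pos {l : Idx n} (h : l ≠ 0) : 0 < ‖toCov l‖ :=
  zero_lt_one.trans_le ((one_le_norm_idx h).trans (norm_le_norm_toCov l))

theorem smul_smul_norm_sq {l : Idx n} (h : l ≠ 0) (v : Spin N) :
    (((‖toCov l‖ ^ 2)⁻¹ : ℝ) : ℂ) • ((‖toCov l‖ ^ 2 : ℝ) : ℂ) • v = v := by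
  rw [smul_smul, ← Complex.ofReal_mul, inv_mul_cancel₀, Complex.ofReal_one, one_smul]
  have := norm_toCov_pos h
  positivity

theorem mono_apply_self (m : Idx n) (v : Spin N) : (mono m v).1 m = v :=
  Pi.single_eq_same (M := fun _ : Idx n => Spin N) m v

theorem mono_apply_ne {m l : Idx n} (h : l ≠ m) (v : Spin N) : (mono m v).1 l = 0 :=
  Pi.single_eq_of_ne (M := fun _ : Idx n => Spin N) h v

theorem dirac_diracInvS (f : SmoothSpinor n N) :
    dirac X.γ (X.diracInvS f) = f - mono 0 (f.1 0) := by
  apply Subtype.ext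
  funext l
  change _ = f.1 l - (mono 0 (f.1 0)).1 l
  rw [dirac_apply, diracInvS_apply]
  by_cases h : l = 0
  · subst h
    rw [mono_apply_self, toCov_zero, slash_zero, sub_self]
    rfl
  · rw [mono_apply_ne h, sub_zero]
    change slash X.γ (toCov l) ((((‖toCov l‖ ^ 2)⁻¹ : ℝ) : ℂ) • slash X.γ (toCov l) (f.1 l)) = _
    rw [map_smul, slash_slash, smul_smul_norm_sq h]

theorem diracInvS_dirac (f : SmoothSpinor n N) :
    X.diracInvS (dirac X.γ f) = f - mono 0 (f.1 0) := by
  apply Subtype.ext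
  funext l
  change _ = f.1 l - (mono 0 (f.1 0)).1 l
  rw [diracInvS_apply, dirac_apply]
  by_cases h : l = 0
  · subst h
    rw [mono_apply_self, toCov_zero, slash_zero, sub_self]
    exact map_zero _
  · rw [mono_apply_ne h, sub_zero]
    change (((‖toCov l‖ ^ 2)⁻¹ : ℝ) : ℂ) • slash X.γ (toCov l) (slash X.γ (toCov l) (f.1 l)) = _
    rw [slash_slash, smul_smul_norm_sq h]

theorem dirac_mono_zero (v : Spin N) : dirac X.γ (mono (0 : Idx n) v) = 0 := by
  apply Subtype.ext
  funext l
  rw [dirac_apply]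
  by_cases h : l = 0
  · subst h
    rw [toCov_zero, slash_zero]
    rfl
  · rw [mono_apply_ne h]
    exact map_zero _

/-! ### The projection onto the kernel -/

theorem toL2_mono (m : Idx n) (v : Spin N) : toL2 (mono m v) = lp.single 2 m v := rfl

theorem inner_mono (m : Idx n) (v : Spin N) (f : SmoothSpinor n N) :
    inner ℂ (toL2 (mono m v)) (toL2 f) = inner ℂ v (f.1 m) := by
  rw [toL2_mono, lp.inner_single_left]
  rfl

/-- The map `v ↦ k⁻¹ ⊗ v` onto the kernel of the rescaled Dirac operator. -/
def kerMap : Spin N →ₗ[ℂ] L2 n (Spin N) :=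
  X.Kinv.toLinearMap ∘ₗ lp.lsingle (𝕜 := ℂ) (E := fun _ : Idx n => Spin N) 2 0

theorem kerMap_apply (v : Spin N) : X.kerMap v = X.Kinv (toL2 (mono 0 v)) := rfl

/-- The kernel of the rescaled Dirac operator. -/
def kerSpace : Submodule ℂ (L2 n (Spin N)) := LinearMap.range X.kerMap

instance : FiniteDimensional ℂ X.kerSpace :=
  inferInstanceAs (FiniteDimensional ℂ (LinearMap.range X.kerMap))

/-- The orthogonal projection onto the kernel of the rescaled Dirac operator. -/
def kerProj : L2 n (Spin N) →L[ℂ] L2 n (Spin N) := X.kerSpace.starProjection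

theorem kerProj_mem (x : L2 n (Spin N)) : X.kerProj x ∈ X.kerSpace :=
  Submodule.starProjection_apply_mem _ _

theorem kerProj_of_mem {x : L2 n (Spin N)} (h : x ∈ X.kerSpace) : X.kerProj x = x :=
  Submodule.starProjection_eq_self_iff.2 h

theorem kerProj_eq_zero {x : L2 n (Spin N)} (h : ∀ v, inner ℂ (X.kerMap v) x = 0) :
    X.kerProj x = 0 := by
  refine (Submodule.starProjection_apply_eq_zero_iff _).2 ?_
  rintro _ ⟨v, rfl⟩
  exact h v

theorem kerProj_symm (x y : L2 n (Spin N)) :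
    inner ℂ (X.kerProj x) y = inner ℂ x (X.kerProj y) :=
  X.kerSpace.starProjection_isSymmetric x y

theorem norm_kerProj_le (x : L2 n (Spin N)) : ‖X.kerProj x‖ ≤ ‖x‖ :=
  Submodule.norm_starProjection_apply_le _ _

theorem norm_W_mono_zero (M s : ℕ) (v : Spin N) :
    ‖W M s (toL2 (mono (0 : Idx n) v))‖ ≤ ‖v‖ := by
  refine (norm_W_toL2_le M s _).trans (le_of_eq ?_)
  unfold sn
  rw [tsum_eq_single 0 fun p hp => by rw [mono_apply_ne hp]; simp]
  rw [mono_apply_self]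
  simp

theorem kerSpace_W_bound (s : ℕ) : ∃ C, 0 ≤ C ∧ ∀ M, ∀ x ∈ X.kerSpace, ‖W M s x‖ ≤ C * ‖x‖ := by
  obtain ⟨C, hC, h⟩ := X.Kinv_gains s
  refine ⟨C * ‖X.K‖, by positivity, fun M x hx => ?_⟩
  obtain ⟨v, rfl⟩ := hx
  have h1 : ‖v‖ ≤ ‖X.K‖ * ‖X.kerMap v‖ := by
    calc ‖v‖ = ‖toL2 (mono (0 : Idx n) v)‖ := by
          rw [toL2_mono, lp.norm_single (by simp)]
      _ = ‖X.K (X.kerMap v)‖ := by rw [kerMap_apply, K_Kinv]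
      _ ≤ _ := X.K.le_opNorm _
  calc _ ≤ C * ‖W M s (toL2 (mono 0 v))‖ := h M _
    _ ≤ C * (‖X.K‖ * ‖X.kerMap v‖) := by
        gcongr
        exact (norm_W_mono_zero M s v).trans h1
    _ = _ := by ring

theorem kerProj_gains (a : ℕ) : Gains a X.kerProj := by
  intro s
  obtain ⟨C, hC, h⟩ := X.kerSpace_W_bound (s + a)
  refine ⟨C, hC, fun M x => (h M _ (X.kerProj_mem x)).trans ?_⟩
  gcongr
  exact (X.norm_kerProj_le x).trans (norm_le_norm_W M s x)

/-- The projection onto the kernel, on smooth spinors. -/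
def kerProjS : Module.End ℂ (SmoothSpinor n N) := restr X.kerProj (X.kerProj_gains 0).preserves

theorem toL2_kerProjS (f : SmoothSpinor n N) : toL2 (X.kerProjS f) = X.kerProj (toL2 f) :=
  toL2_restr _ _ _

theorem exists_of_kerSpace {f : SmoothSpinor n N} (h : toL2 f ∈ X.kerSpace) :
    ∃ v, f = X.kinvS (mono 0 v) := by
  obtain ⟨v, hv⟩ := h
  exact ⟨v, toL2_injective (by rw [toL2_kinvS, ← hv, kerMap_apply])⟩

theorem kinvS_mono_mem (v : Spin N) : toL2 (X.kinvS (mono (0 : Idx n) v)) ∈ X.kerSpace :=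
  ⟨v, by rw [toL2_kinvS, kerMap_apply]⟩

theorem kerProjS_of_mem {f : SmoothSpinor n N} (h : toL2 f ∈ X.kerSpace) : X.kerProjS f = f :=
  toL2_injective (by rw [toL2_kerProjS, kerProj_of_mem _ h])

/-- The rescaled Dirac operator. -/
abbrev D : Module.End ℂ (SmoothSpinor n N) := diracK X.θ X.γ X.k

theorem D_apply (f : SmoothSpinor n N) : X.D f = X.kS (dirac X.γ (X.kS f)) := rfl

theorem D_of_mem {f : SmoothSpinor n N} (h : toL2 f ∈ X.kerSpace) : X.D f = 0 := by
  obtain ⟨v, rfl⟩ := X.exists_of_kerSpace h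
  rw [D_apply, kS_kinvS, dirac_mono_zero, map_zero]

theorem D_kerProjS (f : SmoothSpinor n N) : X.D (X.kerProjS f) = 0 :=
  X.D_of_mem (by rw [toL2_kerProjS]; exact X.kerProj_mem _)

theorem inner_kerMap (v : Spin N) (f : SmoothSpinor n N) :
    inner ℂ (X.kerMap v) (toL2 f) = inner ℂ v ((X.kinvS f).1 0) := by
  rw [kerMap_apply, Kinv_symm, ← toL2_kinvS, inner_mono]

theorem kerProjS_D (f : SmoothSpinor n N) : X.kerProjS (X.D f) = 0 := by
  refine toL2_injective ?_
  rw [toL2_kerProjS, map_zero]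
  refine X.kerProj_eq_zero fun v => ?_
  rw [inner_kerMap, D_apply, kinvS_kS, dirac_apply, toCov_zero, slash_zero]
  exact inner_zero_right _

theorem kinvS_sub_kerProjS_zero (f : SmoothSpinor n N) :
    (X.kinvS (f - X.kerProjS f)).1 0 = 0 := by
  have h : ∀ v : Spin N, inner ℂ v ((X.kinvS (f - X.kerProjS f)).1 0) = (0 : ℂ) := fun v => by
    rw [← inner_kerMap, map_sub, toL2_kerProjS, inner_sub_right, ← X.kerProj_symm,
      X.kerProj_of_mem ⟨v, rfl⟩, sub_self]
  exact inner_self_eq_zero.1 (h _)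

/-! ### The inverse of the rescaled Dirac operator away from its kernel -/

/-- The inverse of the rescaled Dirac operator, vanishing on its kernel. -/
def T : L2 n (Spin N) →L[ℂ] L2 n (Spin N) :=
  (1 - X.kerProj) * (X.Kinv * (X.diracInv * (X.Kinv * (1 - X.kerProj))))

theorem T_apply (x : L2 n (Spin N)) : X.T x =
    X.Kinv (X.diracInv (X.Kinv (x - X.kerProj x))) -
      X.kerProj (X.Kinv (X.diracInv (X.Kinv (x - X.kerProj x)))) := rfl

theorem T_gains : Gains 1 X.T := by
  have h1 : Gains 0 (1 - X.kerProj) := gains_one.sub (X.kerProj_gains 0)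
  have h2 := h1.comp' (X.Kinv_gains.comp' (X.diracInv_gains.comp' (X.Kinv_gains.comp' h1)))
  unfold T
  exact h2.mono (by norm_num)

theorem T_symm (x y : L2 n (Spin N)) : inner ℂ (X.T x) y = inner ℂ x (X.T y) := by
  have h : ∀ x y, inner ℂ (x - X.kerProj x) y = inner ℂ x (y - X.kerProj y) := fun x y => by
    rw [inner_sub_left, inner_sub_right, kerProj_symm]
  rw [T_apply, T_apply, h, Kinv_symm, diracInv_symm, Kinv_symm, h]

theorem isCompactOperator_T : IsCompactOperator X.T := by
  have h1 := (X.isCompactOperator_diracInv.comp_clm (X.Kinv * (1 - X.kerProj))).clm_comp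
    ((1 - X.kerProj) * X.Kinv)
  exact h1

theorem T_kerProj (x : L2 n (Spin N)) : X.T (X.kerProj x) = 0 := by
  rw [T_apply, X.kerProj_of_mem (X.kerProj_mem x), sub_self]
  simp

theorem kerProj_T (x : L2 n (Spin N)) : X.kerProj (X.T x) = 0 := by
  rw [T_apply, map_sub, X.kerProj_of_mem (X.kerProj_mem _), sub_self]

/-- The inverse of the rescaled Dirac operator on smooth spinors. -/
def TS : Module.End ℂ (SmoothSpinor n N) := restr X.T (X.T_gains.mono (Nat.zero_le 1)).preserves

theorem toL2_TS (f : SmoothSpinor n N) : toL2 (X.TS f) = X.T (toL2 f) := toL2_restr _ _ _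

theorem TS_apply (f : SmoothSpinor n N) : X.TS f =
    X.kinvS (X.diracInvS (X.kinvS (f - X.kerProjS f))) -
      X.kerProjS (X.kinvS (X.diracInvS (X.kinvS (f - X.kerProjS f)))) := by
  refine toL2_injective ?_
  have h : ∀ g, toL2 (X.diracInvS g) = X.diracInv (toL2 g) := fun g => toL2_restr _ _ _
  rw [toL2_TS, T_apply]
  simp only [map_sub, toL2_kerProjS, toL2_kinvS, h]

theorem D_TS (f : SmoothSpinor n N) : X.D (X.TS f) = f - X.kerProjS f := by
  rw [TS_apply, map_sub, D_kerProjS, sub_zero, D_apply, kS_kinvS, dirac_diracInvS, map_sub,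
    kS_kinvS, kinvS_sub_kerProjS_zero]
  have : (mono (0 : Idx n) (0 : Spin N)) = 0 := Subtype.ext (Pi.single_zero _)
  rw [this, map_zero, sub_zero]

theorem TS_D (f : SmoothSpinor n N) : X.TS (X.D f) = f - X.kerProjS f := by
  rw [TS_apply, kerProjS_D, sub_zero, D_apply, kinvS_kS, diracInvS_dirac, map_sub, kinvS_kS,
    map_sub, X.kerProjS_of_mem (X.kinvS_mono_mem _)]
  abel

end ConfData

namespace ConfData
variable {n N : ℕ} (X : ConfData n N)

/-! ### Bounded operators that commute with `T` -/

theorem tempered_dirac (γ : Fin n → Mat N) : Tempered (dirac γ : Module.End ℂ (SmoothSpinor n N)) :=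
  Tempered.sum _ _ fun j _ => (tempered_spinMap _).mul (tempered_delta j)

theorem tempered_D : Tempered X.D := (X.tempered_kS.mul (tempered_dirac _)).mul X.tempered_kS

theorem T_pow_D_pow (j : ℕ) (f : SmoothSpinor n N) :
    (X.T ^ (j + 1)) (toL2 ((X.D ^ (j + 1)) f)) = toL2 f - X.kerProj (toL2 f) := by
  induction j generalizing f with
  | zero =>
    rw [zero_add, pow_one, pow_one, ← toL2_TS, TS_D, map_sub, toL2_kerProjS]
  | succ j ih =>
    rw [pow_succ' X.T, pow_succ X.D]
    change X.T ((X.T ^ (j + 1)) (toL2 ((X.D ^ (j + 1)) (X.D f)))) = _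
    rw [ih, map_sub, T_kerProj, sub_zero, ← toL2_TS, TS_D, map_sub, toL2_kerProjS]

theorem commute_W_bound (s : ℕ) : ∃ s' C, 0 ≤ C ∧ ∀ B : L2 n (Spin N) →L[ℂ] L2 n (Spin N),
    Commute B X.T → (∀ x, B (X.kerProj x) = 0) → ∀ M f,
      ‖W M s (B (toL2 f))‖ ≤ C * ‖B‖ * sn s' f := by
  obtain ⟨C, hC, h⟩ := X.T_gains.pow (s + 1) 0
  obtain ⟨s', C', hC', h'⟩ := X.tempered_D.pow (s + 1) 0
  refine ⟨s', C * C', by positivity, fun B hB hB0 M f => ?_⟩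
  have e : B (toL2 f) = (X.T ^ (s + 1)) (B (toL2 ((X.D ^ (s + 1)) f))) := by
    have h1 : B (toL2 f) = B (toL2 f - X.kerProj (toL2 f)) := by rw [map_sub, hB0, sub_zero]
    rw [h1, ← T_pow_D_pow X s]
    exact congrArg (fun A : L2 n (Spin N) →L[ℂ] L2 n (Spin N) => A (toL2 ((X.D ^ (s + 1)) f)))
      (hB.pow_right (s + 1))
  rw [e]
  calc _ ≤ ‖W M (0 + (s + 1) * 1) ((X.T ^ (s + 1)) (B (toL2 ((X.D ^ (s + 1)) f))))‖ :=
        norm_W_mono M (by omega) _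
    _ ≤ C * ‖W M 0 (B (toL2 ((X.D ^ (s + 1)) f)))‖ := h M _
    _ ≤ C * (‖B‖ * (C' * sn s' f)) := by
        rw [W_zero]
        gcongr
        refine (B.le_opNorm _).trans ?_
        gcongr
        exact (norm_toL2_le _).trans (h' f)
    _ = _ := by ring

theorem preservesSmooth_of_commute {B : L2 n (Spin N) →L[ℂ] L2 n (Spin N)} (hB : Commute B X.T)
    (hB0 : ∀ x, B (X.kerProj x) = 0) : PreservesSmooth B := fun f =>
  exists_schw_of_W_bound fun s => by
    obtain ⟨s', C, -, h⟩ := X.commute_W_bound s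
    exact ⟨_, fun M => h B hB hB0 M f⟩

theorem sn_commute_bound (s : ℕ) : ∃ s' C, 0 ≤ C ∧ ∀ B : L2 n (Spin N) →L[ℂ] L2 n (Spin N),
    Commute B X.T → (∀ x, B (X.kerProj x) = 0) → ∀ f g : SmoothSpinor n N, toL2 g = B (toL2 f) →
      sn s g ≤ C * ‖B‖ * sn s' f := by
  obtain ⟨s', C, hC, h⟩ := X.commute_W_bound (s + 2 * n)
  refine ⟨s', weightSum n * C, mul_nonneg (weightSum_nonneg n) hC, fun B hB hB0 f g hg => ?_⟩
  rw [mul_assoc, mul_assoc, ← mul_assoc C]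
  refine sn_le_of_W_bound fun M => ?_
  rw [hg]
  exact h B hB hB0 M f

/-! ### The absolute value of `T` -/

/-- The operator `s² + T²`. -/
def shiftSq (s : ℝ) : L2 n (Spin N) →L[ℂ] L2 n (Spin N) := ((s ^ 2 : ℝ) : ℂ) • 1 + X.T * X.T

theorem shiftSq_apply (s : ℝ) (x : L2 n (Spin N)) :
    X.shiftSq s x = ((s ^ 2 : ℝ) : ℂ) • x + X.T (X.T x) := rfl

theorem norm_sq_shiftSq (s : ℝ) (x : L2 n (Spin N)) :
    ‖X.shiftSq s x‖ ^ 2 = (s ^ 2 * ‖x‖) ^ 2 + 2 * (s ^ 2 * ‖X.T x‖ ^ 2) + ‖X.T (X.T x)‖ ^ 2 := by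
  rw [shiftSq_apply, norm_add_sq (𝕜 := ℂ), norm_smul, Complex.norm_real,
    Real.norm_of_nonneg (sq_nonneg s), inner_smul_left, Complex.conj_ofReal, ← X.T_symm,
    inner_self_eq_norm_sq_to_K]
  congr 3
  simp only [Complex.coe_algebraMap, ← Complex.ofReal_pow, ← Complex.ofReal_mul]
  exact Complex.ofReal_re _

theorem mul_norm_le_shiftSq (s : ℝ) (x : L2 n (Spin N)) : s ^ 2 * ‖x‖ ≤ ‖X.shiftSq s x‖ := by
  refine le_of_sq_le_sq ?_ (norm_nonneg _)
  rw [norm_sq_shiftSq]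
  have : 0 ≤ s ^ 2 * ‖X.T x‖ ^ 2 := by positivity
  nlinarith [sq_nonneg ‖X.T (X.T x)‖]

theorem norm_T_T_le_shiftSq (s : ℝ) (x : L2 n (Spin N)) : ‖X.T (X.T x)‖ ≤ ‖X.shiftSq s x‖ := by
  refine le_of_sq_le_sq ?_ (norm_nonneg _)
  rw [norm_sq_shiftSq]
  have : 0 ≤ s ^ 2 * ‖X.T x‖ ^ 2 := by positivity
  nlinarith [sq_nonneg (s ^ 2 * ‖x‖)]

theorem isUnit_shiftSq {s : ℝ} (hs : s ≠ 0) : IsUnit (X.shiftSq s) := by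
  refine isUnit_of_bounded_below (c := s ^ 2) (by positivity) (X.mul_norm_le_shiftSq s) ?_
  intro x y
  rw [shiftSq_apply, shiftSq_apply, inner_add_left, inner_add_right, inner_smul_left,
    inner_smul_right, Complex.conj_ofReal, T_symm, T_symm]

/-- The operator `T² (s² + T²)⁻¹`. -/
def Θ (s : ℝ) : L2 n (Spin N) →L[ℂ] L2 n (Spin N) := X.T * X.T * Ring.inverse (X.shiftSq s)

theorem commute_T_shiftSq (s : ℝ) : Commute X.T (X.shiftSq s) :=
  ((Commute.one_right X.T).smul_right _).add_right
    ((Commute.refl X.T).mul_right (Commute.refl X.T))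

theorem commute_inverse {R : Type*} [Ring R] {a b : R} (hb : IsUnit b) (h : Commute a b) :
    Commute a (Ring.inverse b) := by
  obtain ⟨u, rfl⟩ := hb
  rw [Ring.inverse_unit]
  exact h.units_inv_right

theorem commute_Θ_T {s : ℝ} (hs : s ≠ 0) : Commute (X.Θ s) X.T :=
  ((Commute.refl X.T).mul_left (Commute.refl X.T)).mul_left
    (commute_inverse (X.isUnit_shiftSq hs) (X.commute_T_shiftSq s)).symm

theorem Θ_shiftSq {s : ℝ} (hs : s ≠ 0) (x : L2 n (Spin N)) :
    X.Θ s (X.shiftSq s x) = X.T (X.T x) := by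
  have h := congrArg (fun A : L2 n (Spin N) →L[ℂ] L2 n (Spin N) => A x)
    (Ring.inverse_mul_cancel _ (X.isUnit_shiftSq hs))
  change X.T (X.T ((Ring.inverse (X.shiftSq s)) (X.shiftSq s x))) = _
  exact congrArg (fun y => X.T (X.T y)) h

theorem Θ_kerProj {s : ℝ} (hs : s ≠ 0) (x : L2 n (Spin N)) : X.Θ s (X.kerProj x) = 0 := by
  have h1 : X.shiftSq s (X.kerProj x) = ((s ^ 2 : ℝ) : ℂ) • X.kerProj x := by
    rw [shiftSq_apply, T_kerProj, map_zero, add_zero]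
  have h2 := X.Θ_shiftSq hs (X.kerProj x)
  rw [h1, T_kerProj, map_zero, map_smul] at h2
  refine (smul_eq_zero.1 h2).resolve_left ?_
  have : s ^ 2 ≠ 0 := by positivity
  exact_mod_cast this

theorem norm_Θ_le {s : ℝ} (hs : s ≠ 0) : ‖X.Θ s‖ ≤ (1 + ‖X.T * X.T‖) * (1 + s ^ 2)⁻¹ := by
  refine ContinuousLinearMap.opNorm_le_bound _ (by positivity) fun y => ?_
  obtain ⟨x, rfl⟩ : ∃ x, X.shiftSq s x = y := by
    refine ⟨Ring.inverse (X.shiftSq s) y, ?_⟩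
    exact congrArg (fun A : L2 n (Spin N) →L[ℂ] L2 n (Spin N) => A y)
      (Ring.mul_inverse_cancel _ (X.isUnit_shiftSq hs))
  rw [Θ_shiftSq X hs]
  have h1 := X.norm_T_T_le_shiftSq s x
  have h2 : s ^ 2 * ‖X.T (X.T x)‖ ≤ ‖X.T * X.T‖ * ‖X.shiftSq s x‖ := by
    calc s ^ 2 * ‖X.T (X.T x)‖ ≤ s ^ 2 * (‖X.T * X.T‖ * ‖x‖) := by
          gcongr
          exact (X.T * X.T).le_opNorm x
      _ = ‖X.T * X.T‖ * (s ^ 2 * ‖x‖) := by ring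
      _ ≤ _ := by gcongr; exact X.mul_norm_le_shiftSq s x
  have h3 : 0 < 1 + s ^ 2 := by positivity
  rw [mul_assoc, mul_comm (1 + s ^ 2)⁻¹, ← mul_assoc, ← div_eq_mul_inv, le_div_iff₀ h3]
  linarith

theorem continuousOn_Θ : ContinuousOn X.Θ {0}ᶜ := by
  intro s hs
  refine ContinuousAt.continuousWithinAt ?_
  obtain ⟨u, hu⟩ := X.isUnit_shiftSq hs
  have h1 : ContinuousAt (fun t => X.shiftSq t) s := by
    unfold shiftSq
    fun_prop
  have h2 : ContinuousAt (fun t => Ring.inverse (X.shiftSq t)) s := by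
    refine ContinuousAt.comp (g := Ring.inverse) ?_ h1
    rw [← hu]
    exact NormedRing.inverse_continuousAt u
  exact continuousAt_const.mul h2

theorem ae_ne_zero : ∀ᵐ s : ℝ, s ≠ 0 := MeasureTheory.Measure.ae_ne _ _

theorem aestronglyMeasurable_of_continuousOn_compl {E : Type*} [NormedAddCommGroup E]
    {f : ℝ → E} (h : ContinuousOn f {0}ᶜ) :
    MeasureTheory.AEStronglyMeasurable f MeasureTheory.volume := by
  have h1 : SecondCountableTopologyEither ℝ E := inferInstance
  have h2 := h.aestronglyMeasurable (μ := MeasureTheory.volume)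
    (measurableSet_singleton (0 : ℝ)).compl
  rwa [MeasureTheory.Measure.restrict_eq_self_of_ae_mem] at h2
  exact ae_ne_zero

theorem integrable_Θ : MeasureTheory.Integrable X.Θ := by
  refine (integrable_inv_one_add_sq.const_mul (1 + ‖X.T * X.T‖)).mono'
    (aestronglyMeasurable_of_continuousOn_compl X.continuousOn_Θ) ?_
  filter_upwards [ae_ne_zero] with s hs using X.norm_Θ_le hs

/-- The absolute value of `T`. -/
def Q : L2 n (Spin N) →L[ℂ] L2 n (Spin N) := ((Real.pi⁻¹ : ℝ) : ℂ) • ∫ s, X.Θ s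

theorem Q_apply (x : L2 n (Spin N)) : X.Q x = ((Real.pi⁻¹ : ℝ) : ℂ) • ∫ s, X.Θ s x := by
  rw [← ContinuousLinearMap.integral_apply X.integrable_Θ]
  rfl

theorem Q_kerProj (x : L2 n (Spin N)) : X.Q (X.kerProj x) = 0 := by
  rw [Q_apply, MeasureTheory.integral_eq_zero_of_ae, smul_zero]
  filter_upwards [ae_ne_zero] with s hs using X.Θ_kerProj hs x

theorem Q_T (x : L2 n (Spin N)) : X.Q (X.T x) = X.T (X.Q x) := by
  rw [Q_apply, Q_apply, map_smul]
  have h : MeasureTheory.Integrable fun s => X.Θ s x :=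
    X.integrable_Θ.apply_continuousLinearMap x
  rw [← ContinuousLinearMap.integral_comp_comm X.T h]
  congr 1
  refine MeasureTheory.integral_congr_ae ?_
  filter_upwards [ae_ne_zero] with s hs
  exact congrArg (fun A : L2 n (Spin N) →L[ℂ] L2 n (Spin N) => A x) (X.commute_Θ_T hs)

theorem commute_Q_T : Commute X.Q X.T := ContinuousLinearMap.ext X.Q_T

theorem integral_div_sq_add (ν : ℝ) : ∫ s : ℝ, ν ^ 2 / (s ^ 2 + ν ^ 2) = |ν| * Real.pi := by
  by_cases hν : ν = 0
  · simp [hν]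
  have h := MeasureTheory.Measure.integral_comp_div (fun s : ℝ => (1 + s ^ 2)⁻¹) ν
  rw [integral_univ_inv_one_add_sq, smul_eq_mul] at h
  rw [← h]
  refine MeasureTheory.integral_congr_ae (Filter.Eventually.of_forall fun s => ?_)
  have h1 : 0 < s ^ 2 + ν ^ 2 := by positivity
  have h2 : 0 < 1 + (s / ν) ^ 2 := by positivity
  change ν ^ 2 / (s ^ 2 + ν ^ 2) = (1 + (s / ν) ^ 2)⁻¹
  rw [eq_comm, inv_eq_one_div, div_eq_div_iff h2.ne' h1.ne']
  field_simp
  ring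

theorem Θ_eigen {s : ℝ} (hs : s ≠ 0) {ν : ℝ} {x : L2 n (Spin N)} (h : X.T x = (ν : ℂ) • x) :
    X.Θ s x = ((ν ^ 2 / (s ^ 2 + ν ^ 2) : ℝ) : ℂ) • x := by
  have h1 : X.T (X.T x) = ((ν ^ 2 : ℝ) : ℂ) • x := by
    rw [h, map_smul, h, smul_smul, ← Complex.ofReal_mul, sq]
  have h2 : X.shiftSq s x = ((s ^ 2 + ν ^ 2 : ℝ) : ℂ) • x := by
    rw [shiftSq_apply, h1, ← add_smul, Complex.ofReal_add]
  have h3 := X.Θ_shiftSq hs x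
  have h4 : s ^ 2 + ν ^ 2 ≠ 0 := by positivity
  have h5 : ((s ^ 2 + ν ^ 2 : ℝ) : ℂ) ≠ 0 := by exact_mod_cast h4
  rw [h1, h2, map_smul] at h3
  rw [← inv_smul_smul₀ h5 (X.Θ s x), h3, smul_smul, div_eq_mul_inv, mul_comm (ν ^ 2),
    Complex.ofReal_mul, Complex.ofReal_inv]

theorem Q_eigen {ν : ℝ} {x : L2 n (Spin N)} (h : X.T x = (ν : ℂ) • x) :
    X.Q x = ((|ν| : ℝ) : ℂ) • x := by
  have h1 : ∫ s, X.Θ s x = ∫ s : ℝ, ((ν ^ 2 / (s ^ 2 + ν ^ 2) : ℝ) : ℂ) • x := by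
    refine MeasureTheory.integral_congr_ae ?_
    filter_upwards [ae_ne_zero] with s hs using X.Θ_eigen hs h
  rw [Q_apply, h1, integral_smul_const, integral_complex_ofReal, integral_div_sq_add, smul_smul,
    ← Complex.ofReal_mul]
  congr 2
  field_simp

theorem Q_pow_eigen {ν : ℝ} {x : L2 n (Spin N)} (h : X.T x = (ν : ℂ) • x) (j : ℕ) :
    (X.Q ^ j) x = ((|ν| ^ j : ℝ) : ℂ) • x := by
  induction j with
  | zero => simp
  | succ j ih =>
    rw [pow_succ']
    change X.Q ((X.Q ^ j) x) = _
    rw [ih, map_smul, X.Q_eigen h, smul_smul, ← Complex.ofReal_mul, pow_succ]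

/-- The absolute value of `T` on smooth spinors. -/
def QS : Module.End ℂ (SmoothSpinor n N) :=
  restr X.Q (X.preservesSmooth_of_commute X.commute_Q_T X.Q_kerProj)

theorem toL2_QS (f : SmoothSpinor n N) : toL2 (X.QS f) = X.Q (toL2 f) := toL2_restr _ _ _

theorem toL2_QS_pow (j : ℕ) (f : SmoothSpinor n N) :
    toL2 ((X.QS ^ j) f) = (X.Q ^ j) (toL2 f) := by
  induction j with
  | zero => simp
  | succ j ih =>
    rw [pow_succ', pow_succ']
    change toL2 (X.QS ((X.QS ^ j) f)) = X.Q ((X.Q ^ j) (toL2 f))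
    rw [toL2_QS, ih]

/-! ### The operator `|D|^{-t}` -/

theorem kerProjS_of_eigen {μ : ℝ} (hμ : μ ≠ 0) {f : SmoothSpinor n N}
    (h : X.D f = (μ : ℂ) • f) : X.kerProjS f = 0 := by
  have h1 := X.kerProjS_D f
  rw [h, map_smul] at h1
  exact (smul_eq_zero.1 h1).resolve_left (by exact_mod_cast hμ)

theorem T_of_eigen {μ : ℝ} (hμ : μ ≠ 0) {f : SmoothSpinor n N} (h : X.D f = (μ : ℂ) • f) :
    X.T (toL2 f) = ((μ⁻¹ : ℝ) : ℂ) • toL2 f := by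
  have h1 := X.TS_D f
  have h2 : (μ : ℂ) ≠ 0 := by exact_mod_cast hμ
  rw [X.kerProjS_of_eigen hμ h, sub_zero, h, map_smul] at h1
  rw [← toL2_TS, ← inv_smul_smul₀ h2 (X.TS f), h1, map_smul, Complex.ofReal_inv]

theorem kerProjS_of_D_eq_zero {f : SmoothSpinor n N} (h : X.D f = 0) : X.kerProjS f = f := by
  have h1 := X.TS_D f
  rw [h, map_zero] at h1
  exact (sub_eq_zero.1 h1.symm).symm

theorem Q_pow_kerProj {t : ℕ} (ht : t ≠ 0) (x : L2 n (Spin N)) : (X.Q ^ t) (X.kerProj x) = 0 := by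
  obtain ⟨j, rfl⟩ := Nat.exists_eq_succ_of_ne_zero ht
  rw [Nat.succ_eq_add_one, pow_succ]
  change (X.Q ^ j) (X.Q (X.kerProj x)) = 0
  rw [Q_kerProj, map_zero]

theorem isInvAbsPow_QS {t : ℕ} (ht : t ≠ 0) : IsInvAbsPow X.D t (X.QS ^ t) where
  bounded := ⟨X.Q ^ t, X.toL2_QS_pow t⟩
  eigen μ f hμ h := toL2_injective (by
    rw [toL2_QS_pow, X.Q_pow_eigen (X.T_of_eigen hμ h), abs_inv, map_smul])
  kernel f h := toL2_injective (by
    rw [toL2_QS_pow, ← X.kerProjS_of_D_eq_zero h, toL2_kerProjS, X.Q_pow_kerProj ht, map_zero])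

theorem mem_kerSpace_of_T_eq_zero {x : L2 n (Spin N)} (h : X.T x = 0) : x ∈ X.kerSpace := by
  have h1 : x - X.kerProj x = 0 := by
    refine (denseRange_toL2 (n := n) (V := Spin N)).eq_zero_of_inner_left ℂ fun f => ?_
    have e : toL2 f = X.kerProj (toL2 f) + X.T (toL2 (X.D f)) := by
      rw [← toL2_TS, TS_D, map_sub, toL2_kerProjS]
      abel
    rw [e, inner_add_right, ← kerProj_symm, ← T_symm, map_sub, map_sub, h, T_kerProj,
      X.kerProj_of_mem (X.kerProj_mem x)]
    simp
  rw [sub_eq_zero.1 h1]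
  exact X.kerProj_mem x

theorem exists_smooth_of_eigen {ν : ℝ} (hν : ν ≠ 0) {x : L2 n (Spin N)}
    (h : X.T x = (ν : ℂ) • x) : ∃ f : SmoothSpinor n N, toL2 f = x ∧ X.D f = ((ν⁻¹ : ℝ) : ℂ) • f := by
  have hν' : (ν : ℂ) ≠ 0 := by exact_mod_cast hν
  have hp : ∀ j : ℕ, (X.T ^ j) x = (ν : ℂ) ^ j • x := fun j => by
    induction j with
    | zero => simp
    | succ j ih =>
      rw [pow_succ']
      change X.T ((X.T ^ j) x) = _
      rw [ih, map_smul, h, smul_smul, pow_succ]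
  obtain ⟨f, hf⟩ : ∃ f : SmoothSpinor n N, toL2 f = x := by
    refine exists_schw_of_W_bound fun s => ?_
    obtain ⟨C, hC, h1⟩ := X.T_gains.pow s 0
    refine ⟨(‖(ν : ℂ) ^ s‖)⁻¹ * (C * ‖x‖), fun M => ?_⟩
    have h2 := h1 M x
    rw [W_zero, hp, map_smul, norm_smul, zero_add, mul_one] at h2
    have h3 : 0 < ‖(ν : ℂ) ^ s‖ := norm_pos_iff.2 (pow_ne_zero _ hν')
    rw [inv_mul_eq_div, le_div_iff₀ h3]
    linarith
  refine ⟨f, hf, ?_⟩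
  have h1 : X.TS f = (ν : ℂ) • f := toL2_injective (by rw [toL2_TS, hf, h, map_smul, hf])
  have h2 : X.kerProjS f = 0 := by
    have h3 : (ν : ℂ) • X.kerProjS f = 0 := toL2_injective (by
      rw [← map_smul, toL2_kerProjS, ← h1, toL2_TS, kerProj_T, map_zero])
    exact (smul_eq_zero.1 h3).resolve_left hν'
  have h3 := X.D_TS f
  rw [h1, h2, sub_zero, map_smul] at h3
  rw [← inv_smul_smul₀ hν' (X.D f), h3, Complex.ofReal_inv]

theorem eq_of_isInvAbsPow {t : ℕ} {R R' : Module.End ℂ (SmoothSpinor n N)}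
    (hR : IsInvAbsPow X.D t R) (hR' : IsInvAbsPow X.D t R') : R' = R := by
  obtain ⟨B, hB⟩ := hR.bounded
  obtain ⟨B', hB'⟩ := hR'.bounded
  have key : ∀ (μ : ℂ) (x : L2 n (Spin N)), X.T x = μ • x → B' x = B x := by
    intro μ x hx
    by_cases hx0 : x = 0
    · simp [hx0]
    have hμ : ((μ.re : ℝ) : ℂ) = μ := by
      have h1 := X.T_symm x x
      rw [hx, inner_smul_left, inner_smul_right] at h1
      have h2 : (inner ℂ x x : ℂ) ≠ 0 := inner_self_ne_zero.2 hx0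
      exact Complex.conj_eq_iff_re.1 (mul_right_cancel₀ h2 h1)
    rw [← hμ] at hx
    by_cases h0 : μ.re = 0
    · rw [h0, Complex.ofReal_zero, zero_smul] at hx
      obtain ⟨v, rfl⟩ := X.mem_kerSpace_of_T_eq_zero hx
      have h1 : X.D (X.kinvS (mono 0 v)) = 0 := X.D_of_mem (X.kinvS_mono_mem v)
      rw [kerMap_apply, ← toL2_kinvS, ← hB, ← hB', hR.kernel _ h1, hR'.kernel _ h1]
    · obtain ⟨f, rfl, hf⟩ := X.exists_smooth_of_eigen h0 hx
      rw [← hB, ← hB', hR.eigen _ f (inv_ne_zero h0) hf, hR'.eigen _ f (inv_ne_zero h0) hf]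
  have hs : (X.T : L2 n (Spin N) →ₗ[ℂ] L2 n (Spin N)).IsSymmetric := X.T_symm
  have hbot := ContinuousLinearMap.orthogonalComplement_iSup_eigenspaces_eq_bot
    X.isCompactOperator_T hs
  let E := LinearMap.eqLocus (B' : L2 n (Spin N) →ₗ[ℂ] L2 n (Spin N))
    (B : L2 n (Spin N) →ₗ[ℂ] L2 n (Spin N))
  have hle : (⨆ μ, Module.End.eigenspace (X.T : L2 n (Spin N) →ₗ[ℂ] L2 n (Spin N)) μ) ≤
      E := by
    refine iSup_le fun μ x hx => ?_
    exact key μ x (Module.End.mem_eigenspace_iff.1 hx)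
  have hcl : IsClosed (E : Set (L2 n (Spin N))) :=
    isClosed_eq B'.continuous B.continuous
  have htop : E = ⊤ := by
    rw [eq_top_iff, ← (Submodule.topologicalClosure_eq_top_iff).2 hbot]
    exact Submodule.topologicalClosure_minimal _ hle hcl
  refine LinearMap.ext fun f => toL2_injective ?_
  rw [hB, hB']
  have : toL2 f ∈ E := by rw [htop]; trivial
  exact this

end ConfData

/-! ### Left and right multiplications -/

section
variable {n : ℕ} {V : Type} [NormedAddCommGroup V] [NormedSpace ℂ V]

theorem shiftOp_comm (θ : Matrix (Fin n) (Fin n) ℝ) (p q : Idx n) (x : L2 n V) :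
    shiftOp (fun p q => cocycle θ p q) (fun p q => norm_cocycle θ p q) p
      (shiftOp (fun p q => cocycle θ q p) (fun p q => norm_cocycle θ q p) q x) =
    shiftOp (fun p q => cocycle θ q p) (fun p q => norm_cocycle θ q p) q
      (shiftOp (fun p q => cocycle θ p q) (fun p q => norm_cocycle θ p q) p x) := by
  refine lp.ext (funext fun l => ?_)
  simp only [shiftOp_apply, smul_smul]
  rw [sub_right_comm l q p]
  congr 1
  have h1 : cocycle θ p (l - p) = cocycle θ p (l - p - q) * cocycle θ p q := by
    rw [← cocycle_add_right, sub_add_cancel]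
  have h2 : cocycle θ (l - q) q = cocycle θ (l - p - q) q * cocycle θ p q := by
    rw [← cocycle_add_left]
    congr 1
    abel
  have h3 : l - q - p = l - p - q := by abel
  rw [h1, h2, ]
  ring

variable [CompleteSpace V]

theorem convL2_comm (θ : Matrix (Fin n) (Fin n) ℝ) (a b : SmoothAlg n) (x : L2 n V) :
    convL2 (fun p q => cocycle θ p q) (fun p q => norm_cocycle θ p q) a
      (convL2 (fun p q => cocycle θ q p) (fun p q => norm_cocycle θ q p) b x) =
    convL2 (fun p q => cocycle θ q p) (fun p q => norm_cocycle θ q p) b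
      (convL2 (fun p q => cocycle θ p q) (fun p q => norm_cocycle θ p q) a x) := by
  have key : ∀ p, ∀ y : L2 n V, shiftOp (fun p q => cocycle θ p q) (fun p q => norm_cocycle θ p q) p
      (convL2 (fun p q => cocycle θ q p) (fun p q => norm_cocycle θ q p) b y) =
      convL2 (fun p q => cocycle θ q p) (fun p q => norm_cocycle θ q p) b
        (shiftOp (fun p q => cocycle θ p q) (fun p q => norm_cocycle θ p q) p y) := by
    intro p y
    refine ((convL2_hasSum _ _ b y).mapL _).unique ?_
    refine (convL2_hasSum _ _ b _).congr_fun fun q => ?_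
    rw [map_smul, shiftOp_comm]
  refine (convL2_hasSum _ _ a _).unique ?_
  refine ((convL2_hasSum _ _ a x).mapL _).congr_fun fun p => ?_
  rw [map_smul, key]

theorem lmul_rmul (θ : Matrix (Fin n) (Fin n) ℝ) (a b : SmoothAlg n) (f : Schw n V) :
    lmul θ a (rmul θ b f) = rmul θ b (lmul θ a f) := by
  apply toL2_injective
  simp only [lmul, rmul, ← convL2_toL2]
  exact convL2_comm θ a b _

theorem delta_convOp (w : Idx n → Idx n → ℂ) (hw : ∀ p q, ‖w p q‖ = 1) (j : Fin n)
    (a : SmoothAlg n) (f : Schw n V) :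
    delta j (convOp w hw a f) = convOp w hw a (delta j f) + convOp w hw (delta j a) f := by
  apply Subtype.ext
  funext l
  change (l j : ℂ) • conv w a.1 f.1 l = conv w a.1 (delta j f).1 l + conv w (delta j a).1 f.1 l
  simp only [conv]
  rw [← (summable_conv w hw a (delta j f) l).of_norm.tsum_add
    (summable_conv w hw (delta j a) f l).of_norm, ← tsum_const_smul'' (l j : ℂ)]
  refine tsum_congr fun p => ?_
  rw [delta_apply, delta_apply, smul_smul, smul_smul, ← add_smul]
  congr 1
  simp only [Pi.sub_apply, smul_eq_mul]
  push_cast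
  ring

end

section
variable {n N : ℕ}
open ConfData

theorem convOp_mono_zero (w : Idx n → Idx n → ℂ) (hw : ∀ p q, ‖w p q‖ = 1)
    (hw0 : ∀ p, w p 0 = 1) (a : SmoothAlg n) (v : Spin N) (l : Idx n) :
    (convOp w hw a (mono 0 v)).1 l = a.1 l • v := by
  change conv w a.1 (mono 0 v).1 l = _
  rw [conv, tsum_eq_single l]
  · rw [sub_self, hw0, one_mul, mono_apply_self]
  · intro p hp
    rw [mono_apply_ne (sub_ne_zero.2 (Ne.symm hp)), smul_zero]

theorem lmul_mono_zero (θ : Matrix (Fin n) (Fin n) ℝ) (a : SmoothAlg n) (v : Spin N) (l : Idx n) :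
    (lmul θ a (mono 0 v)).1 l = a.1 l • v :=
  convOp_mono_zero _ _ (cocycle_zero_right θ) a v l

theorem rmul_mono_zero (θ : Matrix (Fin n) (Fin n) ℝ) (a : SmoothAlg n) (v : Spin N) :
    rmul θ a (mono (0 : Idx n) v) = lmul θ a (mono 0 v) := by
  apply Subtype.ext
  funext l
  rw [lmul_mono_zero]
  exact convOp_mono_zero _ _ (cocycle_zero_left θ) a v l

theorem delta_mono_zero (j : Fin n) (v : Spin N) : delta j (mono (0 : Idx n) v) = 0 := by
  apply Subtype.ext
  funext l
  rw [delta_apply]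
  by_cases h : l = 0
  · simp [h]
  · rw [mono_apply_ne h, smul_zero]
    rfl

theorem inner_delta (j : Fin n) (f g : SmoothSpinor n N) :
    inner ℂ (toL2 (delta j f)) (toL2 g) = inner ℂ (toL2 f) (toL2 (delta j g)) := by
  rw [lp.inner_eq_tsum, lp.inner_eq_tsum]
  refine tsum_congr fun l => ?_
  simp only [toL2_apply, delta_apply, inner_smul_left, inner_smul_right]
  simp

end

namespace ConfData
variable {n N : ℕ} (X : ConfData n N)

theorem inner_lmul (f g : SmoothSpinor n N) :
    inner ℂ (toL2 (lmul X.θ X.k f)) (toL2 g) = inner ℂ (toL2 f) (toL2 (lmul X.θ X.k g)) := by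
  simp only [lmul, ← convL2_toL2]
  exact inner_convL2 _ _ X.left_adj _ X.pos.1 _ _

theorem inner_kS (f g : SmoothSpinor n N) :
    inner ℂ (toL2 (X.kS f)) (toL2 g) = inner ℂ (toL2 f) (toL2 (X.kS g)) := by
  rw [← K_toL2, ← K_toL2, K_symm]

/-- The elements `k^a ⊗ v`. -/
def powMono (a : ℕ) (v : Spin N) : SmoothSpinor n N := (X.kS ^ a) (mono 0 v)

theorem powMono_zero (v : Spin N) : X.powMono 0 v = mono 0 v := by simp [powMono]

theorem powMono_succ (a : ℕ) (v : Spin N) : X.powMono (a + 1) v = X.kS (X.powMono a v) := by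
  rw [powMono, pow_succ']
  rfl

theorem powMono_succ_left (a : ℕ) (v : Spin N) :
    X.powMono (a + 1) v = lmul X.θ X.k (X.powMono a v) := by
  induction a with
  | zero => rw [powMono_succ, powMono_zero, rmul_mono_zero]
  | succ a ih => rw [powMono_succ, ih, ← lmul_rmul, ← powMono_succ, ih]

theorem inner_powMono_shift (a b : ℕ) (v w : Spin N) (b' : SmoothAlg n) :
    inner ℂ (toL2 (X.powMono a w)) (toL2 (rmul X.θ b' (X.powMono b v))) =
      inner ℂ (toL2 (X.powMono (a + b) w)) (toL2 (rmul X.θ b' (mono 0 v))) := by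
  induction b generalizing a with
  | zero => rw [powMono_zero, add_zero]
  | succ b ih =>
    rw [powMono_succ_left, ← lmul_rmul, ← inner_lmul, ← powMono_succ_left, ih,
      Nat.add_right_comm, Nat.add_assoc]

theorem inner_powMono_delta (j : Fin n) (a b : ℕ) (v w : Spin N) :
    inner ℂ (toL2 (X.powMono a w)) (toL2 (delta j (X.powMono b v))) = b *
      inner ℂ (toL2 (X.powMono (a + b - 1) w)) (toL2 (rmul X.θ (delta j X.k) (mono 0 v))) := by
  induction b generalizing a with
  | zero =>
    rw [powMono_zero, delta_mono_zero, map_zero, inner_zero_right]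
    simp
  | succ b ih =>
    have e : delta j (X.powMono (b + 1) v) = X.kS (delta j (X.powMono b v)) +
        rmul X.θ (delta j X.k) (X.powMono b v) := by
      rw [powMono_succ]
      exact delta_convOp _ _ j X.k _
    rw [e, map_add, inner_add_right, inner_powMono_shift, ← inner_kS, ← powMono_succ, ih]
    have h1 : a + 1 + b - 1 = a + b := by omega
    have h2 : a + (b + 1) - 1 = a + b := by omega
    rw [h1, h2]
    push_cast
    ring

theorem inner_powMono_delta_eq_zero (j : Fin n) (a b : ℕ) (v w : Spin N) :
    inner ℂ (toL2 (X.powMono a w)) (toL2 (delta j (X.powMono b v))) = 0 := by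
  have key : ∀ q, inner ℂ (toL2 (X.powMono q w))
      (toL2 (rmul X.θ (delta j X.k) (mono 0 v))) = 0 := by
    intro q
    have h := X.inner_powMono_delta j 0 (q + 1) v w
    rw [powMono_zero, ← inner_delta, delta_mono_zero, map_zero, inner_zero_left] at h
    have h1 : 0 + (q + 1) - 1 = q := by omega
    rw [h1] at h
    refine (mul_eq_zero.1 h.symm).resolve_left ?_
    exact_mod_cast Nat.succ_ne_zero q
  rw [inner_powMono_delta, key, mul_zero]

/-! ### The part of the Hilbert space generated by the conformal factor -/

/-- The closed span of the `k^a ⊗ v`. -/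
def confSpace : Submodule ℂ (L2 n (Spin N)) :=
  (Submodule.span ℂ (Set.range fun x : ℕ × Spin N => toL2 (X.powMono x.1 x.2))).topologicalClosure

theorem isClosed_confSpace : IsClosed (X.confSpace : Set (L2 n (Spin N))) :=
  Submodule.isClosed_topologicalClosure _

instance : CompleteSpace X.confSpace := X.isClosed_confSpace.completeSpace_coe

theorem powMono_mem (a : ℕ) (v : Spin N) : toL2 (X.powMono a v) ∈ X.confSpace :=
  Submodule.le_topologicalClosure _ (Submodule.subset_span ⟨(a, v), rfl⟩)

theorem confSpace_le {p : Submodule ℂ (L2 n (Spin N))} (hp : IsClosed (p : Set (L2 n (Spin N))))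
    (h : ∀ a v, toL2 (X.powMono a v) ∈ p) : X.confSpace ≤ p := by
  refine Submodule.topologicalClosure_minimal _ (Submodule.span_le.2 ?_) hp
  rintro _ ⟨x, rfl⟩
  exact h x.1 x.2

theorem confSpace_map (B : L2 n (Spin N) →L[ℂ] L2 n (Spin N))
    (h : ∀ a v, B (toL2 (X.powMono a v)) ∈ X.confSpace) {x : L2 n (Spin N)}
    (hx : x ∈ X.confSpace) : B x ∈ X.confSpace := by
  have h1 : X.confSpace ≤ X.confSpace.comap (B : L2 n (Spin N) →ₗ[ℂ] L2 n (Spin N)) :=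
    X.confSpace_le (X.isClosed_confSpace.preimage B.continuous) h
  exact h1 hx

/-- The orthogonal projection onto the closed span of the `k^a ⊗ v`. -/
def confProj : L2 n (Spin N) →L[ℂ] L2 n (Spin N) := X.confSpace.starProjection

theorem confProj_eq_self_iff {x : L2 n (Spin N)} : X.confProj x = x ↔ x ∈ X.confSpace :=
  Submodule.starProjection_eq_self_iff

theorem confProj_eq_zero_iff {x : L2 n (Spin N)} : X.confProj x = 0 ↔ x ∈ X.confSpaceᗮ :=
  Submodule.starProjection_apply_eq_zero_iff _

theorem confProj_mem (x : L2 n (Spin N)) : X.confProj x ∈ X.confSpace :=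
  Submodule.starProjection_apply_mem _ _

theorem sub_confProj_mem (x : L2 n (Spin N)) : x - X.confProj x ∈ X.confSpaceᗮ :=
  Submodule.sub_starProjection_mem_orthogonal _

theorem commute_confProj {B B' : L2 n (Spin N) →L[ℂ] L2 n (Spin N)}
    (hadj : ∀ x y, inner ℂ (B' x) y = inner ℂ x (B y))
    (h : ∀ a v, B (toL2 (X.powMono a v)) ∈ X.confSpace)
    (h' : ∀ a v, B' (toL2 (X.powMono a v)) ∈ X.confSpace) : Commute B X.confProj := by
  refine ContinuousLinearMap.ext fun x => ?_
  change B (X.confProj x) = X.confProj (B x)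
  have h1 : B (x - X.confProj x) ∈ X.confSpaceᗮ := by
    rw [Submodule.mem_orthogonal]
    intro y hy
    rw [← hadj]
    exact (Submodule.mem_orthogonal _ _).1 (X.sub_confProj_mem x) _ (X.confSpace_map B' h' hy)
  have h2 := X.confProj_eq_self_iff.2 (X.confSpace_map B h (X.confProj_mem x))
  have h3 := X.confProj_eq_zero_iff.2 h1
  rw [map_sub, map_sub, sub_eq_zero] at h3
  rw [h3, h2]

theorem commute_K_confProj : Commute X.K X.confProj := by
  have h : ∀ a v, X.K (toL2 (X.powMono a v)) ∈ X.confSpace := fun a v => by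
    rw [K_toL2, ← powMono_succ]
    exact X.powMono_mem _ _
  exact X.commute_confProj X.K_symm h h

theorem commute_Kinv_confProj : Commute X.Kinv X.confProj := by
  refine ContinuousLinearMap.ext fun x => ?_
  change X.Kinv (X.confProj x) = X.confProj (X.Kinv x)
  have h := congrArg (fun A => A (X.Kinv x)) X.commute_K_confProj.eq
  change X.K (X.confProj (X.Kinv x)) = X.confProj (X.K (X.Kinv x)) at h
  rw [K_Kinv] at h
  rw [← h, Kinv_K]

/-- The action of a matrix on the Hilbert space. -/
def spinL2 (φ : Mat N) : L2 n (Spin N) →L[ℂ] L2 n (Spin N) :=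
  diagOp (fun _ => φ) ‖φ‖ (fun _ => le_rfl)

theorem spinL2_toL2 (φ : Mat N) (f : SmoothSpinor n N) :
    spinL2 φ (toL2 f) = toL2 (spinMap φ f) := rfl

theorem spinMap_kS (φ : Mat N) (f : SmoothSpinor n N) :
    spinMap φ (X.kS f) = X.kS (spinMap φ f) := by
  apply Subtype.ext
  funext l
  have h := (summable_conv (fun p q => cocycle X.θ q p) (fun p q => norm_cocycle X.θ q p)
    X.k f l).of_norm.hasSum.mapL φ
  refine h.tsum_eq.symm.trans ?_
  exact tsum_congr fun p => map_smul φ _ _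

theorem spinMap_mono (φ : Mat N) (m : Idx n) (v : Spin N) :
    spinMap φ (mono m v) = mono m (φ v) := by
  apply Subtype.ext
  funext l
  change φ ((mono m v).1 l) = _
  by_cases h : l = m
  · rw [h, mono_apply_self, mono_apply_self]
  · rw [mono_apply_ne h, mono_apply_ne h, map_zero]

theorem spinMap_powMono (φ : Mat N) (a : ℕ) (v : Spin N) :
    spinMap φ (X.powMono a v) = X.powMono a (φ v) := by
  induction a with
  | zero => rw [powMono_zero, powMono_zero, spinMap_mono]
  | succ a ih => rw [powMono_succ, powMono_succ, spinMap_kS, ih]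

theorem commute_spinL2_confProj (φ : Mat N) : Commute (spinL2 φ) X.confProj := by
  refine X.commute_confProj (B' := spinL2 (ContinuousLinearMap.adjoint φ)) (fun x y => ?_)
    (fun a v => ?_) (fun a v => ?_)
  · rw [lp.inner_eq_tsum, lp.inner_eq_tsum]
    exact tsum_congr fun l => ContinuousLinearMap.adjoint_inner_left φ _ _
  · rw [spinL2_toL2, spinMap_powMono]
    exact X.powMono_mem _ _
  · rw [spinL2_toL2, spinMap_powMono]
    exact X.powMono_mem _ _

/-! ### Filtered operators -/

/-- The tempered operators of filtration degree `j`: those of degree `0` preserve the closed span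
of the `k^a ⊗ v` and its complement, and those of degree `1` map the first into the second. -/
def grade (j : ℕ) : Submodule ℂ (Module.End ℂ (SmoothSpinor n N)) where
  carrier := {A | Tempered A ∧
    (j = 0 → (∀ f, toL2 f ∈ X.confSpace → toL2 (A f) ∈ X.confSpace) ∧
      (∀ f, toL2 f ∈ X.confSpaceᗮ → toL2 (A f) ∈ X.confSpaceᗮ)) ∧
    (j = 1 → ∀ f, toL2 f ∈ X.confSpace → toL2 (A f) ∈ X.confSpaceᗮ)}
  zero_mem' := ⟨tempered_zero, fun _ => ⟨fun f _ => by simp, fun f _ => by simp⟩,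
    fun _ f _ => by simp⟩
  add_mem' := fun {A B} hA hB => ⟨hA.1.add hB.1,
    fun h => ⟨fun f hf => by
      rw [LinearMap.add_apply, map_add]
      exact add_mem ((hA.2.1 h).1 f hf) ((hB.2.1 h).1 f hf), fun f hf => by
      rw [LinearMap.add_apply, map_add]
      exact add_mem ((hA.2.1 h).2 f hf) ((hB.2.1 h).2 f hf)⟩,
    fun h f hf => by
      rw [LinearMap.add_apply, map_add]
      exact add_mem (hA.2.2 h f hf) (hB.2.2 h f hf)⟩
  smul_mem' := fun c A hA => ⟨hA.1.smul c,
    fun h => ⟨fun f hf => by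
      rw [LinearMap.smul_apply, map_smul]
      exact Submodule.smul_mem _ _ ((hA.2.1 h).1 f hf), fun f hf => by
      rw [LinearMap.smul_apply, map_smul]
      exact Submodule.smul_mem _ _ ((hA.2.1 h).2 f hf)⟩,
    fun h f hf => by
      rw [LinearMap.smul_apply, map_smul]
      exact Submodule.smul_mem _ _ (hA.2.2 h f hf)⟩

variable {X}

theorem tempered_of_grade {j : ℕ} {A : Module.End ℂ (SmoothSpinor n N)} (h : A ∈ X.grade j) :
    Tempered A := h.1

theorem mul_mem_grade {i j : ℕ} {A B : Module.End ℂ (SmoothSpinor n N)} (hA : A ∈ X.grade i)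
    (hB : B ∈ X.grade j) : A * B ∈ X.grade (i + j) := by
  refine ⟨hA.1.mul hB.1, fun h => ?_, fun h f hf => ?_⟩
  · obtain ⟨rfl, rfl⟩ : i = 0 ∧ j = 0 := by omega
    exact ⟨fun f hf => (hA.2.1 rfl).1 _ ((hB.2.1 rfl).1 f hf),
      fun f hf => (hA.2.1 rfl).2 _ ((hB.2.1 rfl).2 f hf)⟩
  · rcases Nat.eq_zero_or_pos i with rfl | hi
    · exact (hA.2.1 rfl).2 _ (hB.2.2 (by omega) f hf)
    · obtain ⟨rfl, rfl⟩ : i = 1 ∧ j = 0 := by omega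
      exact hA.2.2 rfl _ ((hB.2.1 rfl).1 f hf)

theorem mem_grade_zero_of_commute {A : Module.End ℂ (SmoothSpinor n N)} (hA : Tempered A)
    {B : L2 n (Spin N) →L[ℂ] L2 n (Spin N)} (h : ∀ f, toL2 (A f) = B (toL2 f))
    (hB : Commute B X.confProj) : A ∈ X.grade 0 := by
  have hB' : ∀ x, X.confProj (B x) = B (X.confProj x) := fun x =>
    (congrArg (fun A => A x) hB.eq).symm
  refine ⟨hA, fun _ => ⟨fun f hf => ?_, fun f hf => ?_⟩, fun h => by omega⟩
  · rw [← confProj_eq_self_iff] at hf ⊢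
    rw [h, hB', hf]
  · rw [← confProj_eq_zero_iff] at hf ⊢
    rw [h, hB', hf, map_zero]

variable (X)

theorem one_mem_grade : (1 : Module.End ℂ (SmoothSpinor n N)) ∈ X.grade 0 :=
  mem_grade_zero_of_commute tempered_one (B := 1) (fun _ => rfl) (Commute.one_left _)

theorem kS_mem_grade : X.kS ∈ X.grade 0 :=
  mem_grade_zero_of_commute X.tempered_kS (fun f => (X.K_toL2 f).symm) X.commute_K_confProj

theorem kinvS_mem_grade : X.kinvS ∈ X.grade 0 :=
  mem_grade_zero_of_commute X.tempered_kinvS X.toL2_kinvS X.commute_Kinv_confProj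

theorem spinMap_mem_grade (φ : Mat N) : spinMap φ ∈ X.grade 0 :=
  mem_grade_zero_of_commute (tempered_spinMap φ) (fun f => (spinL2_toL2 φ f).symm)
    (X.commute_spinL2_confProj φ)

theorem delta_mem_grade (j : Fin n) : delta j ∈ X.grade 1 := by
  refine ⟨tempered_delta j, fun h => by omega, fun _ f hf => ?_⟩
  have h1 : ∀ a v, toL2 (delta j (X.powMono a v)) ∈ X.confSpaceᗮ := by
    intro a v
    have h2 : X.confSpace ≤ (ℂ ∙ toL2 (delta j (X.powMono a v)))ᗮ := by
      refine X.confSpace_le (Submodule.isClosed_orthogonal _) fun b w => ?_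
      rw [Submodule.mem_orthogonal_singleton_iff_inner_left]
      exact X.inner_powMono_delta_eq_zero j b a v w
    rw [Submodule.mem_orthogonal]
    intro y hy
    exact Submodule.mem_orthogonal_singleton_iff_inner_left.1 (h2 hy)
  have h3 : X.confSpace ≤ (ℂ ∙ toL2 (delta j f))ᗮ := by
    refine X.confSpace_le (Submodule.isClosed_orthogonal _) fun b w => ?_
    rw [Submodule.mem_orthogonal_singleton_iff_inner_left, ← inner_delta]
    exact Submodule.inner_left_of_mem_orthogonal hf (h1 b w)
  rw [Submodule.mem_orthogonal]
  intro y hy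
  exact Submodule.mem_orthogonal_singleton_iff_inner_left.1 (h3 hy)

theorem D_mem_grade : X.D ∈ X.grade 1 := by
  have h : dirac X.γ ∈ X.grade 1 := by
    refine Submodule.sum_mem _ fun j _ => ?_
    have h1 := mul_mem_grade (X.spinMap_mem_grade (X.γ j)) (X.delta_mem_grade j)
    rwa [zero_add] at h1
  have h2 := mul_mem_grade (mul_mem_grade X.kS_mem_grade h) X.kS_mem_grade
  rwa [zero_add, add_zero] at h2

theorem apply_zero_of_grade_one {A : Module.End ℂ (SmoothSpinor n N)} (hA : A ∈ X.grade 1)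
    (v : Spin N) : (A (mono 0 v)).1 0 = 0 := by
  have h0 : ∀ w, toL2 (mono (0 : Idx n) w) ∈ X.confSpace := fun w => by
    rw [← X.powMono_zero]
    exact X.powMono_mem 0 w
  have h1 := hA.2.2 rfl _ (h0 v)
  have h2 := Submodule.inner_right_of_mem_orthogonal (h0 ((A (mono 0 v)).1 0)) h1
  rw [inner_mono] at h2
  exact inner_self_eq_zero.1 h2

end ConfData

/-! ### Conjugation by the monomials -/

section
variable {n : ℕ} {V : Type} [NormedAddCommGroup V] [NormedSpace ℂ V]

theorem summable_shift_weight (s : ℕ) (m : Idx n) (f : Schw n V) :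
    Summable (fun l => (1 + ‖m‖) ^ s * ((1 + ‖l - m‖) ^ s * ‖f.1 (l - m)‖)) :=
  (((Equiv.subRight m).summable_iff).2 (f.2 s)).mul_left _

theorem weight_shift_le (s : ℕ) (m l : Idx n) :
    (1 + ‖l‖) ^ s ≤ (1 + ‖m‖) ^ s * (1 + ‖l - m‖) ^ s := by
  rw [← mul_pow]
  refine pow_le_pow_left₀ (by positivity) ?_ s
  nlinarith [norm_nonneg m, norm_nonneg (l - m), norm_le_norm_add_norm_sub l m]

/-- Left multiplication by `U^m`. -/
def U (θ : Matrix (Fin n) (Fin n) ℝ) (m : Idx n) : Module.End ℂ (Schw n V) where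
  toFun f := ⟨fun l => cocycle θ m (l - m) • f.1 (l - m), fun s => by
    refine Summable.of_nonneg_of_le (fun l => by positivity) (fun l => ?_)
      (summable_shift_weight s m f)
    rw [norm_smul, norm_cocycle, one_mul, ← mul_assoc]
    exact mul_le_mul_of_nonneg_right (weight_shift_le s m l) (norm_nonneg _)⟩
  map_add' f g := Subtype.ext (funext fun l => smul_add _ _ _)
  map_smul' c f := Subtype.ext (funext fun l => smul_comm _ _ _)

theorem U_apply (θ : Matrix (Fin n) (Fin n) ℝ) (m : Idx n) (f : Schw n V) (l : Idx n) :
    (U θ m f).1 l = cocycle θ m (l - m) • f.1 (l - m) := rfl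

theorem sn_U_le (θ : Matrix (Fin n) (Fin n) ℝ) (s : ℕ) (m : Idx n) (f : Schw n V) :
    sn s (U θ m f) ≤ (1 + ‖m‖) ^ s * sn s f := by
  have h : (1 + ‖m‖) ^ s * sn s f =
      ∑' l, (1 + ‖m‖) ^ s * ((1 + ‖l - m‖) ^ s * ‖f.1 (l - m)‖) := by
    rw [tsum_mul_left, sn, ← (Equiv.subRight m).tsum_eq]
    rfl
  rw [h]
  refine ((U θ m f).2 s).tsum_le_tsum (fun l => ?_) (summable_shift_weight s m f)
  rw [U_apply, norm_smul, norm_cocycle, one_mul, ← mul_assoc]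
  exact mul_le_mul_of_nonneg_right (weight_shift_le s m l) (norm_nonneg _)

theorem U_neg_U {θ : Matrix (Fin n) (Fin n) ℝ} (hθ : θ.transpose = -θ) (m : Idx n)
    (f : Schw n V) : U θ (-m) (U θ m f) = f := by
  apply Subtype.ext
  funext l
  rw [U_apply, U_apply, smul_smul]
  have h : l - -m - m = l := by abel
  have h1 : cocycle θ (-m) (l - -m) * cocycle θ m l = 1 := by
    rw [cocycle_neg_left, sub_neg_eq_add, cocycle_add_right, cocycle_self θ hθ, mul_one]
    exact inv_mul_cancel₀ (cocycle_ne_zero θ _ _)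
  rw [h, h1, one_smul]

theorem U_U_neg {θ : Matrix (Fin n) (Fin n) ℝ} (hθ : θ.transpose = -θ) (m : Idx n)
    (f : Schw n V) : U θ m (U θ (-m) f) = f := by
  have h := U_neg_U hθ (-m) f
  rwa [neg_neg] at h

theorem sn_le_U {θ : Matrix (Fin n) (Fin n) ℝ} (hθ : θ.transpose = -θ) (s : ℕ) (m : Idx n)
    (f : Schw n V) : sn s f ≤ (1 + ‖m‖) ^ s * sn s (U θ m f) := by
  have h := sn_U_le θ s (-m) (U θ m f)
  rwa [U_neg_U hθ, norm_neg] at h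

theorem norm_toL2_U (θ : Matrix (Fin n) (Fin n) ℝ) (m : Idx n) (f : Schw n V) :
    toL2 (U θ m f) = shiftOp (fun p q => cocycle θ p q) (fun p q => norm_cocycle θ p q) m
      (toL2 f) := rfl

theorem rmul_U [CompleteSpace V] (θ : Matrix (Fin n) (Fin n) ℝ) (b : SmoothAlg n) (m : Idx n)
    (f : Schw n V) : rmul θ b (U θ m f) = U θ m (rmul θ b f) := by
  apply toL2_injective
  rw [norm_toL2_U, rmul, ← convL2_toL2, ← convL2_toL2, norm_toL2_U]
  refine (convL2_hasSum _ _ b _).unique ?_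
  refine ((convL2_hasSum _ _ b (toL2 f)).mapL _).congr_fun fun q => ?_
  rw [map_smul, shiftOp_comm]

/-- The operator `U^(-m) P U^m`. -/
def conjU (θ : Matrix (Fin n) (Fin n) ℝ) (m : Idx n) (P : Module.End ℂ (Schw n V)) :
    Module.End ℂ (Schw n V) := U θ (-m) * P * U θ m

theorem conjU_apply (θ : Matrix (Fin n) (Fin n) ℝ) (m : Idx n) (P : Module.End ℂ (Schw n V))
    (f : Schw n V) : conjU θ m P f = U θ (-m) (P (U θ m f)) := rfl

theorem U_conjU {θ : Matrix (Fin n) (Fin n) ℝ} (hθ : θ.transpose = -θ) (m : Idx n)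
    (P : Module.End ℂ (Schw n V)) (f : Schw n V) : U θ m (conjU θ m P f) = P (U θ m f) := by
  rw [conjU_apply, U_U_neg hθ]

theorem conjU_mul {θ : Matrix (Fin n) (Fin n) ℝ} (hθ : θ.transpose = -θ) (m : Idx n)
    (P P' : Module.End ℂ (Schw n V)) (f : Schw n V) :
    conjU θ m (P * P') f = conjU θ m P (conjU θ m P' f) := by
  rw [conjU_apply, conjU_apply, U_conjU hθ]
  rfl

end

section
variable {n N : ℕ}
open ConfData

theorem U_mono_zero (θ : Matrix (Fin n) (Fin n) ℝ) (m : Idx n) (v : Spin N) :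
    U θ m (mono 0 v) = mono m v := by
  apply Subtype.ext
  funext l
  rw [U_apply]
  by_cases h : l = m
  · rw [h, sub_self, mono_apply_self, mono_apply_self, cocycle_zero_right, one_smul]
  · rw [mono_apply_ne h, mono_apply_ne (sub_ne_zero.2 h), smul_zero]

theorem spinMap_U (θ : Matrix (Fin n) (Fin n) ℝ) (φ : Mat N) (m : Idx n)
    (f : SmoothSpinor n N) : spinMap φ (U θ m f) = U θ m (spinMap φ f) :=
  Subtype.ext (funext fun _ => map_smul φ _ _)

theorem dirac_U (θ : Matrix (Fin n) (Fin n) ℝ) (γ : Fin n → Mat N) (m : Idx n)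
    (f : SmoothSpinor n N) :
    dirac γ (U θ m f) = U θ m (dirac γ f + spinMap (slash γ (toCov m)) f) := by
  apply Subtype.ext
  funext l
  rw [dirac_apply, U_apply, U_apply, map_smul]
  congr 1
  change _ = (dirac γ f).1 (l - m) + slash γ (toCov m) (f.1 (l - m))
  have h : toCov l = toCov (l - m) + toCov m := by rw [← toCov_add, sub_add_cancel]
  rw [dirac_apply, h, slash_add]
  rfl

end

/-! ### Families of operators of a given order -/

section
variable {n : ℕ} {V : Type} [NormedAddCommGroup V] [NormedSpace ℂ V]

/-- The family `A m` is `O(|m|^r)` on smooth vectors. -/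
def OrdBd (r : ℤ) (A : Idx n → Schw n V → Schw n V) : Prop :=
  ∀ s, ∃ s' C, 0 ≤ C ∧ ∀ m f, m ≠ 0 → sn s (A m f) ≤ C * ‖m‖ ^ r * sn s' f

theorem OrdBd.add {r : ℤ} {A B : Idx n → Schw n V → Schw n V} (hA : OrdBd r A)
    (hB : OrdBd r B) : OrdBd r fun m f => A m f + B m f := by
  intro s
  obtain ⟨s1, C1, h1, hA⟩ := hA s
  obtain ⟨s2, C2, h2, hB⟩ := hB s
  refine ⟨max s1 s2, C1 + C2, by positivity, fun m f hm => (sn_add_le s _ _).trans ?_⟩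
  rw [add_mul, add_mul]
  refine add_le_add ((hA m f hm).trans ?_) ((hB m f hm).trans ?_)
  · gcongr; exact sn_mono (le_max_left _ _) f
  · gcongr; exact sn_mono (le_max_right _ _) f

theorem ordBd_zero (r : ℤ) : OrdBd r fun (_ : Idx n) (_ : Schw n V) => (0 : Schw n V) :=
  fun s => ⟨0, 0, le_rfl, fun m f _ => by simp⟩

theorem OrdBd.sum {ι : Type*} {r : ℤ} (t : Finset ι) {A : ι → Idx n → Schw n V → Schw n V}
    (hA : ∀ i ∈ t, OrdBd r (A i)) : OrdBd r fun m f => ∑ i ∈ t, A i m f := by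
  classical
  induction t using Finset.induction_on with
  | empty => simpa using ordBd_zero r
  | insert i t hi ih =>
    simp only [Finset.sum_insert hi]
    exact (hA i (Finset.mem_insert_self _ _)).add
      (ih fun j hj => hA j (Finset.mem_insert_of_mem hj))

theorem OrdBd.comp {r r' : ℤ} {A B : Idx n → Schw n V → Schw n V} (hA : OrdBd r A)
    (hB : OrdBd r' B) : OrdBd (r + r') fun m f => A m (B m f) := by
  intro s
  obtain ⟨s1, C1, h1, hA⟩ := hA s
  obtain ⟨s2, C2, h2, hB⟩ := hB s1
  refine ⟨s2, C1 * C2, by positivity, fun m f hm => (hA m _ hm).trans ?_⟩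
  rw [zpow_add₀ (norm_ne_zero_iff.2 hm)]
  calc C1 * ‖m‖ ^ r * sn s1 (B m f) ≤ C1 * ‖m‖ ^ r * (C2 * ‖m‖ ^ r' * sn s2 f) := by
        gcongr
        exact hB m f hm
    _ = _ := by ring

theorem OrdBd.mono {r r' : ℤ} (h : r ≤ r') {A : Idx n → Schw n V → Schw n V}
    (hA : OrdBd r A) : OrdBd r' A := by
  intro s
  obtain ⟨s1, C1, h1, hA⟩ := hA s
  refine ⟨s1, C1, h1, fun m f hm => (hA m f hm).trans ?_⟩
  gcongr
  · exact sn_nonneg _ _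
  · exact one_le_norm_idx hm

theorem OrdBd.congr {r : ℤ} {A B : Idx n → Schw n V → Schw n V} (hA : OrdBd r A)
    (h : ∀ m f, m ≠ 0 → B m f = A m f) : OrdBd r B := by
  intro s
  obtain ⟨s1, C1, h1, hA⟩ := hA s
  exact ⟨s1, C1, h1, fun m f hm => by rw [h m f hm]; exact hA m f hm⟩

theorem Tempered.ordBd {A : Module.End ℂ (Schw n V)} (hA : Tempered A) :
    OrdBd 0 fun _ f => A f := by
  intro s
  obtain ⟨s1, C1, h1, hA⟩ := hA s
  exact ⟨s1, C1, h1, fun m f _ => by simpa using hA f⟩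

theorem norm_toCov_le (m : Idx n) : ‖toCov m‖ ≤ (n + 1) * ‖m‖ := by
  rw [EuclideanSpace.norm_eq]
  refine Real.sqrt_le_iff.2 ⟨by positivity, ?_⟩
  calc ∑ i, ‖(toCov m) i‖ ^ 2 ≤ ∑ _i : Fin n, ‖m‖ ^ 2 := by
        refine Finset.sum_le_sum fun i _ => ?_
        gcongr
        have h : ‖(toCov m) i‖ = ‖m i‖ := by simp [toCov, Int.norm_eq_abs]
        rw [h]
        exact norm_le_pi_norm m i
    _ = n * ‖m‖ ^ 2 := by simp
    _ ≤ ((n + 1) * ‖m‖) ^ 2 := by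
        rw [mul_pow]
        gcongr
        nlinarith [(Nat.cast_nonneg n : (0 : ℝ) ≤ n)]

theorem toCov_ne_zero {m : Idx n} (hm : m ≠ 0) : toCov m ≠ 0 :=
  norm_pos_iff.1 (ConfData.norm_toCov_pos hm)

theorem exists_norm_toCov_zpow_le (n : ℕ) (r : ℤ) :
    ∃ C : ℝ, 0 ≤ C ∧ ∀ m : Idx n, m ≠ 0 → ‖toCov m‖ ^ r ≤ C * ‖m‖ ^ r := by
  rcases le_total 0 r with hr | hr
  · obtain ⟨j, rfl⟩ := Int.eq_ofNat_of_zero_le hr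
    refine ⟨(n + 1) ^ j, by positivity, fun m _ => ?_⟩
    simp only [zpow_natCast, ← mul_pow]
    exact pow_le_pow_left₀ (norm_nonneg _) (norm_toCov_le m) j
  · refine ⟨1, zero_le_one, fun m hm => ?_⟩
    rw [one_mul]
    obtain ⟨j, hj⟩ := Int.eq_ofNat_of_zero_le (neg_nonneg.2 hr)
    have hr' : r = -(j : ℤ) := by
      have : -r = (j : ℤ) := hj
      omega
    rw [hr', zpow_neg, zpow_neg, zpow_natCast, zpow_natCast]
    have h0 : 0 < ‖m‖ := norm_pos_iff.2 hm
    exact inv_anti₀ (by positivity) (pow_le_pow_left₀ (norm_nonneg _) (norm_le_norm_toCov m) j)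

end

/-- A smooth function on the cotangent space without the origin, positively homogeneous of
degree `r`. -/
structure IsHomogFun {n : ℕ} (r : ℤ) (g : Cov n → ℂ) : Prop where
  smooth : ContDiffOn ℝ ∞ g {0}ᶜ
  homogeneous : ∀ t : ℝ, 0 < t → ∀ ξ : Cov n, ξ ≠ 0 → g (t • ξ) = ((t ^ r : ℝ) : ℂ) * g ξ

section
variable {n : ℕ}

theorem IsHomogFun.mul {r r' : ℤ} {g g' : Cov n → ℂ} (h : IsHomogFun r g)
    (h' : IsHomogFun r' g') : IsHomogFun (r + r') (g * g') where
  smooth := h.smooth.mul h'.smooth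
  homogeneous t ht ξ hξ := by
    rw [Pi.mul_apply, Pi.mul_apply, h.homogeneous t ht ξ hξ, h'.homogeneous t ht ξ hξ,
      zpow_add₀ ht.ne']
    push_cast
    ring

theorem isHomogFun_one : IsHomogFun 0 (1 : Cov n → ℂ) where
  smooth := contDiffOn_const
  homogeneous t ht ξ hξ := by simp

theorem isHomogFun_coord (j : Fin n) : IsHomogFun 1 fun ξ : Cov n => ((ξ j : ℝ) : ℂ) where
  smooth := by
    refine ContDiff.contDiffOn ?_
    exact Complex.ofRealCLM.contDiff.comp (EuclideanSpace.proj (𝕜 := ℝ) j).contDiff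
  homogeneous t ht ξ hξ := by simp

theorem isHomogFun_norm_zpow (r : ℤ) : IsHomogFun r fun ξ : Cov n => ((‖ξ‖ ^ r : ℝ) : ℂ) where
  smooth := by
    intro ξ hξ
    have h : ContDiffAt ℝ ∞ (fun ξ : Cov n => ‖ξ‖ ^ r) ξ := by
      have h0 : ContDiffAt ℝ ∞ (fun ξ : Cov n => ‖ξ‖) ξ := contDiffAt_norm ℝ hξ
      cases r with
      | ofNat j => simpa using h0.pow j
      | negSucc j =>
        simp only [zpow_negSucc]
        exact (h0.pow (j + 1)).inv (pow_ne_zero _ (norm_ne_zero_iff.2 hξ))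
    exact (Complex.ofRealCLM.contDiff.contDiffAt.comp ξ h).contDiffWithinAt
  homogeneous t ht ξ hξ := by
    rw [norm_smul, Real.norm_of_nonneg ht.le, mul_zpow]
    push_cast
    rfl

theorem IsHomogFun.bound {r : ℤ} {g : Cov n → ℂ} (h : IsHomogFun r g) :
    ∃ C, 0 ≤ C ∧ ∀ ξ, ξ ≠ 0 → ‖g ξ‖ ≤ C * ‖ξ‖ ^ r := by
  obtain ⟨C, hC⟩ := (isCompact_sphere (0 : Cov n) 1).exists_bound_of_continuousOn
    (h.smooth.continuousOn.mono fun ξ hξ => by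
      rintro rfl
      simp at hξ)
  refine ⟨|C|, abs_nonneg _, fun ξ hξ => ?_⟩
  have h0 : 0 < ‖ξ‖ := norm_pos_iff.2 hξ
  have h1 := h.homogeneous ‖ξ‖ h0 (‖ξ‖⁻¹ • ξ) (smul_ne_zero (inv_ne_zero h0.ne') hξ)
  rw [smul_inv_smul₀ h0.ne'] at h1
  rw [h1, norm_mul, Complex.norm_real, Real.norm_of_nonneg (by positivity), mul_comm]
  gcongr
  refine (hC _ ?_).trans (le_abs_self C)
  rw [mem_sphere_zero_iff_norm, norm_smul, norm_inv, norm_norm, inv_mul_cancel₀ h0.ne']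

end

namespace ConfData
variable {n N : ℕ} (X : ConfData n N)

/-- The span of the operator valued functions `ξ ↦ g(ξ) A`, with `g` homogeneous of degree `r` and
`A` of filtration degree `j`. -/
def homSpan (r : ℤ) (j : ℕ) : Submodule ℂ (Cov n → Module.End ℂ (SmoothSpinor n N)) :=
  Submodule.span ℂ {F | ∃ g, IsHomogFun r g ∧ ∃ A ∈ X.grade j, F = fun ξ => g ξ • A}

variable {X}

theorem smul_mem_homSpan {r : ℤ} {j : ℕ} {g : Cov n → ℂ} (hg : IsHomogFun r g)
    {A : Module.End ℂ (SmoothSpinor n N)} (hA : A ∈ X.grade j) :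
    (fun ξ => g ξ • A) ∈ X.homSpan r j := Submodule.subset_span ⟨g, hg, A, hA, rfl⟩

theorem const_mem_homSpan {j : ℕ} {A : Module.End ℂ (SmoothSpinor n N)} (hA : A ∈ X.grade j) :
    (fun _ => A) ∈ X.homSpan 0 j := by
  have h1 := smul_mem_homSpan (X := X) isHomogFun_one hA
  convert h1 using 1
  funext ξ
  exact (one_smul ℂ A).symm

theorem mul_mem_homSpan {r r' : ℤ} {j j' : ℕ} {F G : Cov n → Module.End ℂ (SmoothSpinor n N)}
    (hF : F ∈ X.homSpan r j) (hG : G ∈ X.homSpan r' j') :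
    F * G ∈ X.homSpan (r + r') (j + j') := by
  have h := Submodule.mul_mem_mul hF hG
  rw [homSpan, homSpan, Submodule.span_mul_span] at h
  refine Submodule.span_mono ?_ h
  rintro _ ⟨_, ⟨g, hg, A, hA, rfl⟩, _, ⟨g', hg', A', hA', rfl⟩, rfl⟩
  refine ⟨g * g', hg.mul hg', A * A', mul_mem_grade hA hA', funext fun ξ => ?_⟩
  exact smul_mul_smul_comm (g ξ) A (g' ξ) A'

theorem mem_grade_of_homSpan {r : ℤ} {j : ℕ} {F : Cov n → Module.End ℂ (SmoothSpinor n N)}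
    (hF : F ∈ X.homSpan r j) (ξ : Cov n) : F ξ ∈ X.grade j := by
  induction hF using Submodule.span_induction with
  | mem F h =>
    obtain ⟨g, -, A, hA, rfl⟩ := h
    exact Submodule.smul_mem _ _ hA
  | zero => exact zero_mem _
  | add F G _ _ h1 h2 => exact add_mem h1 h2
  | smul c F _ h => exact Submodule.smul_mem _ _ h

theorem ordBd_of_homSpan {r : ℤ} {j : ℕ} {F : Cov n → Module.End ℂ (SmoothSpinor n N)}
    (hF : F ∈ X.homSpan r j) : OrdBd r fun m f => F (toCov m) f := by
  induction hF using Submodule.span_induction with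
  | mem F h =>
    obtain ⟨g, hg, A, hA, rfl⟩ := h
    intro s
    obtain ⟨s', C, hC, h1⟩ := tempered_of_grade hA s
    obtain ⟨C1, hC1, h2⟩ := hg.bound
    obtain ⟨C2, hC2, h3⟩ := exists_norm_toCov_zpow_le n r
    refine ⟨s', C1 * C2 * C, by positivity, fun m f hm => ?_⟩
    change sn s (g (toCov m) • A f) ≤ _
    rw [sn_smul]
    calc ‖g (toCov m)‖ * sn s (A f) ≤ (C1 * (C2 * ‖m‖ ^ r)) * (C * sn s' f) := by
          refine mul_le_mul ((h2 _ (toCov_ne_zero hm)).trans ?_) (h1 f) (sn_nonneg _ _)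
            (by positivity)
          gcongr
          exact h3 m hm
      _ = _ := by ring
  | zero => exact ordBd_zero r
  | add F G _ _ h1 h2 => exact h1.add h2
  | smul c F _ h =>
    intro s
    obtain ⟨s', C, hC, h1⟩ := h s
    refine ⟨s', ‖c‖ * C, by positivity, fun m f hm => ?_⟩
    have h2 := mul_le_mul_of_nonneg_left (h1 m f hm) (norm_nonneg c)
    rw [← sn_smul] at h2
    exact h2.trans (le_of_eq (by ring))

variable (X)

/-- `P` has the expansion `U^(-m) P U^m ~ ∑ F_j(m)`, where `F_j` is homogeneous of degree
`d - j`. -/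
structure IsExp (P : Module.End ℂ (SmoothSpinor n N)) (d : ℤ)
    (F : ℕ → Cov n → Module.End ℂ (SmoothSpinor n N)) : Prop where
  mem : ∀ j : ℕ, F j ∈ X.homSpan (d - j) j
  rem : ∀ J : ℕ, OrdBd (d - J) fun m f =>
    conjU X.θ m P f - ∑ j ∈ Finset.range J, F j (toCov m) f

variable {X}

theorem IsExp.ordBd {P : Module.End ℂ (SmoothSpinor n N)} {d : ℤ}
    {F : ℕ → Cov n → Module.End ℂ (SmoothSpinor n N)} (h : X.IsExp P d F) :
    OrdBd d fun m f => conjU X.θ m P f := by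
  have h1 := h.rem 0
  simpa using h1

theorem sum_range_antidiagonal {M : Type*} [AddCommMonoid M] (f : ℕ → ℕ → M) (J : ℕ) :
    ∑ j ∈ Finset.range J, ∑ x ∈ Finset.HasAntidiagonal.antidiagonal j, f x.1 x.2 =
      ∑ i ∈ Finset.range J, ∑ k ∈ Finset.range (J - i), f i k := by
  induction J with
  | zero => simp
  | succ J ih =>
    rw [Finset.sum_range_succ, ih, Finset.Nat.sum_antidiagonal_eq_sum_range_succ f,
      Finset.sum_range_succ, Finset.sum_range_succ, ← add_assoc, ← Finset.sum_add_distrib]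
    congr 1
    · refine Finset.sum_congr rfl fun i hi => ?_
      have : J + 1 - i = (J - i) + 1 := by
        have := Finset.mem_range.1 hi
        omega
      rw [this, Finset.sum_range_succ]
    · simp

theorem IsExp.mul {P P' : Module.End ℂ (SmoothSpinor n N)} {d d' : ℤ}
    {F G : ℕ → Cov n → Module.End ℂ (SmoothSpinor n N)} (h : X.IsExp P d F)
    (h' : X.IsExp P' d' G) :
    X.IsExp (P * P') (d + d') fun j => ∑ x ∈ Finset.HasAntidiagonal.antidiagonal j, F x.1 * G x.2 where
  mem j := by
    refine Submodule.sum_mem _ fun x hx => ?_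
    have h1 := mul_mem_homSpan (h.mem x.1) (h'.mem x.2)
    rw [Finset.HasAntidiagonal.mem_antidiagonal] at hx
    have e : d - x.1 + (d' - x.2) = d + d' - j := by rw [← hx]; push_cast; ring
    rwa [hx, e] at h1
  rem J := by
    have h1 : OrdBd (d + d' - J) fun m f =>
        conjU X.θ m P (conjU X.θ m P' f) -
          ∑ j ∈ Finset.range J, F j (toCov m) (conjU X.θ m P' f) := by
      have := (h.rem J).comp h'.ordBd
      refine OrdBd.mono (le_of_eq ?_) this
      ring
    have h2 : OrdBd (d + d' - J) fun m f => ∑ i ∈ Finset.range J, F i (toCov m)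
        (conjU X.θ m P' f - ∑ k ∈ Finset.range (J - i), G k (toCov m) f) := by
      refine OrdBd.sum _ fun i hi => ?_
      have := (ordBd_of_homSpan (h.mem i)).comp (h'.rem (J - i))
      refine OrdBd.mono (le_of_eq ?_) this
      have hi' : i ≤ J := (Finset.mem_range.1 hi).le
      push_cast [Nat.cast_sub hi']
      ring
    refine (h1.add h2).congr fun m f _ => ?_
    rw [conjU_mul X.skew]
    have e : ∑ j ∈ Finset.range J, (∑ x ∈ Finset.HasAntidiagonal.antidiagonal j, F x.1 * G x.2) (toCov m) f =
        ∑ i ∈ Finset.range J, ∑ k ∈ Finset.range (J - i), F i (toCov m) (G k (toCov m) f) := by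
      rw [← sum_range_antidiagonal]
      refine Finset.sum_congr rfl fun j _ => ?_
      rw [Finset.sum_apply, LinearMap.sum_apply]
      rfl
    rw [e]
    simp only [map_sub, map_sum, Finset.sum_sub_distrib]
    abel

/-- An operator commuting with the `U^m` is its own expansion. -/
theorem isExp_of_commute {A : Module.End ℂ (SmoothSpinor n N)} (hA : A ∈ X.grade 0)
    (h : ∀ m f, A (U X.θ m f) = U X.θ m (A f)) :
    X.IsExp A 0 fun j => if j = 0 then fun _ => A else 0 where
  mem j := by
    split_ifs with hj
    · subst hj
      simpa using const_mem_homSpan hA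
    · exact zero_mem _
  rem J := by
    have e : ∀ m f, conjU X.θ m A f = A f := fun m f => by
      rw [conjU_apply, h, U_neg_U X.skew]
    rcases J with _ | J
    · refine OrdBd.congr (tempered_of_grade hA).ordBd fun m f _ => ?_
      rw [e, Finset.range_zero, Finset.sum_empty, sub_zero]
    · refine (ordBd_zero _).congr fun m f _ => ?_
      rw [e, Finset.sum_range_succ', Finset.sum_eq_zero]
      · simp
      · intro j _
        simp

variable (X)

theorem D_U (m : Idx n) (f : SmoothSpinor n N) :
    X.D (U X.θ m f) = U X.θ m (X.D f + spinMap (slash X.γ (toCov m)) (X.kS (X.kS f))) := by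
  rw [D_apply, D_apply, rmul_U, dirac_U, rmul_U, map_add, ← spinMap_kS]

theorem slash_smul_sum (ξ : Cov n) (f : SmoothSpinor n N) :
    spinMap (slash X.γ ξ) f = ∑ j, ((ξ j : ℝ) : ℂ) • spinMap (X.γ j) f := by
  apply Subtype.ext
  funext l
  change slash X.γ ξ (f.1 l) = _
  rw [AddSubmonoidClass.coe_finsetSum, Finset.sum_apply, slash, sum_apply]
  rfl

theorem isExp_D : ∃ F, X.IsExp X.D 1 F := by
  let A : Fin n → Module.End ℂ (SmoothSpinor n N) := fun j => spinMap (X.γ j) * (X.kS * X.kS)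
  have hA : ∀ j, A j ∈ X.grade 0 := fun j =>
    mul_mem_grade (X.spinMap_mem_grade _) (mul_mem_grade X.kS_mem_grade X.kS_mem_grade)
  let F : ℕ → Cov n → Module.End ℂ (SmoothSpinor n N) := fun j =>
    match j with
    | 0 => ∑ j, fun ξ : Cov n => ((ξ j : ℝ) : ℂ) • A j
    | 1 => fun _ => X.D
    | _ + 2 => 0
  have e : ∀ m f, conjU X.θ m X.D f = F 0 (toCov m) f + X.D f := by
    intro m f
    rw [conjU_apply, D_U, U_neg_U X.skew, slash_smul_sum, add_comm]
    change _ = (∑ j, fun ξ : Cov n => ((ξ j : ℝ) : ℂ) • A j) (toCov m) f + _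
    rw [Finset.sum_apply, LinearMap.sum_apply]
    rfl
  have hF0 : F 0 ∈ X.homSpan 1 0 :=
    Submodule.sum_mem _ fun j _ => smul_mem_homSpan (isHomogFun_coord j) (hA j)
  have hF1 : F 1 ∈ X.homSpan 0 1 := const_mem_homSpan X.D_mem_grade
  refine ⟨F, fun j => ?_, fun J => ?_⟩
  · match j with
    | 0 => simpa using hF0
    | 1 => simpa using hF1
    | j + 2 => exact zero_mem _
  · match J with
    | 0 =>
      refine (((ordBd_of_homSpan hF0).add ((tempered_of_grade X.D_mem_grade).ordBd.mono
        zero_le_one)).mono (by simp)).congr fun m f _ => ?_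
      rw [e, Finset.range_zero, Finset.sum_empty, sub_zero]
    | 1 =>
      refine ((tempered_of_grade X.D_mem_grade).ordBd.mono (by simp)).congr fun m f _ => ?_
      rw [e, Finset.sum_range_one, add_sub_cancel_left]
    | J + 2 =>
      refine (ordBd_zero _).congr fun m f _ => ?_
      rw [e, Finset.sum_range_succ', Finset.sum_range_succ', Finset.sum_eq_zero]
      · change F 0 (toCov m) f + X.D f - (0 + X.D f + F 0 (toCov m) f) = 0
        abel
      · intro j _
        rfl

end ConfData

namespace ConfData
variable {n N : ℕ} (X : ConfData n N)

/-! ### The resolvent of the leading symbol -/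

/-- The operator `1 + σ² K⁴`. -/
def quartic (σ : ℝ) : L2 n (Spin N) →L[ℂ] L2 n (Spin N) :=
  1 + ((σ ^ 2 : ℝ) : ℂ) • ((X.K * X.K) * (X.K * X.K))

theorem quartic_apply (σ : ℝ) (x : L2 n (Spin N)) :
    X.quartic σ x = x + ((σ ^ 2 : ℝ) : ℂ) • X.K (X.K (X.K (X.K x))) := rfl

theorem quartic_symm (σ : ℝ) (x y : L2 n (Spin N)) :
    inner ℂ (X.quartic σ x) y = inner ℂ x (X.quartic σ y) := by
  rw [quartic_apply, quartic_apply, inner_add_left, inner_add_right, inner_smul_left,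
    inner_smul_right, Complex.conj_ofReal]
  simp only [K_symm]

theorem quartic_bounded_below : ∃ c : ℝ, 0 < c ∧
    ∀ (σ : ℝ) (x : L2 n (Spin N)), c * (1 + σ ^ 2) * ‖x‖ ≤ ‖X.quartic σ x‖ := by
  obtain ⟨ε, hε, h⟩ := X.K_bounded_below
  refine ⟨min 1 (ε ^ 4), lt_min one_pos (by positivity), fun σ x => ?_⟩
  rcases eq_or_ne x 0 with rfl | hx
  · simp
  have hx0 : 0 < ‖x‖ := norm_pos_iff.2 hx
  have h1 : ε ^ 2 * ‖x‖ ≤ ‖X.K (X.K x)‖ := by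
    calc ε ^ 2 * ‖x‖ = ε * (ε * ‖x‖) := by ring
      _ ≤ ε * ‖X.K x‖ := by gcongr; exact h x
      _ ≤ _ := h _
  have h2 : (inner ℂ (X.quartic σ x) x : ℂ) =
      ((‖x‖ ^ 2 + σ ^ 2 * ‖X.K (X.K x)‖ ^ 2 : ℝ) : ℂ) := by
    rw [quartic_apply, inner_add_left, inner_smul_left, Complex.conj_ofReal, K_symm, K_symm,
      inner_self_eq_norm_sq_to_K, inner_self_eq_norm_sq_to_K]
    push_cast
    rfl
  have h3 : ‖x‖ ^ 2 + σ ^ 2 * ‖X.K (X.K x)‖ ^ 2 ≤ ‖X.quartic σ x‖ * ‖x‖ := by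
    refine le_trans ?_ (norm_inner_le_norm (𝕜 := ℂ) (X.quartic σ x) x)
    rw [h2, Complex.norm_real]
    exact le_abs_self _
  have h4 : (ε ^ 2 * ‖x‖) ^ 2 ≤ ‖X.K (X.K x)‖ ^ 2 := by gcongr
  refine le_of_mul_le_mul_right (le_trans ?_ h3) hx0
  have h5 : min 1 (ε ^ 4) ≤ 1 := min_le_left _ _
  have h6 : min 1 (ε ^ 4) ≤ ε ^ 4 := min_le_right _ _
  calc min 1 (ε ^ 4) * (1 + σ ^ 2) * ‖x‖ * ‖x‖
      = min 1 (ε ^ 4) * ‖x‖ ^ 2 + σ ^ 2 * (min 1 (ε ^ 4) * ‖x‖ ^ 2) := by ring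
    _ ≤ 1 * ‖x‖ ^ 2 + σ ^ 2 * (ε ^ 4 * ‖x‖ ^ 2) := by gcongr
    _ = ‖x‖ ^ 2 + σ ^ 2 * (ε ^ 2 * ‖x‖) ^ 2 := by ring
    _ ≤ _ := by gcongr

theorem isUnit_quartic (σ : ℝ) : IsUnit (X.quartic σ) := by
  obtain ⟨c, hc, h⟩ := X.quartic_bounded_below
  exact isUnit_of_bounded_below (c := c * (1 + σ ^ 2)) (by positivity) (h σ) (X.quartic_symm σ)

/-- The resolvent `(1 + σ² K⁴)⁻¹`. -/
def G (σ : ℝ) : L2 n (Spin N) →L[ℂ] L2 n (Spin N) := Ring.inverse (X.quartic σ)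

theorem quartic_G (σ : ℝ) (x : L2 n (Spin N)) : X.quartic σ (X.G σ x) = x :=
  congrArg (fun A => A x) (Ring.mul_inverse_cancel _ (X.isUnit_quartic σ))

theorem G_quartic (σ : ℝ) (x : L2 n (Spin N)) : X.G σ (X.quartic σ x) = x :=
  congrArg (fun A => A x) (Ring.inverse_mul_cancel _ (X.isUnit_quartic σ))

theorem W_G_le (s : ℕ) : ∃ C, 0 ≤ C ∧ ∀ (σ : ℝ) M x,
    (1 + σ ^ 2) * ‖W M s (X.G σ x)‖ ≤ C * ‖W M s x‖ := by
  obtain ⟨c, hc, h⟩ := X.quartic_bounded_below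
  have hK2 : CommLower (X.K * X.K) := X.K_commLower.comp X.K_commLower X.K_gains
  have hK4 : CommLower ((X.K * X.K) * (X.K * X.K)) :=
    hK2.comp hK2 (by simpa using X.K_gains.comp X.K_gains)
  choose D hD hcomm using hK4
  obtain ⟨C, hC, h1⟩ := weighted_estimate_of_bounded_below (n := n) (V := Spin N) hc D hD s
  refine ⟨C, hC, fun σ M x => ?_⟩
  have h2 := h1 (1 + σ ^ 2) (X.quartic σ) (by positivity) (h σ) (fun s M x => ?_) M (X.G σ x)
  · rwa [quartic_G] at h2
  · have e : W M (s + 1) (X.quartic σ x) - X.quartic σ (W M (s + 1) x) =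
        ((σ ^ 2 : ℝ) : ℂ) • (W M (s + 1) (((X.K * X.K) * (X.K * X.K)) x) -
          ((X.K * X.K) * (X.K * X.K)) (W M (s + 1) x)) := by
      rw [quartic_apply, quartic_apply, map_add, map_smul, smul_sub]
      change _ = ((σ ^ 2 : ℝ) : ℂ) • W M (s + 1) (X.K (X.K (X.K (X.K x)))) -
        ((σ ^ 2 : ℝ) : ℂ) • X.K (X.K (X.K (X.K (W M (s + 1) x))))
      abel
    rw [e, norm_smul, Complex.norm_real, Real.norm_of_nonneg (sq_nonneg σ), mul_assoc (1 + σ ^ 2)]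
    exact mul_le_mul (by linarith) (hcomm s M x) (norm_nonneg _) (by positivity)

theorem G_gains (σ : ℝ) : Gains 0 (X.G σ) := by
  intro s
  obtain ⟨C, hC, h⟩ := X.W_G_le s
  refine ⟨C, hC, fun M x => le_trans ?_ (h σ M x)⟩
  exact le_mul_of_one_le_left (norm_nonneg _) (by nlinarith [sq_nonneg σ])

/-- The resolvent on smooth spinors. -/
def GS (σ : ℝ) : Module.End ℂ (SmoothSpinor n N) := restr (X.G σ) (X.G_gains σ).preserves

theorem toL2_GS (σ : ℝ) (f : SmoothSpinor n N) : toL2 (X.GS σ f) = X.G σ (toL2 f) :=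
  toL2_restr _ _ _

theorem GS_add (σ : ℝ) (f : SmoothSpinor n N) :
    X.GS σ f + ((σ ^ 2 : ℝ) : ℂ) • X.kS (X.kS (X.kS (X.kS (X.GS σ f)))) = f := by
  apply toL2_injective
  rw [map_add, map_smul, ← K_toL2, ← K_toL2, ← K_toL2, ← K_toL2, toL2_GS, ← quartic_apply,
    quartic_G]

theorem GS_resolvent (σ τ : ℝ) (f : SmoothSpinor n N) : X.GS σ f - X.GS τ f =
    ((τ ^ 2 - σ ^ 2 : ℝ) : ℂ) • X.GS σ (X.kS (X.kS (X.kS (X.kS (X.GS τ f))))) := by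
  apply toL2_injective
  have h1 : toL2 f = X.quartic σ (toL2 (X.GS τ f)) +
      ((τ ^ 2 - σ ^ 2 : ℝ) : ℂ) • toL2 (X.kS (X.kS (X.kS (X.kS (X.GS τ f))))) := by
    conv_lhs => rw [← X.GS_add τ f]
    rw [quartic_apply, map_add, map_smul, K_toL2, K_toL2, K_toL2, K_toL2, add_assoc, ← add_smul]
    congr 2
    push_cast
    ring
  rw [map_sub, toL2_GS X σ f, h1, map_add, G_quartic, map_smul, map_smul, toL2_GS X σ,
    add_sub_cancel_left]

theorem sn_GS_le (s : ℕ) : ∃ s' C, 0 ≤ C ∧ ∀ (σ : ℝ) f,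
    sn s (X.GS σ f) ≤ C * (1 + σ ^ 2)⁻¹ * sn s' f := by
  obtain ⟨C, hC, h⟩ := X.W_G_le (s + 2 * n)
  have hw := weightSum_nonneg n
  refine ⟨s + 2 * n, weightSum n * C, by positivity, fun σ f => ?_⟩
  have h0 : 0 < 1 + σ ^ 2 := by positivity
  have h1 : sn s (X.GS σ f) ≤ weightSum n * (C * (1 + σ ^ 2)⁻¹ * sn (s + 2 * n) f) := by
    refine sn_le_of_W_bound fun M => ?_
    rw [toL2_GS]
    have h2 := (h σ M (toL2 f)).trans
      (mul_le_mul_of_nonneg_left (norm_W_toL2_le M (s + 2 * n) f) hC)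
    rw [mul_comm, ← le_div_iff₀ h0] at h2
    refine h2.trans (le_of_eq ?_)
    field_simp
  exact h1.trans (le_of_eq (by ring))

theorem commute_G_confProj (σ : ℝ) : Commute (X.G σ) X.confProj := by
  have h : Commute X.confProj (X.quartic σ) := by
    refine (Commute.one_right _).add_right (Commute.smul_right ?_ _)
    have h1 := X.commute_K_confProj.symm
    exact (h1.mul_right h1).mul_right (h1.mul_right h1)
  exact (commute_inverse (X.isUnit_quartic σ) h).symm

theorem GS_mem_grade (σ : ℝ) : X.GS σ ∈ X.grade 0 :=
  mem_grade_zero_of_commute (X.G_gains σ).tempered (X.toL2_GS σ) (X.commute_G_confProj σ)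

/-! ### Families depending on a real parameter -/

/-- Families of filtered operators, uniformly `O((1 + σ²)^(-κ))` and uniformly Lipschitz in
`σ²`. -/
def fam (κ j : ℕ) : Submodule ℂ (ℝ → Module.End ℂ (SmoothSpinor n N)) where
  carrier := {a | (∀ σ, a σ ∈ X.grade j) ∧
    (∀ s, ∃ s' C, 0 ≤ C ∧ ∀ (σ : ℝ) f, sn s (a σ f) ≤ C * ((1 + σ ^ 2)⁻¹) ^ κ * sn s' f) ∧
    (∀ s, ∃ s' C, 0 ≤ C ∧ ∀ (σ τ : ℝ) f, sn s (a σ f - a τ f) ≤ C * |σ ^ 2 - τ ^ 2| * sn s' f)}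
  zero_mem' := by
    refine ⟨fun σ => zero_mem _, fun s => ⟨0, 0, le_rfl, fun σ f => ?_⟩,
      fun s => ⟨0, 0, le_rfl, fun σ τ f => ?_⟩⟩
    · simp
    · simp
  add_mem' := by
    rintro a b ⟨ha1, ha2, ha3⟩ ⟨hb1, hb2, hb3⟩
    refine ⟨fun σ => add_mem (ha1 σ) (hb1 σ), fun s => ?_, fun s => ?_⟩
    · obtain ⟨s1, C1, h1, hA⟩ := ha2 s
      obtain ⟨s2, C2, h2, hB⟩ := hb2 s
      refine ⟨max s1 s2, C1 + C2, by positivity, fun σ f => (sn_add_le s _ _).trans ?_⟩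
      rw [add_mul, add_mul]
      refine add_le_add ((hA σ f).trans ?_) ((hB σ f).trans ?_)
      · gcongr; exact sn_mono (le_max_left _ _) f
      · gcongr; exact sn_mono (le_max_right _ _) f
    · obtain ⟨s1, C1, h1, hA⟩ := ha3 s
      obtain ⟨s2, C2, h2, hB⟩ := hb3 s
      refine ⟨max s1 s2, C1 + C2, by positivity, fun σ τ f => ?_⟩
      have e : (a + b) σ f - (a + b) τ f = (a σ f - a τ f) + (b σ f - b τ f) := by
        change a σ f + b σ f - (a τ f + b τ f) = _
        abel
      rw [e, add_mul, add_mul]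
      refine (sn_add_le s _ _).trans (add_le_add ((hA σ τ f).trans ?_) ((hB σ τ f).trans ?_))
      · gcongr; exact sn_mono (le_max_left _ _) f
      · gcongr; exact sn_mono (le_max_right _ _) f
  smul_mem' := by
    rintro c a ⟨ha1, ha2, ha3⟩
    refine ⟨fun σ => Submodule.smul_mem _ _ (ha1 σ), fun s => ?_, fun s => ?_⟩
    · obtain ⟨s1, C1, h1, hA⟩ := ha2 s
      refine ⟨s1, ‖c‖ * C1, by positivity, fun σ f => ?_⟩
      have h2 := mul_le_mul_of_nonneg_left (hA σ f) (norm_nonneg c)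
      rw [← sn_smul] at h2
      exact h2.trans (le_of_eq (by ring))
    · obtain ⟨s1, C1, h1, hA⟩ := ha3 s
      refine ⟨s1, ‖c‖ * C1, by positivity, fun σ τ f => ?_⟩
      have h2 := mul_le_mul_of_nonneg_left (hA σ τ f) (norm_nonneg c)
      rw [← sn_smul, smul_sub] at h2
      exact h2.trans (le_of_eq (by ring))

variable {X}

theorem inv_one_add_sq_le_one (σ : ℝ) : (1 + σ ^ 2)⁻¹ ≤ 1 :=
  inv_le_one_of_one_le₀ (by nlinarith [sq_nonneg σ])

theorem inv_one_add_sq_nonneg (σ : ℝ) : 0 ≤ (1 + σ ^ 2)⁻¹ := by positivity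

theorem fam_bound {κ j : ℕ} {a : ℝ → Module.End ℂ (SmoothSpinor n N)} (ha : a ∈ X.fam κ j)
    (s : ℕ) : ∃ s' C, 0 ≤ C ∧ ∀ (σ : ℝ) f, sn s (a σ f) ≤ C * sn s' f := by
  obtain ⟨s1, C1, h1, hA⟩ := ha.2.1 s
  refine ⟨s1, C1, h1, fun σ f => (hA σ f).trans ?_⟩
  refine mul_le_mul_of_nonneg_right ?_ (sn_nonneg _ _)
  exact mul_le_of_le_one_right h1 (pow_le_one₀ (inv_one_add_sq_nonneg σ) (inv_one_add_sq_le_one σ))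

theorem fam_le_zero {κ j : ℕ} : X.fam κ j ≤ X.fam 0 j := by
  intro a ha
  refine ⟨ha.1, fun s => ?_, ha.2.2⟩
  simpa using fam_bound ha s

theorem const_mem_fam {j : ℕ} {A : Module.End ℂ (SmoothSpinor n N)} (hA : A ∈ X.grade j) :
    (fun _ => A) ∈ X.fam 0 j := by
  refine ⟨fun _ => hA, fun s => ?_, fun s => ⟨0, 0, le_rfl, fun σ τ f => ?_⟩⟩
  · obtain ⟨s', C, hC, h⟩ := tempered_of_grade hA s
    exact ⟨s', C, hC, fun σ f => by simpa using h f⟩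
  · simp

theorem mul_mem_fam {κ κ' i j : ℕ} {a b : ℝ → Module.End ℂ (SmoothSpinor n N)}
    (ha : a ∈ X.fam κ i) (hb : b ∈ X.fam κ' j) : a * b ∈ X.fam (κ + κ') (i + j) := by
  refine ⟨fun σ => mul_mem_grade (ha.1 σ) (hb.1 σ), fun s => ?_, fun s => ?_⟩
  · obtain ⟨s1, C1, h1, hA⟩ := ha.2.1 s
    obtain ⟨s2, C2, h2, hB⟩ := hb.2.1 s1
    refine ⟨s2, C1 * C2, by positivity, fun σ f => (hA σ (b σ f)).trans ?_⟩
    calc C1 * (1 + σ ^ 2)⁻¹ ^ κ * sn s1 (b σ f)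
        ≤ C1 * (1 + σ ^ 2)⁻¹ ^ κ * (C2 * (1 + σ ^ 2)⁻¹ ^ κ' * sn s2 f) := by
          gcongr
          exact hB σ f
      _ = _ := by ring
  · obtain ⟨s1, C1, h1, hA⟩ := fam_bound ha s
    obtain ⟨s2, C2, h2, hB⟩ := hb.2.2 s1
    obtain ⟨s3, C3, h3, hA'⟩ := ha.2.2 s
    obtain ⟨s4, C4, h4, hB'⟩ := fam_bound hb s3
    refine ⟨max s2 s4, C1 * C2 + C3 * C4, by positivity, fun σ τ f => ?_⟩
    have e : (a * b) σ f - (a * b) τ f = a σ (b σ f - b τ f) + (a σ (b τ f) - a τ (b τ f)) := by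
      change a σ (b σ f) - a τ (b τ f) = _
      rw [map_sub]
      abel
    rw [e]
    refine (sn_add_le s _ _).trans ?_
    have e1 : sn s (a σ (b σ f - b τ f)) ≤ C1 * (C2 * |σ ^ 2 - τ ^ 2| * sn (max s2 s4) f) := by
      refine (hA σ _).trans ?_
      gcongr
      refine (hB σ τ f).trans ?_
      gcongr
      exact sn_mono (le_max_left _ _) f
    have e2 : sn s (a σ (b τ f) - a τ (b τ f)) ≤
        C3 * |σ ^ 2 - τ ^ 2| * (C4 * sn (max s2 s4) f) := by
      refine (hA' σ τ _).trans ?_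
      gcongr
      refine (hB' τ f).trans ?_
      gcongr
      exact sn_mono (le_max_right _ _) f
    exact (add_le_add e1 e2).trans (le_of_eq (by ring))

variable (X)

theorem GS_mem_fam : X.GS ∈ X.fam 1 0 := by
  refine ⟨X.GS_mem_grade, fun s => ?_, fun s => ?_⟩
  · simpa using X.sn_GS_le s
  · have hK := X.tempered_kS
    obtain ⟨s1, C1, h1, hA⟩ := X.sn_GS_le s
    obtain ⟨s2, C2, h2, hB⟩ := ((hK.mul hK).mul (hK.mul hK)) s1
    obtain ⟨s3, C3, h3, hC⟩ := X.sn_GS_le s2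
    have drop : ∀ (C σ x : ℝ), 0 ≤ C → 0 ≤ x → C * (1 + σ ^ 2)⁻¹ * x ≤ C * x :=
      fun C σ x h hx => mul_le_mul_of_nonneg_right
        (mul_le_of_le_one_right h (inv_one_add_sq_le_one σ)) hx
    refine ⟨s3, C1 * (C2 * C3), by positivity, fun σ τ f => ?_⟩
    rw [GS_resolvent, sn_smul, Complex.norm_real, Real.norm_eq_abs, abs_sub_comm]
    have h : sn s (X.GS σ (X.kS (X.kS (X.kS (X.kS (X.GS τ f)))))) ≤ C1 * (C2 * (C3 * sn s3 f)) := by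
      refine (hA σ _).trans ((drop _ _ _ h1 (sn_nonneg _ _)).trans ?_)
      gcongr
      refine (hB (X.GS τ f)).trans ?_
      gcongr
      exact (hC τ f).trans (drop _ _ _ h3 (sn_nonneg _ _))
    calc |σ ^ 2 - τ ^ 2| * sn s (X.GS σ (X.kS (X.kS (X.kS (X.kS (X.GS τ f))))))
        ≤ |σ ^ 2 - τ ^ 2| * (C1 * (C2 * (C3 * sn s3 f))) := by gcongr
      _ = _ := by ring

/-- The family `-σ² (1 + σ² K⁴)⁻¹`. -/
def GSq : ℝ → Module.End ℂ (SmoothSpinor n N) :=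
  (fun _ => X.kinvS * X.kinvS * (X.kinvS * X.kinvS)) * (X.GS + fun _ => (-1 : ℂ) • 1)

theorem GSq_mem_fam : X.GSq ∈ X.fam 0 0 := by
  have h1 := mul_mem_grade X.kinvS_mem_grade X.kinvS_mem_grade
  have h2 := mul_mem_grade h1 h1
  exact mul_mem_fam (const_mem_fam h2) (add_mem (fam_le_zero X.GS_mem_fam)
    (const_mem_fam (Submodule.smul_mem _ _ X.one_mem_grade)))

theorem GSq_apply (σ : ℝ) (f : SmoothSpinor n N) :
    X.GSq σ f = -(((σ ^ 2 : ℝ) : ℂ) • X.GS σ f) := by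
  change X.kinvS (X.kinvS (X.kinvS (X.kinvS (X.GS σ f + (-1 : ℂ) • f)))) = _
  have h : X.GS σ f + (-1 : ℂ) • f =
      -(((σ ^ 2 : ℝ) : ℂ) • X.kS (X.kS (X.kS (X.kS (X.GS σ f))))) := by
    have h1 := X.GS_add σ f
    conv_lhs =>
      rhs
      rw [← h1]
    have h2 : ∀ x y : SmoothSpinor n N, x + (-1 : ℂ) • (x + y) = -y := fun x y => by module
    exact h2 _ _
  rw [h]
  simp only [map_neg, map_smul, kinvS_kS]

theorem GSq_spec (σ : ℝ) (f : SmoothSpinor n N) :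
    X.GSq σ f + ((σ ^ 2 : ℝ) : ℂ) • X.kS (X.kS (X.kS (X.kS (X.GSq σ f)))) =
      -(((σ ^ 2 : ℝ) : ℂ) • f) := by
  conv_rhs => rw [← X.GS_add σ f]
  rw [GSq_apply]
  simp only [map_neg, map_smul, smul_add, smul_neg, neg_add]

/-- The span of the functions `(ξ, σ) ↦ g(ξ) a(σ)` with `g` homogeneous of degree `r`. -/
def famSpan (κ : ℕ) (r : ℤ) (j : ℕ) :
    Submodule ℂ (Cov n → ℝ → Module.End ℂ (SmoothSpinor n N)) :=
  Submodule.span ℂ {p | ∃ g, IsHomogFun r g ∧ ∃ a ∈ X.fam κ j, p = fun ξ => g ξ • a}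

variable {X}

theorem smul_mem_famSpan {κ : ℕ} {r : ℤ} {j : ℕ} {g : Cov n → ℂ} (hg : IsHomogFun r g)
    {a : ℝ → Module.End ℂ (SmoothSpinor n N)} (ha : a ∈ X.fam κ j) :
    (fun ξ => g ξ • a) ∈ X.famSpan κ r j := Submodule.subset_span ⟨g, hg, a, ha, rfl⟩

theorem const_mem_famSpan {κ : ℕ} {j : ℕ}
    {a : ℝ → Module.End ℂ (SmoothSpinor n N)} (ha : a ∈ X.fam κ j) :
    (fun _ => a) ∈ X.famSpan κ 0 j := by
  have h1 := smul_mem_famSpan (X := X) isHomogFun_one ha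
  convert h1 using 1
  funext ξ
  exact (one_smul ℂ a).symm

theorem mul_mem_famSpan {κ κ' : ℕ} {r r' : ℤ} {j j' : ℕ}
    {p q : Cov n → ℝ → Module.End ℂ (SmoothSpinor n N)}
    (hp : p ∈ X.famSpan κ r j) (hq : q ∈ X.famSpan κ' r' j') :
    p * q ∈ X.famSpan (κ + κ') (r + r') (j + j') := by
  have h := Submodule.mul_mem_mul hp hq
  rw [famSpan, famSpan, Submodule.span_mul_span] at h
  refine Submodule.span_mono ?_ h
  rintro _ ⟨_, ⟨g, hg, A, hA, rfl⟩, _, ⟨g', hg', A', hA', rfl⟩, rfl⟩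
  refine ⟨g * g', hg.mul hg', A * A', mul_mem_fam hA hA', funext fun ξ => ?_⟩
  exact smul_mul_smul_comm (g ξ) A (g' ξ) A'

theorem famSpan_bound {κ : ℕ} {r : ℤ} {j : ℕ} {p : Cov n → ℝ → Module.End ℂ (SmoothSpinor n N)}
    (hp : p ∈ X.famSpan κ r j) (s : ℕ) : ∃ s' C, 0 ≤ C ∧ ∀ (m : Idx n) (σ : ℝ) f, m ≠ 0 →
      sn s (p (toCov m) σ f) ≤ C * ‖m‖ ^ r * ((1 + σ ^ 2)⁻¹) ^ κ * sn s' f := by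
  induction hp using Submodule.span_induction with
  | mem p h =>
    obtain ⟨g, hg, a, ha, rfl⟩ := h
    obtain ⟨s', C, hC, h1⟩ := ha.2.1 s
    obtain ⟨C1, hC1, h2⟩ := hg.bound
    obtain ⟨C2, hC2, h3⟩ := exists_norm_toCov_zpow_le n r
    refine ⟨s', C1 * C2 * C, by positivity, fun m σ f hm => ?_⟩
    change sn s (g (toCov m) • a σ f) ≤ _
    rw [sn_smul]
    calc ‖g (toCov m)‖ * sn s (a σ f)
        ≤ (C1 * (C2 * ‖m‖ ^ r)) * (C * ((1 + σ ^ 2)⁻¹) ^ κ * sn s' f) := by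
          refine mul_le_mul ((h2 _ (toCov_ne_zero hm)).trans ?_) (h1 σ f) (sn_nonneg _ _)
            (by positivity)
          gcongr
          exact h3 m hm
      _ = _ := by ring
  | zero => exact ⟨0, 0, le_rfl, fun m σ f _ => by simp⟩
  | add p q _ _ h1 h2 =>
    obtain ⟨s1, C1, h1, hA⟩ := h1
    obtain ⟨s2, C2, h2, hB⟩ := h2
    refine ⟨max s1 s2, C1 + C2, by positivity, fun m σ f hm => (sn_add_le s _ _).trans ?_⟩
    rw [add_mul, add_mul, add_mul]
    have h0 := inv_one_add_sq_nonneg σ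
    refine add_le_add ((hA m σ f hm).trans ?_) ((hB m σ f hm).trans ?_)
    · gcongr; exact sn_mono (le_max_left _ _) f
    · gcongr; exact sn_mono (le_max_right _ _) f
  | smul c p _ h =>
    obtain ⟨s', C, hC, h1⟩ := h
    refine ⟨s', ‖c‖ * C, by positivity, fun m σ f hm => ?_⟩
    have h2 := mul_le_mul_of_nonneg_left (h1 m σ f hm) (norm_nonneg c)
    rw [← sn_smul] at h2
    exact h2.trans (le_of_eq (by ring))

/-! ### Integration over the parameter -/

theorem integral_weight_le {z : ℝ → SmoothSpinor n N} {s : ℕ} {B : ℝ → ℝ}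
    (hB : MeasureTheory.Integrable B)
    (hz : MeasureTheory.Integrable fun σ => toL2 (z σ)) (h : ∀ᵐ σ, sn s (z σ) ≤ B σ) (l : Idx n) :
    (1 + ‖l‖) ^ s * ‖(∫ σ, toL2 (z σ)) l‖ ≤ ∫ σ, B σ := by
  let e : L2 n (Spin N) →L[ℂ] Spin N := lp.evalCLM ℂ (fun _ : Idx n => Spin N) 2 l
  have h1 : (∫ σ, toL2 (z σ)) l = ∫ σ, (z σ).1 l := (e.integral_comp_comm hz).symm
  have h0 : (0 : ℝ) < (1 + ‖l‖) ^ s := by positivity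
  rw [h1, ← le_div_iff₀' h0, ← MeasureTheory.integral_div]
  refine MeasureTheory.norm_integral_le_of_norm_le (hB.div_const _) ?_
  filter_upwards [h] with σ hσ
  rw [le_div_iff₀' h0]
  exact (le_sn s (z σ) l).trans hσ

theorem fam_continuous {κ j : ℕ} {a : ℝ → Module.End ℂ (SmoothSpinor n N)} (ha : a ∈ X.fam κ j)
    (f : SmoothSpinor n N) : Continuous fun σ => toL2 (a σ f) := by
  obtain ⟨s', C, hC, h⟩ := ha.2.2 0
  rw [continuous_iff_continuousAt]
  intro τ
  rw [ContinuousAt, tendsto_iff_norm_sub_tendsto_zero]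
  have h1 : Filter.Tendsto (fun σ : ℝ => C * |σ ^ 2 - τ ^ 2| * sn s' f) (nhds τ) (nhds 0) := by
    have : Continuous fun σ : ℝ => C * |σ ^ 2 - τ ^ 2| * sn s' f := by fun_prop
    simpa using this.tendsto τ
  refine squeeze_zero (fun _ => norm_nonneg _) (fun σ => ?_) h1
  rw [← map_sub]
  exact (norm_toL2_le _).trans (h σ τ f)

theorem fam_integrable {j : ℕ} {a : ℝ → Module.End ℂ (SmoothSpinor n N)} (ha : a ∈ X.fam 1 j)
    (f : SmoothSpinor n N) : MeasureTheory.Integrable fun σ => toL2 (a σ f) := by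
  obtain ⟨s', C, hC, h⟩ := ha.2.1 0
  refine MeasureTheory.Integrable.mono' (integrable_inv_one_add_sq.const_mul (C * sn s' f))
    (fam_continuous ha f).aestronglyMeasurable (Filter.Eventually.of_forall fun σ => ?_)
  refine (norm_toL2_le _).trans ((h σ f).trans (le_of_eq ?_))
  ring

theorem exists_integral_fam {j : ℕ} {a : ℝ → Module.End ℂ (SmoothSpinor n N)}
    (ha : a ∈ X.fam 1 j) : ∃ A ∈ X.grade j, ∀ f, toL2 (A f) = ∫ σ, toL2 (a σ f) := by
  have hb : ∀ s, ∃ s' C, 0 ≤ C ∧ ∀ f : SmoothSpinor n N, ∀ l,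
      (1 + ‖l‖) ^ s * ‖(∫ σ, toL2 (a σ f)) l‖ ≤ C * sn s' f := by
    intro s
    obtain ⟨s', C, hC, h⟩ := ha.2.1 s
    refine ⟨s', C * Real.pi, by positivity, fun f l => ?_⟩
    refine (integral_weight_le (integrable_inv_one_add_sq.const_mul (C * sn s' f))
      (fam_integrable ha f) (Filter.Eventually.of_forall fun σ =>
        (h σ f).trans (le_of_eq (by ring))) l).trans (le_of_eq ?_)
    rw [MeasureTheory.integral_const_mul, integral_univ_inv_one_add_sq]
    ring
  let A : Module.End ℂ (SmoothSpinor n N) :=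
    { toFun := fun f => ⟨fun l => (∫ σ, toL2 (a σ f)) l, mem_schw_of_bound fun s => by
        obtain ⟨s', C, _, h⟩ := hb s
        exact ⟨_, h f⟩⟩
      map_add' := fun f g => toL2_injective (by
        change (∫ σ, toL2 (a σ (f + g))) = (∫ σ, toL2 (a σ f)) + ∫ σ, toL2 (a σ g)
        simp only [map_add]
        exact MeasureTheory.integral_add (fam_integrable ha f) (fam_integrable ha g))
      map_smul' := fun c f => toL2_injective (by
        change (∫ σ, toL2 (a σ (c • f))) = c • ∫ σ, toL2 (a σ f)
        simp only [map_smul]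
        exact MeasureTheory.integral_smul c _) }
  have hA : ∀ f, toL2 (A f) = ∫ σ, toL2 (a σ f) := fun f => rfl
  have hP : ∀ f, X.confProj (toL2 (A f)) = ∫ σ, X.confProj (toL2 (a σ f)) := fun f => by
    rw [hA]
    exact (X.confProj.integral_comp_comm (fam_integrable ha f)).symm
  refine ⟨A, ⟨fun s => ?_, fun hj => ⟨fun f hf => ?_, fun f hf => ?_⟩, fun hj f hf => ?_⟩, hA⟩
  · obtain ⟨s', C, hC, h⟩ := hb (s + 2 * n)
    have hw := weightSum_nonneg n
    refine ⟨s', weightSum n * C, by positivity, fun f => ?_⟩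
    rw [mul_assoc]
    exact sn_le_of_bound (h f)
  · rw [← confProj_eq_self_iff, hP, hA]
    exact MeasureTheory.integral_congr_ae (Filter.Eventually.of_forall fun σ =>
      X.confProj_eq_self_iff.2 (((ha.1 σ).2.1 hj).1 f hf))
  · rw [← confProj_eq_zero_iff, hP, ← MeasureTheory.integral_zero ℝ (L2 n (Spin N))]
    exact MeasureTheory.integral_congr_ae (Filter.Eventually.of_forall fun σ =>
      X.confProj_eq_zero_iff.2 (((ha.1 σ).2.1 hj).2 f hf))
  · rw [← confProj_eq_zero_iff, hP, ← MeasureTheory.integral_zero ℝ (L2 n (Spin N))]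
    exact MeasureTheory.integral_congr_ae (Filter.Eventually.of_forall fun σ =>
      X.confProj_eq_zero_iff.2 ((ha.1 σ).2.2 hj f hf))

theorem exists_integral_famSpan {r : ℤ} {j : ℕ}
    {p : Cov n → ℝ → Module.End ℂ (SmoothSpinor n N)} (hp : p ∈ X.famSpan 1 r j) :
    ∃ F ∈ X.homSpan r j, ∀ ξ f, MeasureTheory.Integrable (fun σ => toL2 (p ξ σ f)) ∧
      ∫ σ, toL2 (p ξ σ f) = toL2 (F ξ f) := by
  induction hp using Submodule.span_induction with
  | mem p h =>
    obtain ⟨g, hg, a, ha, rfl⟩ := h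
    obtain ⟨A, hA, h⟩ := exists_integral_fam ha
    refine ⟨_, smul_mem_homSpan hg hA, fun ξ f => ?_⟩
    have e : (fun σ => toL2 ((g ξ • a) σ f)) = fun σ => g ξ • toL2 (a σ f) := by
      funext σ
      exact map_smul toL2 (g ξ) (a σ f)
    rw [e]
    refine ⟨(fam_integrable ha f).smul (g ξ), ?_⟩
    rw [MeasureTheory.integral_smul, ← h]
    rfl
  | zero =>
    refine ⟨0, zero_mem _, fun ξ f => ?_⟩
    have e : (fun σ : ℝ => toL2 ((0 : Cov n → ℝ → Module.End ℂ (SmoothSpinor n N)) ξ σ f)) =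
        fun _ => 0 := by
      funext σ
      exact map_zero toL2
    rw [e]
    refine ⟨MeasureTheory.integrable_zero _ _ _, ?_⟩
    rw [MeasureTheory.integral_zero]
    exact (map_zero toL2).symm
  | add p q _ _ h1 h2 =>
    obtain ⟨F, hF, h1⟩ := h1
    obtain ⟨F', hF', h2⟩ := h2
    refine ⟨F + F', add_mem hF hF', fun ξ f => ?_⟩
    have e : (fun σ => toL2 ((p + q) ξ σ f)) = fun σ => toL2 (p ξ σ f) + toL2 (q ξ σ f) := by
      funext σ
      exact map_add toL2 (p ξ σ f) (q ξ σ f)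
    rw [e]
    refine ⟨(h1 ξ f).1.add (h2 ξ f).1, ?_⟩
    rw [MeasureTheory.integral_add (h1 ξ f).1 (h2 ξ f).1, (h1 ξ f).2, (h2 ξ f).2]
    exact (map_add toL2 (F ξ f) (F' ξ f)).symm
  | smul c p _ h =>
    obtain ⟨F, hF, h1⟩ := h
    refine ⟨c • F, Submodule.smul_mem _ _ hF, fun ξ f => ?_⟩
    have e : (fun σ => toL2 ((c • p) ξ σ f)) = fun σ => c • toL2 (p ξ σ f) := by
      funext σ
      exact map_smul toL2 c (p ξ σ f)
    rw [e]
    refine ⟨(h1 ξ f).1.smul c, ?_⟩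
    rw [MeasureTheory.integral_smul, (h1 ξ f).2]
    exact (map_smul toL2 c (F ξ f)).symm

end ConfData

namespace ConfData
variable {n N : ℕ} (X : ConfData n N)

/-! ### The parametrix -/

/-- The coefficient `1 ⊗ γ^j k²` of the leading part of the rescaled Dirac operator. -/
def leadD (j : Fin n) : Module.End ℂ (SmoothSpinor n N) := spinMap (X.γ j) * (X.kS * X.kS)

theorem leadD_mem_grade (j : Fin n) : X.leadD j ∈ X.grade 0 :=
  mul_mem_grade (X.spinMap_mem_grade _) (mul_mem_grade X.kS_mem_grade X.kS_mem_grade)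

/-- The terms of degree one of the square of the conjugated Dirac operator. -/
def sqOne : Cov n → ℝ → Module.End ℂ (SmoothSpinor n N) :=
  ∑ j, fun ξ => ((ξ j : ℝ) : ℂ) • fun _ => X.D * X.leadD j + X.leadD j * X.D

theorem sqOne_mem : X.sqOne ∈ X.famSpan 0 1 1 :=
  Submodule.sum_mem _ fun j _ => smul_mem_famSpan (isHomogFun_coord j)
    (const_mem_fam (add_mem (mul_mem_grade X.D_mem_grade (X.leadD_mem_grade j))
      (by simpa using mul_mem_grade (X.leadD_mem_grade j) X.D_mem_grade)))

theorem sqOne_apply (ξ : Cov n) (σ : ℝ) (f : SmoothSpinor n N) : X.sqOne ξ σ f =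
    X.D (spinMap (slash X.γ ξ) (X.kS (X.kS f))) + spinMap (slash X.γ ξ) (X.kS (X.kS (X.D f))) := by
  have h : X.sqOne ξ σ f =
      ∑ j, ((ξ j : ℝ) : ℂ) • (X.D (spinMap (X.γ j) (X.kS (X.kS f))) +
        spinMap (X.γ j) (X.kS (X.kS (X.D f)))) := by
    rw [sqOne, Finset.sum_apply, Finset.sum_apply, LinearMap.sum_apply]
    rfl
  rw [h, slash_smul_sum, slash_smul_sum, map_sum, ← Finset.sum_add_distrib]
  exact Finset.sum_congr rfl fun j _ => by rw [smul_add, map_smul]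

/-- The square of the Dirac operator, as a constant family. -/
def sqZero : Cov n → ℝ → Module.End ℂ (SmoothSpinor n N) := fun _ _ => X.D * X.D

theorem sqZero_mem : X.sqZero ∈ X.famSpan 0 0 2 :=
  const_mem_famSpan (const_mem_fam (mul_mem_grade X.D_mem_grade X.D_mem_grade))

/-- The family `-σ² |ξ|⁻² (1 + σ² K⁴)⁻¹`. -/
def stepFam : Cov n → ℝ → Module.End ℂ (SmoothSpinor n N) :=
  fun ξ => ((‖ξ‖ ^ (-2 : ℤ) : ℝ) : ℂ) • X.GSq

theorem stepFam_mem : X.stepFam ∈ X.famSpan 0 (-2) 0 :=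
  smul_mem_famSpan (isHomogFun_norm_zpow _) X.GSq_mem_fam

/-- The terms of the parametrix. -/
def para : ℕ → Cov n → ℝ → Module.End ℂ (SmoothSpinor n N)
  | 0 => fun _ => X.GS
  | 1 => X.stepFam * (X.sqOne * para 0)
  | r + 2 => X.stepFam * (X.sqOne * para (r + 1) + X.sqZero * para r)

theorem para_mem : ∀ r : ℕ, X.para r ∈ X.famSpan 1 (-(r : ℤ)) r
  | 0 => const_mem_famSpan X.GS_mem_fam
  | 1 => by
    have h := mul_mem_famSpan X.stepFam_mem (mul_mem_famSpan X.sqOne_mem (para_mem 0))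
    simpa [para] using h
  | r + 2 => by
    have h1 := mul_mem_famSpan X.sqOne_mem (para_mem (r + 1))
    have h2 := mul_mem_famSpan X.sqZero_mem (para_mem r)
    have e1 : (1 : ℤ) + -((r + 1 : ℕ) : ℤ) = 0 + -(r : ℤ) := by push_cast; ring
    have e2 : 1 + (r + 1) = 2 + r := by omega
    rw [e1, e2] at h1
    have h3 := mul_mem_famSpan X.stepFam_mem (add_mem h1 h2)
    have e3 : (-2 : ℤ) + (0 + -(r : ℤ)) = -((r + 2 : ℕ) : ℤ) := by push_cast; ring
    have e4 : 0 + (2 + r) = r + 2 := by omega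
    rw [e3, e4] at h3
    exact h3

/-- The error terms of the parametrix. -/
def errTerm : ℕ → Cov n → ℝ → Module.End ℂ (SmoothSpinor n N)
  | 0 => X.sqOne * X.para 0
  | r + 1 => X.sqOne * X.para (r + 1) + X.sqZero * X.para r

theorem errTerm_mem : ∀ r : ℕ, X.errTerm r ∈ X.famSpan 1 (1 - (r : ℤ)) (r + 1)
  | 0 => by
    have h := mul_mem_famSpan X.sqOne_mem (X.para_mem 0)
    simpa [errTerm] using h
  | r + 1 => by
    have h1 := mul_mem_famSpan X.sqOne_mem (X.para_mem (r + 1))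
    have h2 := mul_mem_famSpan X.sqZero_mem (X.para_mem r)
    have e1 : (1 : ℤ) + -((r + 1 : ℕ) : ℤ) = 1 - ((r + 1 : ℕ) : ℤ) := by push_cast; ring
    have e2 : 0 + 1 = 1 := rfl
    have e3 : (0 : ℤ) + -(r : ℤ) = 1 - ((r + 1 : ℕ) : ℤ) := by push_cast; ring
    have e4 : 1 + (r + 1) = r + 1 + 1 := by omega
    have e5 : 2 + r = r + 1 + 1 := by omega
    rw [e1, e2, e4] at h1
    rw [e3, e2, e5] at h2
    exact add_mem h1 h2

theorem para_succ (r : ℕ) (ξ : Cov n) (σ : ℝ) (f : SmoothSpinor n N) :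
    X.para (r + 1) ξ σ f = X.stepFam ξ σ (X.errTerm r ξ σ f) := by
  cases r <;> rfl

/-- The conjugated Dirac operator. -/
def shiftD (ξ : Cov n) : Module.End ℂ (SmoothSpinor n N) :=
  X.D + spinMap (slash X.γ ξ) * (X.kS * X.kS)

theorem D_D_U (m : Idx n) (f : SmoothSpinor n N) :
    X.D (X.D (U X.θ m f)) = U X.θ m (X.shiftD (toCov m) (X.shiftD (toCov m) f)) := by
  rw [D_U, D_U]
  rfl

theorem shiftD_shiftD (ξ : Cov n) (σ : ℝ) (f : SmoothSpinor n N) :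
    X.shiftD ξ (X.shiftD ξ f) = ((‖ξ‖ ^ 2 : ℝ) : ℂ) • X.kS (X.kS (X.kS (X.kS f))) +
      X.sqOne ξ σ f + X.sqZero ξ σ f := by
  have h : ∀ g : SmoothSpinor n N, spinMap (slash X.γ ξ) (spinMap (slash X.γ ξ) g) =
      ((‖ξ‖ ^ 2 : ℝ) : ℂ) • g := fun g =>
    Subtype.ext (funext fun l => X.slash_slash ξ (g.1 l))
  have h1 : X.shiftD ξ (X.shiftD ξ f) =
      X.D (X.D f + spinMap (slash X.γ ξ) (X.kS (X.kS f))) +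
      spinMap (slash X.γ ξ) (X.kS (X.kS (X.D f + spinMap (slash X.γ ξ) (X.kS (X.kS f))))) := rfl
  rw [h1, sqOne_apply]
  simp only [map_add]
  rw [← spinMap_kS, ← spinMap_kS, h]
  change _ = _ + _ + X.D (X.D f)
  abel

/-- One term of the parametrix, inserted in the equation. -/
theorem para_succ_spec (r : ℕ) {ξ : Cov n} (hξ : ξ ≠ 0) (s : ℝ) (f : SmoothSpinor n N) :
    X.para (r + 1) ξ (s * ‖ξ‖) f + ((s ^ 2 : ℝ) : ℂ) • (((‖ξ‖ ^ 2 : ℝ) : ℂ) •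
      X.kS (X.kS (X.kS (X.kS (X.para (r + 1) ξ (s * ‖ξ‖) f))))) =
      -(((s ^ 2 : ℝ) : ℂ) • X.errTerm r ξ (s * ‖ξ‖) f) := by
  rw [para_succ]
  set y := X.errTerm r ξ (s * ‖ξ‖) f
  have h0 : ‖ξ‖ ≠ 0 := norm_ne_zero_iff.2 hξ
  have h1 : X.stepFam ξ (s * ‖ξ‖) y = ((‖ξ‖ ^ (-2 : ℤ) : ℝ) : ℂ) • X.GSq (s * ‖ξ‖) y := rfl
  rw [h1]
  simp only [map_smul]
  have h2 := X.GSq_spec (s * ‖ξ‖) y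
  set z := X.GSq (s * ‖ξ‖) y
  have h3 := congrArg (fun w => ((‖ξ‖ ^ (-2 : ℤ) : ℝ) : ℂ) • w) h2
  have h4 : ((‖ξ‖ ^ (-2 : ℤ) : ℝ) : ℂ) * (((s * ‖ξ‖) ^ 2 : ℝ) : ℂ) = ((s ^ 2 : ℝ) : ℂ) := by
    rw [← Complex.ofReal_mul]
    congr 1
    rw [zpow_neg, mul_pow]
    field_simp
  have h5 : ((s ^ 2 : ℝ) : ℂ) * (((‖ξ‖ ^ 2 : ℝ) : ℂ) * ((‖ξ‖ ^ (-2 : ℤ) : ℝ) : ℂ)) =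
      ((s ^ 2 : ℝ) : ℂ) := by
    rw [← Complex.ofReal_mul, ← Complex.ofReal_mul]
    congr 1
    rw [zpow_neg]
    field_simp
  simp only [smul_add, smul_neg, smul_smul] at h3 ⊢
  rw [h4] at h3
  rw [h5]
  exact h3

theorem para_sum_spec (j : ℕ) {ξ : Cov n} (hξ : ξ ≠ 0) (s : ℝ) (f : SmoothSpinor n N) :
    ∑ r ∈ Finset.range (j + 1), X.para r ξ (s * ‖ξ‖) f + ((s ^ 2 : ℝ) : ℂ) •
      X.shiftD ξ (X.shiftD ξ (∑ r ∈ Finset.range (j + 1), X.para r ξ (s * ‖ξ‖) f)) =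
    f + ((s ^ 2 : ℝ) : ℂ) • (X.errTerm j ξ (s * ‖ξ‖) f +
      (X.sqZero * X.para j) ξ (s * ‖ξ‖) f) := by
  set σ := s * ‖ξ‖ with hσ
  set c := ((s ^ 2 : ℝ) : ℂ) with hc
  induction j with
  | zero =>
    rw [zero_add, Finset.sum_range_one, X.shiftD_shiftD ξ σ]
    have h := X.GS_add σ f
    have h5 : c * ((‖ξ‖ ^ 2 : ℝ) : ℂ) = ((σ ^ 2 : ℝ) : ℂ) := by
      rw [hc, hσ]
      push_cast
      ring
    change X.GS σ f + c • (((‖ξ‖ ^ 2 : ℝ) : ℂ) • X.kS (X.kS (X.kS (X.kS (X.GS σ f)))) +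
      X.sqOne ξ σ (X.GS σ f) + X.sqZero ξ σ (X.GS σ f)) =
      f + c • (X.sqOne ξ σ (X.GS σ f) + X.sqZero ξ σ (X.GS σ f))
    conv_rhs =>
      lhs
      rw [← h]
    rw [← h5]
    module
  | succ j ih =>
    rw [Finset.sum_range_succ, map_add, map_add]
    have h := X.para_succ_spec j hξ s f
    rw [← hσ, ← hc] at h
    rw [X.shiftD_shiftD ξ σ (X.para (j + 1) ξ σ f)]
    have e : X.errTerm (j + 1) ξ σ f =
      X.sqOne ξ σ (X.para (j + 1) ξ σ f) + X.sqZero ξ σ (X.para j ξ σ f) := rfl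
    rw [e]
    change _ = f + c • (X.sqOne ξ σ (X.para (j + 1) ξ σ f) + X.sqZero ξ σ (X.para j ξ σ f) +
      X.sqZero ξ σ (X.para (j + 1) ξ σ f))
    change _ = f + c • (X.errTerm j ξ σ f + X.sqZero ξ σ (X.para j ξ σ f)) at ih
    have alg : ∀ a b p k e1 e2 x y z : SmoothSpinor n N, a + c • b = f + c • (e1 + z) →
        p + c • k = -(c • e1) →
        a + p + c • (b + (k + x + y)) = f + c • (x + z + y) := by
      intro a b p k e1 e2 x y z h1 h2
      have h3 : a + p + c • (b + (k + x + y)) =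
          (a + c • b) + (p + c • k) + c • (x + y) := by module
      rw [h3, h1, h2]
      module
    exact alg _ _ _ _ _ 0 _ _ _ ih h

/-! ### Bounds for the error -/

theorem kerProjS_U_bound (a b : ℕ) : ∃ C, 0 ≤ C ∧ ∀ (m : Idx n) (f : SmoothSpinor n N),
    (1 + ‖m‖) ^ b * sn a (X.kerProjS (U X.θ m f)) ≤ C * sn b f := by
  obtain ⟨C1, hC1, h1⟩ := X.kerSpace_W_bound (a + 2 * n)
  obtain ⟨C2, hC2, h2⟩ := X.kerSpace_W_bound b
  have hw := weightSum_nonneg n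
  refine ⟨weightSum n * C1 * C2, by positivity, fun m f => ?_⟩
  set x := toL2 (U X.θ m f)
  set y := X.kerProj x with hy
  have hm : 0 < (1 + ‖m‖) ^ b := by positivity
  have h3 : sn a (X.kerProjS (U X.θ m f)) ≤ weightSum n * (C1 * ‖y‖) := by
    refine sn_le_of_W_bound fun M => ?_
    rw [toL2_kerProjS]
    exact h1 M _ (X.kerProj_mem _)
  have h4 : ∀ l, (1 + ‖l‖) ^ b * ‖y l‖ ≤ C2 * ‖y‖ :=
    pointwise_of_W_bound fun M => h2 M _ (X.kerProj_mem _)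
  have h5 : ‖y‖ ^ 2 = ‖(inner ℂ y x : ℂ)‖ := by
    have : (inner ℂ y x : ℂ) = inner ℂ y y := by
      conv_rhs =>
        rhs
        rw [hy]
      rw [← kerProj_symm, X.kerProj_of_mem (X.kerProj_mem x)]
    rw [this, inner_self_eq_norm_sq_to_K, norm_pow]
    congr 1
    exact (Complex.norm_real _).trans (norm_norm _) |>.symm
  have h6 : (1 + ‖m‖) ^ b * ‖(inner ℂ y x : ℂ)‖ ≤ C2 * ‖y‖ * sn b f := by
    have hs : HasSum (fun l => C2 * ‖y‖ * ((1 + ‖l - m‖) ^ b * ‖f.1 (l - m)‖))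
        (C2 * ‖y‖ * sn b f) :=
      (((Equiv.subRight m).hasSum_iff).2 (f.2 b).hasSum).mul_left _
    rw [← le_div_iff₀' hm, lp.inner_eq_tsum]
    refine tsum_of_norm_bounded (hs.div_const _) fun l => ?_
    rw [le_div_iff₀' hm]
    have h7 : ‖(inner ℂ (y l) (x l) : ℂ)‖ ≤ ‖y l‖ * ‖f.1 (l - m)‖ := by
      refine (norm_inner_le_norm _ _).trans (le_of_eq ?_)
      change ‖y l‖ * ‖cocycle X.θ m (l - m) • f.1 (l - m)‖ = _
      rw [norm_smul, norm_cocycle, one_mul]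
    have h8 : (1 + ‖m‖) ^ b ≤ (1 + ‖l‖) ^ b * (1 + ‖l - m‖) ^ b := by
      rw [← norm_sub_rev m l]
      exact weight_shift_le b l m
    calc (1 + ‖m‖) ^ b * ‖(inner ℂ (y l) (x l) : ℂ)‖
        ≤ ((1 + ‖l‖) ^ b * (1 + ‖l - m‖) ^ b) * (‖y l‖ * ‖f.1 (l - m)‖) := by gcongr
      _ = ((1 + ‖l‖) ^ b * ‖y l‖) * ((1 + ‖l - m‖) ^ b * ‖f.1 (l - m)‖) := by ring
      _ ≤ _ := mul_le_mul_of_nonneg_right (h4 l) (by positivity)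
  have h9 : (1 + ‖m‖) ^ b * ‖y‖ ≤ C2 * sn b f := by
    rcases eq_or_ne ‖y‖ 0 with h0 | h0
    · rw [h0, mul_zero]
      exact mul_nonneg hC2 (sn_nonneg _ _)
    · have h0' : 0 < ‖y‖ := lt_of_le_of_ne (norm_nonneg _) (Ne.symm h0)
      refine le_of_mul_le_mul_right ?_ h0'
      rw [← h5] at h6
      calc (1 + ‖m‖) ^ b * ‖y‖ * ‖y‖ = (1 + ‖m‖) ^ b * ‖y‖ ^ 2 := by ring
        _ ≤ _ := h6
        _ = _ := by ring
  calc (1 + ‖m‖) ^ b * sn a (X.kerProjS (U X.θ m f))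
      ≤ (1 + ‖m‖) ^ b * (weightSum n * (C1 * ‖y‖)) := by gcongr
    _ = weightSum n * C1 * ((1 + ‖m‖) ^ b * ‖y‖) := by ring
    _ ≤ weightSum n * C1 * (C2 * sn b f) := by gcongr
    _ = _ := by ring

theorem Θ_one_add {s : ℝ} (hs : s ≠ 0) (f : SmoothSpinor n N) :
    X.Θ s (toL2 (f + ((s ^ 2 : ℝ) : ℂ) • X.D (X.D f))) = toL2 f - X.kerProj (toL2 f) := by
  have e : ∀ g : SmoothSpinor n N, X.T (toL2 (X.D g)) = toL2 g - X.kerProj (toL2 g) := fun g => by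
    rw [← toL2_TS, TS_D, map_sub, toL2_kerProjS]
  have h1 : X.T (X.T (toL2 (X.D (X.D f)))) = toL2 f - X.kerProj (toL2 f) := by
    rw [e, map_sub, T_kerProj, sub_zero, e]
  have h2 : toL2 f = X.kerProj (toL2 f) + X.T (X.T (toL2 (X.D (X.D f)))) := by
    rw [h1]
    abel
  have h3 : toL2 (f + ((s ^ 2 : ℝ) : ℂ) • X.D (X.D f)) = X.kerProj (toL2 f) +
      X.shiftSq s (toL2 (X.D (X.D f))) := by
    rw [map_add, map_smul, shiftSq_apply]
    conv_lhs =>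
      lhs
      rw [h2]
    abel
  rw [h3, map_add, Θ_kerProj X hs, zero_add, Θ_shiftSq X hs, h1]

variable {X}

theorem one_add_norm_pow_le {m : Idx n} (hm : m ≠ 0) (s : ℕ) :
    (1 + ‖m‖) ^ s ≤ 2 ^ s * ‖m‖ ^ (s : ℤ) := by
  rw [zpow_natCast, ← mul_pow]
  exact pow_le_pow_left₀ (by positivity) (by linarith [one_le_norm_idx hm]) s

/-- A weak form of the remainder estimate suffices. -/
theorem isExp_of_weak {P : Module.End ℂ (SmoothSpinor n N)} {d : ℤ}
    {F : ℕ → Cov n → Module.End ℂ (SmoothSpinor n N)} (hF : ∀ j : ℕ, F j ∈ X.homSpan (d - j) j)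
    (h : ∀ s, ∃ a : ℤ, ∀ j : ℕ, ∃ s' C, 0 ≤ C ∧ ∀ m f, m ≠ 0 →
      sn s (conjU X.θ m P f - ∑ r ∈ Finset.range (j + 1), F r (toCov m) f) ≤
        C * ‖m‖ ^ (a - j) * sn s' f) : X.IsExp P d F := by
  refine ⟨hF, fun J s => ?_⟩
  obtain ⟨a, ha⟩ := h s
  obtain ⟨j, hj1, hj2⟩ : ∃ j : ℕ, a - j ≤ d - J ∧ J ≤ j + 1 :=
    ⟨J + (a - d).toNat, by have := Int.self_le_toNat (a - d); push_cast; omega, by omega⟩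
  obtain ⟨s1, C1, hC1, h1⟩ := ha j
  have h2 : OrdBd (d - J) fun m f => ∑ r ∈ Finset.Ico J (j + 1), F r (toCov m) f := by
    refine OrdBd.sum _ fun i hi => (ordBd_of_homSpan (hF i)).mono ?_
    have := (Finset.mem_Ico.1 hi).1
    omega
  obtain ⟨s2, C2, hC2, h2⟩ := h2 s
  refine ⟨max s1 s2, C1 + C2, by positivity, fun m f hm => ?_⟩
  have e : conjU X.θ m P f - ∑ r ∈ Finset.range J, F r (toCov m) f =
      (conjU X.θ m P f - ∑ r ∈ Finset.range (j + 1), F r (toCov m) f) +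
        ∑ r ∈ Finset.Ico J (j + 1), F r (toCov m) f := by
    rw [← Finset.sum_range_add_sum_Ico _ hj2]
    abel
  change sn s (conjU X.θ m P f - ∑ r ∈ Finset.range J, F r (toCov m) f) ≤ _
  rw [e, add_mul, add_mul]
  refine (sn_add_le s _ _).trans (add_le_add ((h1 m f hm).trans ?_) ((h2 m f hm).trans ?_))
  · gcongr
    · exact sn_nonneg _ _
    · exact one_le_norm_idx hm
    · exact sn_mono (le_max_left _ _) f
  · gcongr
    exact sn_mono (le_max_right _ _) f

end ConfData

namespace ConfData
variable {n N : ℕ} (X : ConfData n N)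

theorem sum_para_bound (J b : ℕ) : ∃ s' C, 0 ≤ C ∧ ∀ (m : Idx n) (σ : ℝ) f, m ≠ 0 →
    sn b (∑ r ∈ Finset.range J, X.para r (toCov m) σ f) ≤ C * (1 + σ ^ 2)⁻¹ * sn s' f := by
  induction J with
  | zero => exact ⟨0, 0, le_rfl, fun m σ f _ => by simp⟩
  | succ J ih =>
    obtain ⟨s1, C1, hC1, h1⟩ := ih
    obtain ⟨s2, C2, hC2, h2⟩ := famSpan_bound (X.para_mem J) b
    refine ⟨max s1 s2, C1 + C2, by positivity, fun m σ f hm => ?_⟩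
    have h0 := inv_one_add_sq_nonneg σ
    rw [Finset.sum_range_succ, add_mul, add_mul]
    refine (sn_add_le _ _ _).trans (add_le_add ((h1 m σ f hm).trans ?_) ((h2 m σ f hm).trans ?_))
    · gcongr
      exact sn_mono (le_max_left _ _) f
    · have h3 : ‖m‖ ^ (-(J : ℤ)) ≤ 1 := zpow_le_one_of_nonpos₀ (one_le_norm_idx hm) (by simp)
      rw [pow_one]
      gcongr
      · exact sn_nonneg _ _
      · exact mul_le_of_le_one_right hC2 h3
      · exact sn_mono (le_max_right _ _) f

theorem err_bound (j b : ℕ) : ∃ s' C, 0 ≤ C ∧ ∀ (m : Idx n) (s : ℝ) f, m ≠ 0 →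
    sn b (((s ^ 2 : ℝ) : ℂ) • (X.errTerm j (toCov m) (s * ‖toCov m‖) f +
      (X.sqZero * X.para j) (toCov m) (s * ‖toCov m‖) f)) ≤
        C * ‖m‖ ^ (-1 - (j : ℤ)) * sn s' f := by
  have hmem : X.sqZero * X.para j ∈ X.famSpan 1 (-(j : ℤ)) (2 + j) := by
    simpa using mul_mem_famSpan X.sqZero_mem (X.para_mem j)
  obtain ⟨s1, C1, hC1, h1⟩ := famSpan_bound (X.errTerm_mem j) b
  obtain ⟨s2, C2, hC2, h2⟩ := famSpan_bound hmem b
  refine ⟨max s1 s2, C1 + C2, by positivity, fun m s f hm => ?_⟩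
  set σ := s * ‖toCov m‖ with hσ
  have hm1 := one_le_norm_idx hm
  have hm0 : 0 < ‖m‖ := by linarith
  have h0 := inv_one_add_sq_nonneg σ
  have hs : s ^ 2 * (1 + σ ^ 2)⁻¹ ≤ ‖m‖ ^ (-2 : ℤ) := by
    rw [zpow_neg, ← div_eq_mul_inv, div_le_iff₀ (by positivity)]
    have h3 : ‖m‖ ^ 2 * s ^ 2 ≤ σ ^ 2 := by
      rw [hσ, mul_pow, mul_comm]
      gcongr
      exact norm_le_norm_toCov m
    have h4 : (‖m‖ ^ (2 : ℤ))⁻¹ * (‖m‖ ^ 2 * s ^ 2) = s ^ 2 := by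
      rw [← mul_assoc, zpow_ofNat, inv_mul_cancel₀ (by positivity), one_mul]
    have h5 : 0 ≤ (‖m‖ ^ (2 : ℤ))⁻¹ := by positivity
    nlinarith
  have e1 : ‖m‖ ^ (-2 : ℤ) * ‖m‖ ^ (1 - (j : ℤ)) = ‖m‖ ^ (-1 - (j : ℤ)) := by
    rw [← zpow_add₀ hm0.ne']
    congr 1
    ring
  have h3 : ‖m‖ ^ (-(j : ℤ)) ≤ ‖m‖ ^ (1 - (j : ℤ)) := zpow_le_zpow_right₀ hm1 (by omega)
  rw [sn_smul, Complex.norm_real, Real.norm_of_nonneg (sq_nonneg s)]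
  set Y := sn (max s1 s2) f with hY
  have hY0 : 0 ≤ Y := sn_nonneg _ _
  have h4 : sn b (X.errTerm j (toCov m) σ f + (X.sqZero * X.para j) (toCov m) σ f) ≤
      (C1 + C2) * ‖m‖ ^ (1 - (j : ℤ)) * (1 + σ ^ 2)⁻¹ * Y := by
    rw [add_mul, add_mul, add_mul]
    refine (sn_add_le _ _ _).trans (add_le_add ((h1 m σ f hm).trans ?_) ((h2 m σ f hm).trans ?_))
    · rw [pow_one]
      gcongr
      exact sn_mono (le_max_left _ _) f
    · rw [pow_one]
      gcongr
      · exact sn_nonneg _ _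
      · exact sn_mono (le_max_right _ _) f
  calc s ^ 2 * sn b (X.errTerm j (toCov m) σ f + (X.sqZero * X.para j) (toCov m) σ f)
      ≤ s ^ 2 * ((C1 + C2) * ‖m‖ ^ (1 - (j : ℤ)) * (1 + σ ^ 2)⁻¹ * Y) := by gcongr
    _ = (s ^ 2 * (1 + σ ^ 2)⁻¹) * ((C1 + C2) * ‖m‖ ^ (1 - (j : ℤ)) * Y) := by ring
    _ ≤ ‖m‖ ^ (-2 : ℤ) * ((C1 + C2) * ‖m‖ ^ (1 - (j : ℤ)) * Y) := by gcongr
    _ = (C1 + C2) * (‖m‖ ^ (-2 : ℤ) * ‖m‖ ^ (1 - (j : ℤ))) * Y := by ring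
    _ = _ := by rw [e1]

/-- Comparison of `Θ s` with the parametrix on `U^m f`. -/
theorem Θ_sub_para_bound (a : ℕ) : ∃ b : ℕ, ∀ j : ℕ, ∃ s' C, 0 ≤ C ∧
    ∀ (m : Idx n) (s : ℝ) f, m ≠ 0 → s ≠ 0 → ∃ z : SmoothSpinor n N,
      toL2 z = X.Θ s (toL2 (U X.θ m f)) -
        toL2 (U X.θ m (∑ r ∈ Finset.range (j + 1), X.para r (toCov m) (s * ‖toCov m‖) f)) ∧
      sn a z ≤ C * ‖m‖ ^ ((b : ℤ) - 1 - (j : ℤ)) * sn s' f * (1 + s ^ 2)⁻¹ := by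
  obtain ⟨s1, C1, hC1, h1⟩ := X.sn_commute_bound a
  refine ⟨s1, fun j => ?_⟩
  obtain ⟨s2, C2, hC2, h2⟩ := X.err_bound j s1
  obtain ⟨C3, hC3, h3⟩ := X.kerProjS_U_bound a (j + 1)
  obtain ⟨s4, C4, hC4, h4⟩ := X.sum_para_bound (j + 1) (j + 1)
  set C5 := 1 + ‖X.T * X.T‖ with hC5
  have hC5' : 0 ≤ C5 := by positivity
  refine ⟨max s2 s4, C3 * C4 + C1 * C5 * 2 ^ s1 * C2, by positivity,
    fun m s f hm hs => ?_⟩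
  set w := ∑ r ∈ Finset.range (j + 1), X.para r (toCov m) (s * ‖toCov m‖) f with hw
  set e := ((s ^ 2 : ℝ) : ℂ) • (X.errTerm j (toCov m) (s * ‖toCov m‖) f +
      (X.sqZero * X.para j) (toCov m) (s * ‖toCov m‖) f) with he
  have hm1 := one_le_norm_idx hm
  have hm0 : 0 < ‖m‖ := by linarith
  have hcomm := X.commute_Θ_T hs
  have hker := fun x => X.Θ_kerProj hs x
  let t := restr (X.Θ s) (X.preservesSmooth_of_commute hcomm hker) (U X.θ m e)
  have ht : toL2 t = X.Θ s (toL2 (U X.θ m e)) := toL2_restr _ _ _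
  have hspec : w + ((s ^ 2 : ℝ) : ℂ) • X.shiftD (toCov m) (X.shiftD (toCov m) w) = f + e :=
    X.para_sum_spec j (toCov_ne_zero hm) s f
  have hU : U X.θ m w + ((s ^ 2 : ℝ) : ℂ) • X.D (X.D (U X.θ m w)) = U X.θ m f + U X.θ m e := by
    rw [D_D_U, ← map_smul, ← map_add, hspec, map_add]
  refine ⟨-X.kerProjS (U X.θ m w) - t, ?_, ?_⟩
  · have h5 := X.Θ_one_add hs (U X.θ m w)
    rw [hU, map_add, map_add] at h5
    rw [map_sub, map_neg, ht, toL2_kerProjS, eq_sub_of_add_eq h5]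
    abel
  · have hs0 := inv_one_add_sq_nonneg s
    set Y := sn (max s2 s4) f with hY
    have hY0 : 0 ≤ Y := sn_nonneg _ _
    have eb : ‖m‖ ^ ((s1 : ℤ) - 1 - (j : ℤ)) = ‖m‖ ^ (s1 : ℤ) * ‖m‖ ^ (-1 - (j : ℤ)) := by
      rw [← zpow_add₀ hm0.ne']
      congr 1
      ring
    have hb1 : sn a (X.kerProjS (U X.θ m w)) ≤
        C3 * C4 * ‖m‖ ^ ((s1 : ℤ) - 1 - (j : ℤ)) * Y * (1 + s ^ 2)⁻¹ := by
      have h5 : sn (j + 1) w ≤ C4 * (1 + s ^ 2)⁻¹ * Y := by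
        refine (h4 m _ f hm).trans ?_
        have h6 : s ^ 2 ≤ (s * ‖toCov m‖) ^ 2 := by
          rw [mul_pow]
          have h7 : 1 ≤ ‖toCov m‖ := hm1.trans (norm_le_norm_toCov m)
          exact le_mul_of_one_le_right (sq_nonneg s) (one_le_pow₀ h7)
        gcongr
        · exact sn_nonneg _ _
        · exact sn_mono (le_max_right _ _) f
      have h6 := (h3 m w).trans (mul_le_mul_of_nonneg_left h5 hC3)
      have h7 : ‖m‖ ^ (j + 1) * sn a (X.kerProjS (U X.θ m w)) ≤
          C3 * (C4 * (1 + s ^ 2)⁻¹ * Y) := by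
        refine le_trans ?_ h6
        refine mul_le_mul_of_nonneg_right ?_ (sn_nonneg _ _)
        gcongr
        linarith
      have h8 : 1 ≤ ‖m‖ ^ ((s1 : ℤ) - 1 - (j : ℤ)) * ‖m‖ ^ (j + 1) := by
        rw [eb, mul_assoc, ← zpow_natCast ‖m‖ (j + 1), ← zpow_add₀ hm0.ne']
        have : (-1 - (j : ℤ) + ((j + 1 : ℕ) : ℤ)) = 0 := by push_cast; ring
        rw [this, zpow_zero, mul_one, zpow_natCast]
        exact one_le_pow₀ hm1
      have h9 : 0 ≤ ‖m‖ ^ ((s1 : ℤ) - 1 - (j : ℤ)) := by positivity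
      calc sn a (X.kerProjS (U X.θ m w)) ≤
          (‖m‖ ^ ((s1 : ℤ) - 1 - (j : ℤ)) * ‖m‖ ^ (j + 1)) * sn a (X.kerProjS (U X.θ m w)) :=
            le_mul_of_one_le_left (sn_nonneg _ _) h8
        _ = ‖m‖ ^ ((s1 : ℤ) - 1 - (j : ℤ)) *
            (‖m‖ ^ (j + 1) * sn a (X.kerProjS (U X.θ m w))) := by ring
        _ ≤ ‖m‖ ^ ((s1 : ℤ) - 1 - (j : ℤ)) * (C3 * (C4 * (1 + s ^ 2)⁻¹ * Y)) := by gcongr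
        _ = _ := by ring
    have hb2 : sn a t ≤ C1 * C5 * 2 ^ s1 * C2 * ‖m‖ ^ ((s1 : ℤ) - 1 - (j : ℤ)) * Y *
        (1 + s ^ 2)⁻¹ := by
      refine (h1 (X.Θ s) hcomm hker _ _ ht).trans ?_
      have h5 : sn s1 (U X.θ m e) ≤ 2 ^ s1 * ‖m‖ ^ (s1 : ℤ) * (C2 * ‖m‖ ^ (-1 - (j : ℤ)) * Y) := by
        refine (sn_U_le _ _ _ _).trans ?_
        refine mul_le_mul (one_add_norm_pow_le hm s1) ((h2 m s f hm).trans ?_) (sn_nonneg _ _)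
          (by positivity)
        gcongr
        exact sn_mono (le_max_left _ _) f
      calc C1 * ‖X.Θ s‖ * sn s1 (U X.θ m e)
          ≤ C1 * (C5 * (1 + s ^ 2)⁻¹) *
            (2 ^ s1 * ‖m‖ ^ (s1 : ℤ) * (C2 * ‖m‖ ^ (-1 - (j : ℤ)) * Y)) := by
            refine mul_le_mul ?_ h5 (sn_nonneg _ _) (by positivity)
            gcongr
            exact X.norm_Θ_le hs
        _ = _ := by rw [eb]; ring
    refine (sn_sub_le _ _ _).trans ?_
    rw [sn_neg, add_mul, add_mul, add_mul]
    exact add_le_add hb1 hb2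

theorem isExp_QS : ∃ F, X.IsExp X.QS (-1) F := by
  choose F' hF' hint using fun r => exists_integral_famSpan (X.para_mem r)
  let F : ℕ → Cov n → Module.End ℂ (SmoothSpinor n N) := fun r =>
    ((Real.pi⁻¹ : ℝ) : ℂ) • ((fun ξ => ((‖ξ‖ ^ (-1 : ℤ) : ℝ) : ℂ) • 1) * F' r)
  have hF : ∀ r : ℕ, F r ∈ X.homSpan (-1 - r) r := fun r => by
    refine Submodule.smul_mem _ _ ?_
    have h := mul_mem_homSpan (smul_mem_homSpan (isHomogFun_norm_zpow (n := n) (-1))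
      X.one_mem_grade) (hF' r)
    rwa [zero_add, ← sub_eq_add_neg] at h
  refine ⟨F, isExp_of_weak hF fun a => ?_⟩
  obtain ⟨b, hb⟩ := X.Θ_sub_para_bound (a + 2 * n)
  refine ⟨a + b - 1, fun j => ?_⟩
  obtain ⟨s', C, hC, h⟩ := hb j
  have hwn := weightSum_nonneg n
  refine ⟨s', 2 ^ a * (weightSum n * C), by positivity, fun m u hm => ?_⟩
  have hm1 := one_le_norm_idx hm
  have hm0 : 0 < ‖m‖ := by linarith
  set ξ := toCov m with hξ
  have hρ : 0 < ‖ξ‖ := norm_toCov_pos hm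
  set y := conjU X.θ m X.QS u - ∑ r ∈ Finset.range (j + 1), F r ξ u with hy
  let sh : L2 n (Spin N) →L[ℂ] L2 n (Spin N) :=
    shiftOp (fun p q => cocycle X.θ p q) (fun p q => norm_cocycle X.θ p q) m
  have hsh : ∀ g : SmoothSpinor n N, toL2 (U X.θ m g) = sh (toL2 g) := fun g => rfl
  have hz : ∀ s : ℝ, ∃ z : SmoothSpinor n N, s ≠ 0 → toL2 z = X.Θ s (toL2 (U X.θ m u)) -
      toL2 (U X.θ m (∑ r ∈ Finset.range (j + 1), X.para r ξ (s * ‖ξ‖) u)) ∧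
      sn (a + 2 * n) z ≤ C * ‖m‖ ^ ((b : ℤ) - 1 - (j : ℤ)) * sn s' u * (1 + s ^ 2)⁻¹ := by
    intro s
    by_cases hs : s = 0
    · exact ⟨0, fun h => absurd hs h⟩
    · obtain ⟨z, hz⟩ := h m s u hm hs
      exact ⟨z, fun _ => hz⟩
  choose z hz using hz
  have hint' : ∀ r, MeasureTheory.Integrable (fun s : ℝ => toL2 (X.para r ξ (s * ‖ξ‖) u)) ∧
      ∫ s : ℝ, toL2 (X.para r ξ (s * ‖ξ‖) u) = ((‖ξ‖ ^ (-1 : ℤ) : ℝ) : ℂ) • toL2 (F' r ξ u) := by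
    intro r
    refine ⟨(hint r ξ u).1.comp_mul_right' hρ.ne', ?_⟩
    rw [MeasureTheory.Measure.integral_comp_mul_right (fun σ => toL2 (X.para r ξ σ u)) ‖ξ‖,
      (hint r ξ u).2, abs_of_pos (inv_pos.2 hρ), zpow_neg, zpow_one, Complex.coe_smul]
    rfl
  have hΘ : MeasureTheory.Integrable fun s => X.Θ s (toL2 (U X.θ m u)) :=
    X.integrable_Θ.apply_continuousLinearMap _
  have hw : MeasureTheory.Integrable fun s : ℝ =>
      ∑ r ∈ Finset.range (j + 1), toL2 (X.para r ξ (s * ‖ξ‖) u) :=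
    MeasureTheory.integrable_finsetSum _ fun r _ => (hint' r).1
  have hae : (fun s => toL2 (z s)) =ᵐ[MeasureTheory.volume] fun s =>
      X.Θ s (toL2 (U X.θ m u)) -
        sh (∑ r ∈ Finset.range (j + 1), toL2 (X.para r ξ (s * ‖ξ‖) u)) := by
    filter_upwards [ae_ne_zero] with s hs
    rw [(hz s hs).1, hsh (∑ r ∈ Finset.range (j + 1), X.para r ξ (s * ‖ξ‖) u), map_sum]
  have hzint : MeasureTheory.Integrable fun s => toL2 (z s) :=
    (hΘ.sub (sh.integrable_comp hw)).congr hae.symm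
  have hzval : ((Real.pi⁻¹ : ℝ) : ℂ) • ∫ s, toL2 (z s) = toL2 (U X.θ m y) := by
    rw [MeasureTheory.integral_congr_ae hae, MeasureTheory.integral_sub hΘ (sh.integrable_comp hw),
      sh.integral_comp_comm hw, MeasureTheory.integral_finsetSum _ fun r _ => (hint' r).1,
      smul_sub, ← Q_apply, ← toL2_QS, hy, map_sub, U_conjU X.skew, map_sub]
    congr 1
    rw [hsh, ← map_smul, map_sum, Finset.smul_sum]
    congr 1
    refine Finset.sum_congr rfl fun r _ => ?_
    rw [(hint' r).2]
    rfl
  have hbound : sn a (U X.θ m y) ≤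
      weightSum n * (C * ‖m‖ ^ ((b : ℤ) - 1 - (j : ℤ)) * sn s' u) := by
    refine sn_le_of_bound fun l => ?_
    have h1 := integral_weight_le (integrable_inv_one_add_sq.const_mul
      (C * ‖m‖ ^ ((b : ℤ) - 1 - (j : ℤ)) * sn s' u)) hzint
      (by filter_upwards [ae_ne_zero] with s hs using (hz s hs).2) l
    rw [MeasureTheory.integral_const_mul, integral_univ_inv_one_add_sq] at h1
    have h2 : (U X.θ m y).1 l = ((Real.pi⁻¹ : ℝ) : ℂ) • (∫ s, toL2 (z s)) l := by
      rw [← toL2_apply, ← hzval]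
      rfl
    rw [h2, norm_smul, Complex.norm_real, Real.norm_of_nonneg (by positivity)]
    calc (1 + ‖l‖) ^ (a + 2 * n) * (Real.pi⁻¹ * ‖(∫ s, toL2 (z s)) l‖)
        = Real.pi⁻¹ * ((1 + ‖l‖) ^ (a + 2 * n) * ‖(∫ s, toL2 (z s)) l‖) := by ring
      _ ≤ Real.pi⁻¹ * (C * ‖m‖ ^ ((b : ℤ) - 1 - (j : ℤ)) * sn s' u * Real.pi) := by gcongr
      _ = _ := by field_simp
  have hfin := (sn_le_U X.skew a m y).trans
    (mul_le_mul (one_add_norm_pow_le hm a) hbound (sn_nonneg _ _) (by positivity))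
  refine hfin.trans (le_of_eq ?_)
  have e : ‖m‖ ^ ((a : ℤ) + b - 1 - j) = ‖m‖ ^ (a : ℤ) * ‖m‖ ^ ((b : ℤ) - 1 - (j : ℤ)) := by
    rw [← zpow_add₀ hm0.ne']
    congr 1
    ring
  rw [e]
  ring

theorem isExp_QS_pow : ∀ t : ℕ, ∃ F, X.IsExp (X.QS ^ t) (-(t : ℤ)) F
  | 0 => by
    have h := isExp_of_commute X.one_mem_grade fun _ _ => rfl
    exact ⟨_, by simpa using h⟩
  | t + 1 => by
    obtain ⟨F, hF⟩ := isExp_QS_pow t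
    obtain ⟨G, hG⟩ := X.isExp_QS
    have h := hF.mul hG
    have e : -(t : ℤ) + -1 = -((t + 1 : ℕ) : ℤ) := by push_cast; ring
    rw [← pow_succ, e] at h
    exact ⟨_, h⟩

end ConfData

/-! ### The algebra of left multiplications -/

section
variable {n N : ℕ}
open ConfData

theorem spinMap_convOp (w : Idx n → Idx n → ℂ) (hw : ∀ p q, ‖w p q‖ = 1) (φ : Mat N)
    (a : SmoothAlg n) (f : SmoothSpinor n N) :
    spinMap φ (convOp w hw a f) = convOp w hw a (spinMap φ f) := by
  apply Subtype.ext
  funext l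
  have h := (summable_conv w hw a f l).of_norm.hasSum.mapL φ
  refine h.tsum_eq.symm.trans ?_
  exact tsum_congr fun p => map_smul φ _ _

/-- The unit of the smooth algebra. -/
def oneAlg : SmoothAlg n :=
  ⟨Pi.single 0 1, fun s => by
    refine summable_of_ne_finset_zero (s := {0}) (fun p hp => ?_)
    have h : p ≠ 0 := by simpa using hp
    simp [Pi.single_eq_of_ne h]⟩

theorem lmul_oneAlg (θ : Matrix (Fin n) (Fin n) ℝ) (f : SmoothSpinor n N) :
    lmul θ oneAlg f = f := by
  apply Subtype.ext
  funext l
  change conv _ oneAlg.1 f.1 l = _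
  rw [conv, tsum_eq_single 0]
  · simp [oneAlg]
  · intro p hp
    simp [oneAlg, Pi.single_eq_of_ne hp]

/-- Multiplication by `U^m` from the right. -/
def rightU (θ : Matrix (Fin n) (Fin n) ℝ) (m : Idx n) : L2 n (Spin N) →L[ℂ] L2 n (Spin N) :=
  shiftOp (fun p q => cocycle θ q p) (fun p q => norm_cocycle θ q p) m

theorem rightU_mono (θ : Matrix (Fin n) (Fin n) ℝ) (m : Idx n) (v : Spin N) :
    rightU θ m (toL2 (mono 0 v)) = toL2 (mono m v) := by
  refine lp.ext (funext fun l => ?_)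
  rw [rightU, shiftOp_apply, toL2_apply, toL2_apply]
  by_cases h : l = m
  · rw [h, sub_self, mono_apply_self, mono_apply_self, cocycle_zero_left, one_smul]
  · rw [mono_apply_ne h, mono_apply_ne (sub_ne_zero.2 h), smul_zero]

/-- Left multiplication on the Hilbert space. -/
def lmulL2 (θ : Matrix (Fin n) (Fin n) ℝ) (a : SmoothAlg n) :
    L2 n (Spin N) →L[ℂ] L2 n (Spin N) :=
  convL2 (fun p q => cocycle θ p q) (fun p q => norm_cocycle θ p q) a

theorem lmulL2_toL2 (θ : Matrix (Fin n) (Fin n) ℝ) (a : SmoothAlg n) (f : SmoothSpinor n N) :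
    lmulL2 θ a (toL2 f) = toL2 (lmul θ a f) := convL2_toL2 _ _ _ _

theorem lmulL2_rightU (θ : Matrix (Fin n) (Fin n) ℝ) (a : SmoothAlg n) (m : Idx n)
    (x : L2 n (Spin N)) : lmulL2 θ a (rightU θ m x) = rightU θ m (lmulL2 θ a x) := by
  refine (convL2_hasSum _ _ a _).unique ?_
  refine ((convL2_hasSum _ _ a x).mapL _).congr_fun fun p => ?_
  rw [map_smul]
  congr 1
  exact shiftOp_comm θ p m x

theorem lmul_lmul_mono_zero (θ : Matrix (Fin n) (Fin n) ℝ) (a b : SmoothAlg n) (v : Spin N) :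
    lmul θ (lmul θ a b) (mono 0 v) = lmul θ a (lmul θ b (mono 0 v)) := by
  apply Subtype.ext
  funext l
  rw [lmul_mono_zero]
  have h := (summable_conv (fun p q => cocycle θ p q) (fun p q => norm_cocycle θ p q) a b
    l).of_norm.hasSum.smul_const v
  refine h.tsum_eq.symm.trans (tsum_congr fun p => ?_)
  rw [lmul_mono_zero, smul_smul, smul_eq_mul]

theorem lmul_lmul (θ : Matrix (Fin n) (Fin n) ℝ) (a b : SmoothAlg n) (f : SmoothSpinor n N) :
    lmul θ (lmul θ a b) f = lmul θ a (lmul θ b f) := by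
  have h0 : ∀ m v, lmulL2 θ (lmul θ a b) (toL2 (mono m v)) =
      lmulL2 θ a (lmulL2 θ b (toL2 (mono m v))) := fun m (v : Spin N) => by
    rw [← rightU_mono θ m v]
    simp only [lmulL2_rightU, lmulL2_toL2, lmul_lmul_mono_zero]
  have h1 : ∀ x : L2 n (Spin N), lmulL2 θ (lmul θ a b) x = lmulL2 θ a (lmulL2 θ b x) := by
    intro x
    have hx := lp.hasSum_single (p := 2) (by simp) x
    refine (hx.mapL _).unique ?_
    refine ((hx.mapL (lmulL2 θ b)).mapL (lmulL2 θ a)).congr_fun fun m => ?_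
    exact h0 m (x m)
  apply toL2_injective
  rw [← lmulL2_toL2, h1, lmulL2_toL2, lmulL2_toL2]

end

namespace ConfData
variable {n N : ℕ} (X : ConfData n N)

/-- Filtered operators of degree zero commuting with the left multiplications. -/
structure IsFlat (Q : Module.End ℂ (SmoothSpinor n N)) : Prop where
  mem : Q ∈ X.grade 0
  lmul_comm : ∀ b f, Q (lmul X.θ b f) = lmul X.θ b (Q f)
  U_comm : ∀ m f, Q (U X.θ m f) = U X.θ m (Q f)

variable {X} in
theorem IsFlat.mul {Q Q' : Module.End ℂ (SmoothSpinor n N)} (h : X.IsFlat Q) (h' : X.IsFlat Q') :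
    X.IsFlat (Q * Q') where
  mem := mul_mem_grade h.mem h'.mem
  lmul_comm b f := by
    change Q (Q' (lmul X.θ b f)) = _
    rw [h'.lmul_comm, h.lmul_comm]
    rfl
  U_comm m f := by
    change Q (Q' (U X.θ m f)) = _
    rw [h'.U_comm, h.U_comm]
    rfl

theorem isFlat_one : X.IsFlat 1 := ⟨X.one_mem_grade, fun _ _ => rfl, fun _ _ => rfl⟩

theorem isFlat_kS : X.IsFlat X.kS :=
  ⟨X.kS_mem_grade, fun b f => (lmul_rmul X.θ b X.k f).symm, fun m f => rmul_U _ _ m f⟩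

theorem isFlat_spinMap (φ : Mat N) : X.IsFlat (spinMap φ) :=
  ⟨X.spinMap_mem_grade φ, fun b f => spinMap_convOp _ _ φ b f, fun m f => spinMap_U _ _ m f⟩

theorem isFlat_leadD (j : Fin n) : X.IsFlat (X.leadD j) :=
  (X.isFlat_spinMap _).mul (X.isFlat_kS.mul X.isFlat_kS)

theorem bracket_D_lmul (b : SmoothAlg n) :
    ⁅X.D, lmul X.θ b⁆ = ∑ j, lmul X.θ (delta j b) * X.leadD j := by
  refine LinearMap.ext fun f => ?_
  have h : ∀ g : SmoothSpinor n N, dirac X.γ (lmul X.θ b g) = lmul X.θ b (dirac X.γ g) +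
      ∑ j, lmul X.θ (delta j b) (spinMap (X.γ j) g) := by
    intro g
    have e : ∀ g : SmoothSpinor n N, dirac X.γ g = ∑ j, spinMap (X.γ j) (delta j g) := fun g => by
      rw [dirac, LinearMap.sum_apply]
      rfl
    rw [e, e, map_sum, ← Finset.sum_add_distrib]
    refine Finset.sum_congr rfl fun j _ => ?_
    have h1 : delta j (lmul X.θ b g) = lmul X.θ b (delta j g) + lmul X.θ (delta j b) g :=
      delta_convOp _ _ j b g
    rw [h1, map_add, (X.isFlat_spinMap (X.γ j)).lmul_comm, (X.isFlat_spinMap (X.γ j)).lmul_comm]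
  have h2 : ⁅X.D, lmul X.θ b⁆ f = X.D (lmul X.θ b f) - lmul X.θ b (X.D f) := rfl
  rw [h2, D_apply, D_apply, ← lmul_rmul, h, map_add, ← lmul_rmul, add_sub_cancel_left, map_sum,
    LinearMap.sum_apply]
  refine Finset.sum_congr rfl fun j _ => ?_
  rw [← lmul_rmul, ← spinMap_kS]
  rfl

/-- The finite sums of products of a left multiplication and a flat operator. -/
def leftSpan : Submodule ℂ (Module.End ℂ (SmoothSpinor n N)) :=
  Submodule.span ℂ {T | ∃ a Q, X.IsFlat Q ∧ T = lmul X.θ a * Q}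

theorem mul_mem_leftSpan {S T : Module.End ℂ (SmoothSpinor n N)} (hS : S ∈ X.leftSpan)
    (hT : T ∈ X.leftSpan) : S * T ∈ X.leftSpan := by
  have h := Submodule.mul_mem_mul hS hT
  rw [leftSpan, Submodule.span_mul_span] at h
  refine Submodule.span_mono ?_ h
  rintro _ ⟨_, ⟨a, Q, hQ, rfl⟩, _, ⟨a', Q', hQ', rfl⟩, rfl⟩
  refine ⟨lmul X.θ a a', Q * Q', hQ.mul hQ', LinearMap.ext fun f => ?_⟩
  change lmul X.θ a (Q (lmul X.θ a' (Q' f))) = lmul X.θ (lmul X.θ a a') (Q (Q' f))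
  rw [hQ.lmul_comm, lmul_lmul]

theorem zeroOrder_le_leftSpan {T : Module.End ℂ (SmoothSpinor n N)}
    (hT : T ∈ zeroOrder X.θ X.γ X.k) : T ∈ X.leftSpan := by
  induction hT using Algebra.adjoin_induction with
  | mem T h =>
    rcases h with ⟨a, rfl⟩ | ⟨b, rfl⟩
    · exact Submodule.subset_span ⟨a, 1, X.isFlat_one, rfl⟩
    · have h := X.bracket_D_lmul b
      change ⁅X.D, lmul X.θ b⁆ ∈ _
      rw [h]
      exact Submodule.sum_mem _ fun j _ =>
        Submodule.subset_span ⟨_, _, X.isFlat_leadD j, rfl⟩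
  | algebraMap c =>
    rw [Algebra.algebraMap_eq_smul_one]
    refine Submodule.smul_mem _ _ (Submodule.subset_span ⟨oneAlg, 1, X.isFlat_one, ?_⟩)
    exact LinearMap.ext fun f => (lmul_oneAlg _ f).symm
  | add S T _ _ h1 h2 => exact add_mem h1 h2
  | mul S T _ _ h1 h2 => exact X.mul_mem_leftSpan h1 h2

end ConfData

/-! ### Linear combinations of symbols -/

section
variable {n N : ℕ}

theorem IsHomogeneousSymbol.contDiffAt {r : ℤ} {c : Cov n → Idx n → Idx n → Mat N}
    (h : IsHomogeneousSymbol r c) (p q : Idx n) {ξ : Cov n} (hξ : ξ ∈ ({0}ᶜ : Set (Cov n))) :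
    ContDiffAt ℝ ∞ (fun η => c η p q) ξ :=
  (h.smooth p q).contDiffAt (isOpen_compl_singleton.mem_nhds hξ)

theorem isHomogeneousSymbol_zero (r : ℤ) :
    IsHomogeneousSymbol r (0 : Cov n → Idx n → Idx n → Mat N) where
  smooth p q := contDiffOn_const
  bound K _ _ i s := ⟨0, fun ξ _ p q => by
    have h : (fun η : Cov n => (0 : Cov n → Idx n → Idx n → Mat N) η p q) = fun _ => 0 := rfl
    rw [h, iteratedFDeriv_fun_zero]
    simp⟩
  homogeneous t _ ξ _ p q := ContinuousLinearMap.ext fun v => by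
    change (0 : Spin N) = t ^ r • (0 : Spin N)
    rw [smul_zero]

theorem IsHomogeneousSymbol.add {r : ℤ} {c c' : Cov n → Idx n → Idx n → Mat N}
    (h : IsHomogeneousSymbol r c) (h' : IsHomogeneousSymbol r c') :
    IsHomogeneousSymbol r (c + c') where
  smooth p q := (h.smooth p q).add (h'.smooth p q)
  bound K hK hK0 i s := by
    obtain ⟨C, hC⟩ := h.bound K hK hK0 i s
    obtain ⟨C', hC'⟩ := h'.bound K hK hK0 i s
    refine ⟨C + C', fun ξ hξ p q => ?_⟩
    have e : iteratedFDeriv ℝ i (fun η => (c + c') η p q) ξ =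
        iteratedFDeriv ℝ i (fun η => c η p q) ξ + iteratedFDeriv ℝ i (fun η => c' η p q) ξ :=
      iteratedFDeriv_add_apply ((h.contDiffAt p q (hK0 hξ)).of_le (by exact_mod_cast le_top))
        ((h'.contDiffAt p q (hK0 hξ)).of_le (by exact_mod_cast le_top))
    rw [e]
    refine (mul_le_mul_of_nonneg_left (norm_add_le _ _) (by positivity)).trans ?_
    rw [mul_add]
    exact add_le_add (hC ξ hξ p q) (hC' ξ hξ p q)
  homogeneous t ht ξ hξ p q := by
    change c (t • ξ) p q + c' (t • ξ) p q = t ^ r • (c ξ p q + c' ξ p q)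
    rw [h.homogeneous t ht ξ hξ, h'.homogeneous t ht ξ hξ, smul_add]

theorem IsHomogeneousSymbol.smul {r : ℤ} (z : ℂ) {c : Cov n → Idx n → Idx n → Mat N}
    (h : IsHomogeneousSymbol r c) : IsHomogeneousSymbol r (z • c) where
  smooth p q := (h.smooth p q).const_smul z
  bound K hK hK0 i s := by
    obtain ⟨C, hC⟩ := h.bound K hK hK0 i s
    refine ⟨‖z • (1 : Mat N →L[ℝ] Mat N)‖ * C, fun ξ hξ p q => ?_⟩
    have e := (z • (1 : Mat N →L[ℝ] Mat N)).norm_iteratedFDeriv_comp_left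
      (h.contDiffAt p q (hK0 hξ)) (n := i) (by exact_mod_cast le_top)
    refine (mul_le_mul_of_nonneg_left e (by positivity)).trans ?_
    rw [mul_left_comm]
    exact mul_le_mul_of_nonneg_left (hC ξ hξ p q) (norm_nonneg _)
  homogeneous t ht ξ hξ p q := by
    change z • c (t • ξ) p q = t ^ r • (z • c ξ p q)
    rw [h.homogeneous t ht ξ hξ, smul_comm]

theorem IsHomogeneousSymbol.decay {r : ℤ} {c : Cov n → Idx n → Idx n → Mat N}
    (h : IsHomogeneousSymbol r c) {ξ : Cov n} (hξ : ξ ≠ 0) (s : ℕ) :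
    ∃ C, 0 ≤ C ∧ ∀ p q, (1 + ‖p‖ + ‖q‖) ^ s * ‖c ξ p q‖ ≤ C := by
  obtain ⟨C, hC⟩ := h.bound {ξ} isCompact_singleton (Set.singleton_subset_iff.2 hξ) 0 s
  refine ⟨|C|, abs_nonneg _, fun p q => ?_⟩
  have h1 := hC ξ rfl p q
  rw [norm_iteratedFDeriv_zero] at h1
  exact h1.trans (le_abs_self C)

theorem IsHomogeneousSymbol.summable {r : ℤ} {c : Cov n → Idx n → Idx n → Mat N}
    (h : IsHomogeneousSymbol r c) (θ : Matrix (Fin n) (Fin n) ℝ) {ξ : Cov n} (hξ : ξ ≠ 0)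
    (m l : Idx n) (v : Spin N) : Summable fun p =>
      (cocycle θ p m * cocycle θ (p + m) (l - p - m)) • c ξ p (l - p - m) v := by
  obtain ⟨C, hC0, hC⟩ := h.decay hξ (2 * n)
  refine Summable.of_norm (Summable.of_nonneg_of_le (fun _ => norm_nonneg _) (fun p => ?_)
    ((summable_weight n).mul_left (C * ‖v‖)))
  rw [norm_smul, norm_mul, norm_cocycle, norm_cocycle, one_mul, one_mul]
  refine ((c ξ p (l - p - m)).le_opNorm v).trans ?_
  have h0 : 0 < (1 + ‖p‖) ^ (2 * n) := by positivity
  have h1 : (1 + ‖p‖) ^ (2 * n) * ‖c ξ p (l - p - m)‖ ≤ C := by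
    refine le_trans (mul_le_mul_of_nonneg_right ?_ (norm_nonneg _)) (hC p (l - p - m))
    exact pow_le_pow_left₀ (by positivity) (by linarith [norm_nonneg (l - p - m)]) _
  rw [← div_eq_mul_inv, le_div_iff₀ h0]
  nlinarith [norm_nonneg v]

theorem hasSymbol_zero (θ : Matrix (Fin n) (Fin n) ℝ) (d : ℤ) :
    HasSymbol θ (0 : Module.End ℂ (SmoothSpinor n N)) d 0 where
  homogeneous r := isHomogeneousSymbol_zero r
  order r _ ξ p q := rfl
  expansion r hr s := ⟨0, fun m l v _ => by
    have h : ∀ i, symbolCoeff θ ((0 : ℤ → Cov n → Idx n → Idx n → Mat N) i (toCov m)) m l v = 0 :=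
      fun i => by simp [symbolCoeff]
    have h' : ((0 : Module.End ℂ (SmoothSpinor n N)) (mono m v)).1 l = 0 := rfl
    rw [h', Finset.sum_eq_zero fun i _ => h i]
    simp⟩

theorem HasSymbol.add {θ : Matrix (Fin n) (Fin n) ℝ} {P P' : Module.End ℂ (SmoothSpinor n N)}
    {d : ℤ} {σ σ' : ℤ → Cov n → Idx n → Idx n → Mat N} (h : HasSymbol θ P d σ)
    (h' : HasSymbol θ P' d σ') : HasSymbol θ (P + P') d (σ + σ') where
  homogeneous r := (h.homogeneous r).add (h'.homogeneous r)
  order r hr ξ p q := by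
    change σ r ξ p q + σ' r ξ p q = 0
    rw [h.order r hr, h'.order r hr, add_zero]
  expansion r hr s := by
    obtain ⟨C, hC⟩ := h.expansion r hr s
    obtain ⟨C', hC'⟩ := h'.expansion r hr s
    refine ⟨C + C', fun m l v hm => ?_⟩
    have e : ∀ i, symbolCoeff θ ((σ + σ') i (toCov m)) m l v =
        symbolCoeff θ (σ i (toCov m)) m l v + symbolCoeff θ (σ' i (toCov m)) m l v := fun i => by
      rw [symbolCoeff, symbolCoeff, symbolCoeff,
        ← ((h.homogeneous i).summable θ (toCov_ne_zero hm) m l v).tsum_add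
          ((h'.homogeneous i).summable θ (toCov_ne_zero hm) m l v)]
      exact tsum_congr fun p => smul_add _ _ _
    have e2 : ((P + P') (mono m v)).1 l = (P (mono m v)).1 l + (P' (mono m v)).1 l := rfl
    simp only [e, e2, Finset.sum_add_distrib]
    rw [add_sub_add_comm, add_mul, add_mul]
    refine (mul_le_mul_of_nonneg_left (norm_add_le _ _) (by positivity)).trans ?_
    rw [mul_add]
    exact add_le_add (hC m l v hm) (hC' m l v hm)

theorem HasSymbol.smul {θ : Matrix (Fin n) (Fin n) ℝ} (z : ℂ)
    {P : Module.End ℂ (SmoothSpinor n N)}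
    {d : ℤ} {σ : ℤ → Cov n → Idx n → Idx n → Mat N} (h : HasSymbol θ P d σ) :
    HasSymbol θ (z • P) d (z • σ) where
  homogeneous r := (h.homogeneous r).smul z
  order r hr ξ p q := by
    change z • σ r ξ p q = 0
    rw [h.order r hr]
    exact ContinuousLinearMap.ext fun _ => smul_zero (A := Spin N) z
  expansion r hr s := by
    obtain ⟨C, hC⟩ := h.expansion r hr s
    refine ⟨‖z‖ * C, fun m l v hm => ?_⟩
    have e : ∀ i, symbolCoeff θ ((z • σ) i (toCov m)) m l v =
        z • symbolCoeff θ (σ i (toCov m)) m l v := fun i => by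
      rw [symbolCoeff, symbolCoeff, ← tsum_const_smul'' z]
      exact tsum_congr fun p => smul_comm _ z (σ i (toCov m) p (l - p - m) v)
    have e2 : ((z • P) (mono m v)).1 l = z • (P (mono m v)).1 l := rfl
    simp only [e, e2, ← Finset.smul_sum]
    rw [← smul_sub, norm_smul, mul_left_comm, mul_assoc, mul_assoc]
    refine mul_le_mul_of_nonneg_left ?_ (norm_nonneg z)
    rw [← mul_assoc]
    exact hC m l v hm

end

/-! ### The symbol of an operator with an expansion -/

section
variable {n N : ℕ}
open ConfData

theorem mono_add (m : Idx n) (v w : Spin N) : mono m (v + w) = mono m v + mono m w := by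
  apply Subtype.ext
  exact Pi.single_add (f := fun _ : Idx n => Spin N) m v w

theorem mono_smul (m : Idx n) (c : ℂ) (v : Spin N) : mono m (c • v) = c • mono m v := by
  apply Subtype.ext
  exact Pi.single_smul (f := fun _ : Idx n => Spin N) m c v

theorem sn_mono_zero (s : ℕ) (v : Spin N) : sn s (mono (0 : Idx n) v) = ‖v‖ := by
  rw [sn, tsum_eq_single 0]
  · rw [mono_apply_self, norm_zero, add_zero, one_pow, one_mul]
  · intro p hp
    rw [mono_apply_ne hp, norm_zero, mul_zero]

/-- The matrix `v ↦ (A (1 ⊗ v))_q`. -/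
def coeffMat (A : Module.End ℂ (SmoothSpinor n N)) (q : Idx n) : Mat N :=
  LinearMap.toContinuousLinearMap
    { toFun := fun v => (A (mono 0 v)).1 q
      map_add' := fun v w => by
        rw [mono_add, map_add]
        rfl
      map_smul' := fun c v => by
        rw [mono_smul, map_smul]
        rfl }

theorem coeffMat_apply (A : Module.End ℂ (SmoothSpinor n N)) (q : Idx n) (v : Spin N) :
    coeffMat A q v = (A (mono 0 v)).1 q := rfl

theorem coeffMat_bound {A : Module.End ℂ (SmoothSpinor n N)} (hA : Tempered A) (s : ℕ) :
    ∃ C, 0 ≤ C ∧ ∀ q, (1 + ‖q‖) ^ s * ‖coeffMat A q‖ ≤ C := by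
  obtain ⟨s', C, hC, h⟩ := hA s
  refine ⟨C, hC, fun q => ?_⟩
  have h0 : 0 < (1 + ‖q‖) ^ s := by positivity
  rw [← le_div_iff₀' h0]
  refine ContinuousLinearMap.opNorm_le_bound _ (by positivity) fun v => ?_
  rw [div_mul_eq_mul_div, le_div_iff₀' h0]
  refine (le_sn s (A (mono 0 v)) q).trans ((h _).trans ?_)
  rw [sn_mono_zero]

/-- The symbol `(p, q) ↦ a_p (F(ξ) 1)_q`. -/
def prodSymbol (a : SmoothAlg n) (F : Cov n → Module.End ℂ (SmoothSpinor n N)) :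
    Cov n → Idx n → Idx n → Mat N := fun ξ p q => a.1 p • coeffMat (F ξ) q

theorem isHomogeneousSymbol_smul {r : ℤ} {g : Cov n → ℂ} (hg : IsHomogFun r g) (a : SmoothAlg n)
    {A : Module.End ℂ (SmoothSpinor n N)} (hA : Tempered A) :
    IsHomogeneousSymbol r fun ξ p q => g ξ • (a.1 p • coeffMat A q) where
  smooth p q := hg.smooth.smul contDiffOn_const
  bound K hK hK0 i s := by
    have hcont : ContinuousOn (fun ξ => iteratedFDeriv ℝ i g ξ) {0}ᶜ := by
      have h1 := hg.smooth.continuousOn_iteratedFDerivWithin (m := i) (by exact_mod_cast le_top)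
        (isOpen_compl_singleton.uniqueDiffOn)
      exact h1.congr fun ξ hξ => (iteratedFDerivWithin_of_isOpen i isOpen_compl_singleton hξ).symm
    obtain ⟨B, hB⟩ := hK.exists_bound_of_continuousOn (hcont.mono hK0)
    obtain ⟨C, hC, hA⟩ := coeffMat_bound hA s
    have ha := sn_nonneg s a
    refine ⟨sn s a * C * |B|, fun ξ hξ p q => ?_⟩
    let M : Mat N := a.1 p • coeffMat A q
    let L : ℂ →L[ℝ] Mat N := (ContinuousLinearMap.id ℝ ℂ).smulRight M
    have h1 := L.norm_iteratedFDeriv_comp_left (f := g) (x := ξ) (N := ∞) (n := i)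
      (hg.smooth.contDiffAt (isOpen_compl_singleton.mem_nhds (hK0 hξ))) (by exact_mod_cast le_top)
    have h2 : ‖L‖ ≤ ‖M‖ := by
      refine ContinuousLinearMap.opNorm_le_bound _ (norm_nonneg _) fun z => ?_
      change ‖z • M‖ ≤ _
      rw [norm_smul, mul_comm]
    have h3 : (1 + ‖p‖ + ‖q‖) ^ s * ‖M‖ ≤ sn s a * C := by
      have h4 : (1 + ‖p‖ + ‖q‖) ^ s ≤ (1 + ‖p‖) ^ s * (1 + ‖q‖) ^ s := by
        rw [← mul_pow]
        refine pow_le_pow_left₀ (by positivity) ?_ s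
        nlinarith [norm_nonneg p, norm_nonneg q]
      have h5 : ‖M‖ = ‖a.1 p‖ * ‖coeffMat A q‖ := norm_smul _ _
      rw [h5]
      calc (1 + ‖p‖ + ‖q‖) ^ s * (‖a.1 p‖ * ‖coeffMat A q‖)
          ≤ ((1 + ‖p‖) ^ s * (1 + ‖q‖) ^ s) * (‖a.1 p‖ * ‖coeffMat A q‖) := by gcongr
        _ = ((1 + ‖p‖) ^ s * ‖a.1 p‖) * ((1 + ‖q‖) ^ s * ‖coeffMat A q‖) := by ring
        _ ≤ _ := mul_le_mul (le_sn s a p) (hA q) (by positivity) ha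
    have h6 : ‖iteratedFDeriv ℝ i (fun η => g η • M) ξ‖ ≤ ‖M‖ * |B| := by
      refine h1.trans (mul_le_mul h2 ((hB ξ hξ).trans (le_abs_self B)) (norm_nonneg _)
        (norm_nonneg _))
    calc (1 + ‖p‖ + ‖q‖) ^ s * ‖iteratedFDeriv ℝ i (fun η => g η • M) ξ‖
        ≤ (1 + ‖p‖ + ‖q‖) ^ s * (‖M‖ * |B|) := by gcongr
      _ = ((1 + ‖p‖ + ‖q‖) ^ s * ‖M‖) * |B| := by ring
      _ ≤ _ := by gcongr
  homogeneous t ht ξ hξ p q := by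
    rw [hg.homogeneous t ht ξ hξ, mul_smul]
    rfl

theorem isHomogeneousSymbol_prodSymbol {X : ConfData n N} {r : ℤ} {j : ℕ}
    {F : Cov n → Module.End ℂ (SmoothSpinor n N)} (hF : F ∈ X.homSpan r j) (a : SmoothAlg n) :
    IsHomogeneousSymbol r (prodSymbol a F) := by
  induction hF using Submodule.span_induction with
  | mem F h =>
    obtain ⟨g, hg, A, hA, rfl⟩ := h
    have h1 := isHomogeneousSymbol_smul hg a (tempered_of_grade hA)
    have e : prodSymbol a (fun ξ => g ξ • A) = fun ξ p q => g ξ • (a.1 p • coeffMat A q) := by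
      funext ξ p q
      exact ContinuousLinearMap.ext fun v => smul_comm (a.1 p) (g ξ) ((A (mono 0 v)).1 q)
    rw [e]
    exact h1
  | zero =>
    have e : prodSymbol a (0 : Cov n → Module.End ℂ (SmoothSpinor n N)) = 0 := by
      funext ξ p q
      exact ContinuousLinearMap.ext fun v => smul_zero (A := Spin N) (a.1 p)
    rw [e]
    exact isHomogeneousSymbol_zero r
  | add F G _ _ h1 h2 =>
    have e : prodSymbol a (F + G) = prodSymbol a F + prodSymbol a G := by
      funext ξ p q
      exact ContinuousLinearMap.ext fun v =>
        smul_add (a.1 p) ((F ξ (mono 0 v)).1 q) ((G ξ (mono 0 v)).1 q)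
    rw [e]
    exact h1.add h2
  | smul c F _ h =>
    have e : prodSymbol a (c • F) = c • prodSymbol a F := by
      funext ξ p q
      exact ContinuousLinearMap.ext fun v => smul_comm (a.1 p) c ((F ξ (mono 0 v)).1 q)
    rw [e]
    exact h.smul c

theorem symbolCoeff_prodSymbol (θ : Matrix (Fin n) (Fin n) ℝ) (a : SmoothAlg n)
    (F : Cov n → Module.End ℂ (SmoothSpinor n N)) (ξ : Cov n) (m l : Idx n) (v : Spin N) :
    symbolCoeff θ (prodSymbol a F ξ) m l v = (lmul θ a (U θ m (F ξ (mono 0 v)))).1 l := by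
  change symbolCoeff θ (prodSymbol a F ξ) m l v = conv (fun p q => cocycle θ p q) a.1
    (U θ m (F ξ (mono 0 v))).1 l
  rw [symbolCoeff, conv]
  refine tsum_congr fun p => ?_
  rw [U_apply]
  change _ • (a.1 p • (F ξ (mono 0 v)).1 (l - p - m)) = _
  rw [smul_smul, smul_smul]
  congr 1
  have h : cocycle θ p (l - p) = cocycle θ p m * cocycle θ p (l - p - m) := by
    rw [← cocycle_add_right]
    congr 1
    abel
  rw [h, cocycle_add_left]
  ring

theorem lmul_U_bound (θ : Matrix (Fin n) (Fin n) ℝ) (s : ℕ) (a : SmoothAlg n) (m l : Idx n)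
    (f : SmoothSpinor n N) :
    (1 + ‖l - m‖) ^ s * ‖(lmul θ a (U θ m f)).1 l‖ ≤ sn s a * sn s f := by
  let w : Idx n → Idx n → ℂ := fun p q => cocycle θ p (q + m) * cocycle θ m q
  have hw : ∀ p q, ‖w p q‖ = 1 := fun p q => by
    rw [norm_mul, norm_cocycle, norm_cocycle, one_mul]
  have e : (lmul θ a (U θ m f)).1 l = (convOp w hw a f).1 (l - m) := by
    change conv (fun p q => cocycle θ p q) a.1 (U θ m f).1 l = conv w a.1 f.1 (l - m)
    rw [conv, conv]
    refine tsum_congr fun p => ?_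
    rw [U_apply, smul_smul, sub_right_comm l p m]
    congr 1
    have h : l - m - p + m = l - p := by abel
    change _ = cocycle θ p (l - m - p + m) * cocycle θ m (l - m - p) * a.1 p
    rw [h]
    ring
  rw [e]
  exact (le_sn s _ _).trans (sn_conv_le w hw s a f)

theorem sum_Ioc_eq_sum_range {M : Type*} [AddCommMonoid M] {r d : ℤ} (h : r ≤ d) (f : ℤ → M) :
    ∑ i ∈ Finset.Ioc r d, f i = ∑ j ∈ Finset.range (d - r).toNat, f (d - j) := by
  refine Finset.sum_nbij' (fun i => (d - i).toNat) (fun j => d - j) ?_ ?_ ?_ ?_ ?_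
  · intro i hi
    have := Finset.mem_Ioc.1 hi
    rw [Finset.mem_range]
    omega
  · intro j hj
    have := Finset.mem_range.1 hj
    rw [Finset.mem_Ioc]
    omega
  · intro i hi
    have := Finset.mem_Ioc.1 hi
    omega
  · intro j hj
    omega
  · intro i hi
    have := Finset.mem_Ioc.1 hi
    congr 1
    omega

theorem hasSymbol_lmul_mul {X : ConfData n N} {P : Module.End ℂ (SmoothSpinor n N)} {d : ℤ}
    {F : ℕ → Cov n → Module.End ℂ (SmoothSpinor n N)} (h : X.IsExp P d F) (a : SmoothAlg n) :
    HasSymbol X.θ (lmul X.θ a * P) d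
      fun r => if r ≤ d then prodSymbol a (F (d - r).toNat) else 0 where
  homogeneous r := by
    split_ifs with hr
    · have h1 := h.mem (d - r).toNat
      have e : d - ((d - r).toNat : ℤ) = r := by omega
      rw [e] at h1
      exact isHomogeneousSymbol_prodSymbol h1 a
    · exact isHomogeneousSymbol_zero r
  order r hr ξ p q := by
    rw [if_neg (not_le.2 hr)]
    rfl
  expansion r hr s := by
    obtain ⟨s', C, hC, h1⟩ := h.rem (d - r).toNat s
    have ha := sn_nonneg s a
    refine ⟨sn s a * C, fun m l v hm => ?_⟩
    have e1 : ∑ i ∈ Finset.Ioc r d, symbolCoeff X.θ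
        ((if i ≤ d then prodSymbol a (F (d - i).toNat) else 0) (toCov m)) m l v =
        ∑ j ∈ Finset.range (d - r).toNat,
          (lmul X.θ a (U X.θ m (F j (toCov m) (mono 0 v)))).1 l := by
      rw [sum_Ioc_eq_sum_range hr]
      refine Finset.sum_congr rfl fun j _ => ?_
      have e : (d - (d - (j : ℤ))).toNat = j := by omega
      rw [if_pos (by omega), e, symbolCoeff_prodSymbol]
    have e2 : ((lmul X.θ a * P : Module.End ℂ (SmoothSpinor n N)) (mono m v)).1 l =
        (lmul X.θ a (U X.θ m (conjU X.θ m P (mono 0 v)))).1 l := by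
      rw [U_conjU X.skew, U_mono_zero]
      rfl
    have e3 : ((lmul X.θ a * P : Module.End ℂ (SmoothSpinor n N)) (mono m v)).1 l - ∑ i ∈ Finset.Ioc r d, symbolCoeff X.θ
        ((if i ≤ d then prodSymbol a (F (d - i).toNat) else 0) (toCov m)) m l v =
        (lmul X.θ a (U X.θ m (conjU X.θ m P (mono 0 v) -
          ∑ j ∈ Finset.range (d - r).toNat, F j (toCov m) (mono 0 v)))).1 l := by
      rw [e1, e2, map_sub, map_sub, map_sum, map_sum, AddSubgroupClass.coe_sub,
        AddSubmonoidClass.coe_finsetSum, Pi.sub_apply, Finset.sum_apply]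
    rw [e3]
    refine (lmul_U_bound X.θ s a m l _).trans ?_
    have h2 := h1 m (mono 0 v) hm
    have e4 : d - ((d - r).toNat : ℤ) = r := by omega
    rw [e4, sn_mono_zero] at h2
    rw [mul_assoc, mul_assoc]
    refine mul_le_mul_of_nonneg_left ?_ ha
    rw [← mul_assoc]
    exact h2

end

namespace ConfData
variable {n N : ℕ} (X : ConfData n N)

/-- The operators `T D_k |D_k|⁻ⁿ` have a symbol whose trace density vanishes identically. -/
theorem exists_hasSymbol {T : Module.End ℂ (SmoothSpinor n N)} (hT : T ∈ X.leftSpan) :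
    ∃ σ, HasSymbol X.θ (T * (X.D * X.QS ^ n)) (1 - (n : ℤ)) σ ∧
      ∀ ξ, σ (-(n : ℤ)) ξ 0 0 = 0 := by
  induction hT using Submodule.span_induction with
  | mem T h =>
    obtain ⟨a, Q, hQ, rfl⟩ := h
    obtain ⟨F, hF⟩ := X.isExp_D
    obtain ⟨G, hG⟩ := X.isExp_QS_pow n
    have h := (isExp_of_commute hQ.mem hQ.U_comm).mul (hF.mul hG)
    rw [zero_add, ← sub_eq_add_neg] at h
    refine ⟨_, hasSymbol_lmul_mul h a, fun ξ => ?_⟩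
    have e : (1 - (n : ℤ) - -(n : ℤ)).toNat = 1 := by omega
    rw [if_pos (by omega), e]
    refine ContinuousLinearMap.ext fun v => ?_
    have h1 := X.apply_zero_of_grade_one (mem_grade_of_homSpan (h.mem 1) ξ) v
    change a.1 0 • coeffMat _ 0 v = 0
    rw [coeffMat_apply, h1, smul_zero]
  | zero => exact ⟨0, by rw [zero_mul]; exact hasSymbol_zero _ _, fun ξ => rfl⟩
  | add S T _ _ h1 h2 =>
    obtain ⟨σ, h1, h1'⟩ := h1
    obtain ⟨τ, h2, h2'⟩ := h2
    refine ⟨σ + τ, by rw [add_mul]; exact h1.add h2, fun ξ => ?_⟩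
    change σ _ ξ 0 0 + τ _ ξ 0 0 = 0
    rw [h1', h2', add_zero]
  | smul c T _ h =>
    obtain ⟨σ, h, h'⟩ := h
    refine ⟨c • σ, ?_, fun ξ => ?_⟩
    · have e : c • T * (X.D * X.QS ^ n) = c • (T * (X.D * X.QS ^ n)) := rfl
      rw [e]
      exact h.smul c
    · change c • σ (-(n : ℤ)) ξ 0 0 = (0 : Mat N)
      rw [h']
      exact ContinuousLinearMap.ext fun _ => smul_zero (A := Spin N) c

end ConfData

/-! ### Almost periodic sums -/

section
variable {n : ℕ}

/-- The character `m ↦ exp(2 π i θ(p, m))`. -/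
def chr (θ : Matrix (Fin n) (Fin n) ℝ) (p m : Idx n) : ℂ := cocycle θ p m ^ 2

theorem norm_chr (θ : Matrix (Fin n) (Fin n) ℝ) (p m : Idx n) : ‖chr θ p m‖ = 1 := by
  rw [chr, norm_pow, norm_cocycle, one_pow]

theorem chr_add (θ : Matrix (Fin n) (Fin n) ℝ) (p m m' : Idx n) :
    chr θ p (m + m') = chr θ p m * chr θ p m' := by
  rw [chr, cocycle_add_right, mul_pow]
  rfl

theorem pairing_eq_sum (θ : Matrix (Fin n) (Fin n) ℝ) (p q : Idx n) :
    pairing θ p q = ∑ j, (q j : ℝ) * pairing θ p (Pi.single j 1) := by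
  have h : ∀ j, pairing θ p (Pi.single j 1) = ∑ i, θ i j * (p i : ℝ) := fun j => by
    rw [pairing]
    refine Finset.sum_congr rfl fun i _ => ?_
    rw [Finset.sum_eq_single j]
    · simp
    · intro b _ hb
      simp [Pi.single_eq_of_ne hb]
    · simp
  simp only [h]
  rw [pairing, Finset.sum_comm]
  refine Finset.sum_congr rfl fun j _ => ?_
  rw [Finset.mul_sum]
  exact Finset.sum_congr rfl fun i _ => by ring

theorem exists_chr_ne {θ : Matrix (Fin n) (Fin n) ℝ} (hirr : StrictlyIrrational θ) {p p0 : Idx n}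
    (h : p ≠ p0) : ∃ i, chr θ p (Pi.single i 1) ≠ chr θ p0 (Pi.single i 1) := by
  by_contra! hc
  refine h (sub_eq_zero.1 (hirr (p - p0) fun q => ?_))
  have h1 : ∀ i, ∃ z : ℤ, pairing θ (p - p0) (Pi.single i 1) = z := by
    intro i
    have h2 : cocycle θ (p - p0) (Pi.single i 1) ^ 2 = 1 := by
      rw [sub_eq_add_neg, cocycle_add_left, cocycle_neg_left, mul_pow, inv_pow]
      have h3 := hc i
      rw [chr, chr] at h3
      rw [h3, mul_inv_cancel₀ (pow_ne_zero _ (cocycle_ne_zero θ _ _))]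
    rw [cocycle, ← Complex.exp_nat_mul, Complex.exp_eq_one_iff] at h2
    obtain ⟨z, hz⟩ := h2
    refine ⟨z, ?_⟩
    have h4 : (2 * Real.pi * Complex.I : ℂ) ≠ 0 := Complex.two_pi_I_ne_zero
    have h5 : ((pairing θ (p - p0) (Pi.single i 1) : ℝ) : ℂ) = ((z : ℝ) : ℂ) := by
      refine mul_right_cancel₀ h4 ?_
      push_cast at hz ⊢
      linear_combination hz
    exact_mod_cast h5
  choose z hz using h1
  refine ⟨∑ j, q j * z j, ?_⟩
  rw [pairing_eq_sum]
  push_cast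
  exact Finset.sum_congr rfl fun j _ => by rw [hz]

variable {V : Type} [NormedAddCommGroup V] [NormedSpace ℂ V]

/-- The summable families whose almost periodic sums tend to zero along translates of a ray. -/
def VanishAlong (θ : Matrix (Fin n) (Fin n) ℝ) (q : Idx n) (b : Idx n → V) : Prop :=
  (Summable fun p => ‖b p‖) ∧ ∀ m' : Idx n,
    Filter.Tendsto (fun j : ℕ => ∑' p, chr θ p ((j : ℤ) • q + m') • b p) Filter.atTop (nhds 0)

theorem norm_chr_smul (θ : Matrix (Fin n) (Fin n) ℝ) (p m : Idx n) (x : V) :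
    ‖chr θ p m • x‖ = ‖x‖ := by
  rw [norm_smul, norm_chr, one_mul]

variable [CompleteSpace V]

theorem VanishAlong.average {θ : Matrix (Fin n) (Fin n) ℝ} {q : Idx n} {b : Idx n → V}
    (h : VanishAlong θ q b) (c : ℂ) (m : Idx n) :
    VanishAlong θ q fun p => ((1 + c * chr θ p m) / 2) • b p := by
  have e : ∀ p, ((1 + c * chr θ p m) / 2) • b p =
      (1 / 2 : ℂ) • b p + (c / 2) • chr θ p m • b p := fun p => by
    rw [smul_smul, ← add_smul]
    congr 1
    ring
  have hs : ∀ m', Summable fun p => chr θ p m' • b p := fun m' =>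
    Summable.of_norm (by simpa only [norm_chr_smul] using h.1)
  refine ⟨?_, fun m' => ?_⟩
  · refine Summable.of_nonneg_of_le (fun _ => norm_nonneg _) (fun p => ?_)
      ((h.1.mul_left ‖(1 / 2 : ℂ)‖).add (h.1.mul_left ‖c / 2‖))
    change ‖((1 + c * chr θ p m) / 2) • b p‖ ≤ _
    rw [e]
    refine (norm_add_le _ _).trans (le_of_eq ?_)
    rw [norm_smul, norm_smul, norm_chr_smul]
  · have h1 := ((h.2 m').const_smul (1 / 2 : ℂ)).add ((h.2 (m' + m)).const_smul (c / 2))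
    rw [smul_zero, smul_zero, add_zero] at h1
    refine h1.congr fun j => ?_
    rw [← tsum_const_smul'', ← tsum_const_smul'', ← ((hs _).const_smul _).tsum_add
      ((hs _).const_smul _)]
    refine tsum_congr fun p => ?_
    change _ = chr θ p ((j : ℤ) • q + m') • (((1 + c * chr θ p m) / 2) • b p)
    rw [e, smul_add, ← add_assoc, chr_add θ p _ m]
    simp only [smul_smul]
    congr 2 <;> ring

/-- The multipliers of the families of `VanishAlong`. -/
def vanishMultiplier (θ : Matrix (Fin n) (Fin n) ℝ) (q : Idx n) (V : Type)
    [NormedAddCommGroup V] [NormedSpace ℂ V] : Submonoid (Idx n → ℂ) where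
  carrier := {g | ∀ b : Idx n → V, VanishAlong θ q b → VanishAlong θ q fun p => g p • b p}
  one_mem' := fun b hb => by simpa using hb
  mul_mem' := fun {g g'} hg hg' b hb => by
    have h := hg _ (hg' b hb)
    simpa only [smul_smul, Pi.mul_apply] using h

theorem norm_one_add_lt {z : ℂ} (hz : ‖z‖ = 1) (h : z ≠ 1) : ‖(1 + z) / 2‖ < 1 := by
  have h1 : z.re ^ 2 + z.im ^ 2 = 1 := by
    have := Complex.sq_norm z
    rw [hz, Complex.normSq_apply] at this
    nlinarith
  have h2 : z.re < 1 := by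
    rcases lt_or_ge z.re 1 with h2 | h2
    · exact h2
    · exfalso
      have h3 : z.im = 0 := by nlinarith [sq_nonneg z.im]
      have h4 : z.re = 1 := by nlinarith [sq_nonneg z.im]
      exact h (Complex.ext h4 h3)
  rw [norm_div, Complex.norm_ofNat, div_lt_one (by norm_num)]
  refine lt_of_pow_lt_pow_left₀ 2 (by norm_num) ?_
  rw [Complex.sq_norm, Complex.normSq_apply]
  simp only [Complex.add_re, Complex.one_re, Complex.add_im, Complex.one_im]
  nlinarith

theorem norm_one_add_le {z : ℂ} (hz : ‖z‖ = 1) : ‖(1 + z) / 2‖ ≤ 1 := by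
  rw [norm_div, Complex.norm_ofNat, div_le_one (by norm_num)]
  refine (norm_add_le _ _).trans ?_
  rw [hz, norm_one]
  norm_num

theorem VanishAlong.eq_zero {θ : Matrix (Fin n) (Fin n) ℝ} (hirr : StrictlyIrrational θ)
    {q : Idx n} {b : Idx n → V} (h : VanishAlong θ q b) (p0 : Idx n) : b p0 = 0 := by
  let z : Fin n → Idx n → ℂ := fun i p =>
    star (chr θ p0 (Pi.single i 1)) * chr θ p (Pi.single i 1)
  have hz : ∀ i p, ‖z i p‖ = 1 := fun i p => by rw [norm_mul, norm_star, norm_chr, norm_chr, one_mul]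
  have hstar : ∀ i, star (chr θ p0 (Pi.single i 1)) * chr θ p0 (Pi.single i 1) = 1 := fun i => by
    rw [← starRingEnd_apply, ← Complex.normSq_eq_conj_mul_self, Complex.normSq_eq_norm_sq, norm_chr]
    simp
  let g : Idx n → ℂ := ∏ i, fun p => (1 + z i p) / 2
  have hg : g ∈ vanishMultiplier θ q V :=
    Submonoid.prod_mem _ fun i _ b hb => hb.average _ _
  have hg_apply : ∀ p, g p = ∏ i, (1 + z i p) / 2 := fun p => Finset.prod_apply _ _ _
  have hg0 : g p0 = 1 := by
    rw [hg_apply]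
    refine Finset.prod_eq_one fun i _ => ?_
    change (1 + star (chr θ p0 (Pi.single i 1)) * chr θ p0 (Pi.single i 1)) / 2 = 1
    rw [hstar]
    norm_num
  have hg1 : ∀ p, ‖g p‖ ≤ 1 := fun p => by
    rw [hg_apply, norm_prod]
    exact Finset.prod_le_one (fun _ _ => norm_nonneg _) fun i _ => norm_one_add_le (hz i p)
  have hg2 : ∀ p, p ≠ p0 → ‖g p‖ < 1 := fun p hp => by
    obtain ⟨i, hi⟩ := exists_chr_ne hirr hp
    have h1 : z i p ≠ 1 := fun h1 => hi (by
      have h2 : chr θ p0 (Pi.single i 1) * z i p = chr θ p (Pi.single i 1) := by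
        change chr θ p0 (Pi.single i 1) * (star (chr θ p0 (Pi.single i 1)) * _) = _
        rw [← mul_assoc, mul_comm (chr θ p0 _), hstar, one_mul]
      rw [← h2, h1, mul_one])
    rw [hg_apply, norm_prod, ← Finset.mul_prod_erase _ _ (Finset.mem_univ i)]
    refine lt_of_le_of_lt (mul_le_of_le_one_right (norm_nonneg _) ?_) (norm_one_add_lt (hz i p) h1)
    exact Finset.prod_le_one (fun _ _ => norm_nonneg _) fun i _ => norm_one_add_le (hz i p)
  let ε : ℕ → ℝ := fun M => ∑' p, if p = p0 then 0 else ‖g p‖ ^ M * ‖b p‖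
  have hε : Filter.Tendsto ε Filter.atTop (nhds 0) := by
    have h1 : ∑' p : Idx n, (0 : ℝ) = 0 := tsum_zero
    rw [← h1]
    refine tendsto_tsum_of_dominated_convergence h.1 (fun p => ?_)
      (Filter.Eventually.of_forall fun M p => ?_)
    · split_ifs with hp
      · exact tendsto_const_nhds
      · simpa using (tendsto_pow_atTop_nhds_zero_of_lt_one (norm_nonneg _) (hg2 p hp)).mul_const
          ‖b p‖
    · split_ifs with hp
      · simp
      · rw [Real.norm_of_nonneg (by positivity)]
        exact mul_le_of_le_one_left (norm_nonneg _) (pow_le_one₀ (norm_nonneg _) (hg1 p))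
  have key : ∀ M, ‖b p0‖ ≤ ε M := by
    intro M
    have hM := (Submonoid.pow_mem _ hg M) b h
    have h1 := (hM.2 0).norm.add_const (ε M)
    rw [norm_zero, zero_add] at h1
    refine ge_of_tendsto' h1 fun j => ?_
    set m := (j : ℤ) • q + (0 : Idx n)
    have hs : Summable fun p => chr θ p m • (g ^ M) p • b p :=
      Summable.of_norm (by simpa only [norm_chr_smul] using hM.1)
    have e : ‖b p0‖ = ‖chr θ p0 m • (g ^ M) p0 • b p0‖ := by
      rw [norm_chr_smul, Pi.pow_apply, hg0, one_pow, one_smul]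
    rw [e, hs.tsum_eq_add_tsum_ite p0]
    set x := chr θ p0 m • (g ^ M) p0 • b p0
    set y := ∑' p, ite (p = p0) 0 (chr θ p m • (g ^ M) p • b p) with hy
    have h2 : ‖y‖ ≤ ε M := by
      refine tsum_of_norm_bounded (Summable.hasSum ?_) fun p => ?_
      · refine Summable.of_nonneg_of_le (fun p => ?_) (fun p => ?_) h.1
        · split_ifs <;> positivity
        · split_ifs
          · positivity
          · exact mul_le_of_le_one_left (norm_nonneg _) (pow_le_one₀ (norm_nonneg _) (hg1 p))
      · split_ifs
        · simp
        · rw [norm_chr_smul, norm_smul, Pi.pow_apply, norm_pow]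
    have h3 : x = (x + y) - y := by abel
    calc ‖x‖ = ‖(x + y) - y‖ := by rw [← h3]
      _ ≤ ‖x + y‖ + ‖y‖ := norm_sub_le _ _
      _ ≤ _ := by gcongr
  exact norm_le_zero_iff.1 (ge_of_tendsto' hε key)

end

/-! ### Uniqueness of the symbol -/

section
variable {n N : ℕ}

theorem toCov_smul (j : ℤ) (m : Idx n) : toCov (j • m) = (j : ℝ) • toCov m := by
  ext i
  simp [toCov]

theorem symbolCoeff_add {θ : Matrix (Fin n) (Fin n) ℝ} (hθ : θ.transpose = -θ)
    (c : Idx n → Idx n → Mat N) (m j : Idx n) (v : Spin N) :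
    symbolCoeff θ c m (m + j) v =
      cocycle θ m j • ∑' p, chr θ p m • (cocycle θ p j • c p (j - p) v) := by
  rw [symbolCoeff, ← tsum_const_smul'']
  refine tsum_congr fun p => ?_
  have e : m + j - p - m = j - p := by abel
  rw [e, smul_smul, smul_smul]
  congr 1
  have h1 : cocycle θ p (j - p) = cocycle θ p j := by
    rw [sub_eq_add_neg, cocycle_add_right, cocycle_neg_right, cocycle_self θ hθ, inv_one, mul_one]
  have h2 : cocycle θ m (j - p) = cocycle θ m j * cocycle θ p m := by
    rw [sub_eq_add_neg, cocycle_add_right, cocycle_neg_right, ← cocycle_swap θ hθ]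
  rw [cocycle_add_left, h1, h2, chr]
  ring

theorem norm_symbolCoeff_add {θ : Matrix (Fin n) (Fin n) ℝ} (hθ : θ.transpose = -θ)
    (c : Idx n → Idx n → Mat N) (m j : Idx n) (v : Spin N) :
    ‖symbolCoeff θ c m (m + j) v‖ =
      ‖∑' p, chr θ p m • (cocycle θ p j • c p (j - p) v)‖ := by
  rw [symbolCoeff_add hθ, norm_smul, norm_cocycle, one_mul]

theorem symbolCoeff_zero (θ : Matrix (Fin n) (Fin n) ℝ) {c : Idx n → Idx n → Mat N}
    (h : ∀ p q, c p q = 0) (m l : Idx n) (v : Spin N) : symbolCoeff θ c m l v = 0 := by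
  rw [symbolCoeff, ← tsum_zero (α := Spin N) (β := Idx n)]
  refine tsum_congr fun p => ?_
  rw [h]
  exact smul_zero _

/-- A homogeneous symbol whose action is of lower order vanishes at lattice points. -/
theorem vanishAlong_of_bound {θ : Matrix (Fin n) (Fin n) ℝ} (hθ : θ.transpose = -θ) {r : ℤ}
    {c : Cov n → Idx n → Idx n → Mat N} (hc : IsHomogeneousSymbol r c) {C : ℝ}
    (h : ∀ (m l : Idx n) (v : Spin N), m ≠ 0 →
      ‖symbolCoeff θ (c (toCov m)) m l v‖ ≤ C * ‖m‖ ^ (r - 1) * ‖v‖)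
    {q : Idx n} (hq : q ≠ 0) (j : Idx n) (v : Spin N) :
    VanishAlong θ q fun p => cocycle θ p j • c (toCov q) p (j - p) v := by
  let B : Set (Cov n) := Metric.closedBall (toCov q) (‖toCov q‖ / 2)
  have hq0 : 0 < ‖toCov q‖ := ConfData.norm_toCov_pos hq
  have hB0 : B ⊆ {0}ᶜ := by
    intro ξ hξ h0
    rw [Set.mem_singleton_iff.1 h0, Metric.mem_closedBall, dist_zero_left] at hξ
    linarith
  obtain ⟨A, hA⟩ := hc.bound B (isCompact_closedBall _ _) hB0 0 (2 * n)
  have hA' : ∀ ξ ∈ B, ∀ p, ‖cocycle θ p j • c ξ p (j - p) v‖ ≤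
      |A| * ‖v‖ * ((1 + ‖p‖) ^ (2 * n))⁻¹ := by
    intro ξ hξ p
    have h1 := hA ξ hξ p (j - p)
    rw [norm_iteratedFDeriv_zero] at h1
    have h2 : (1 + ‖p‖) ^ (2 * n) * ‖c ξ p (j - p)‖ ≤ |A| := by
      refine le_trans (mul_le_mul_of_nonneg_right ?_ (norm_nonneg _)) (h1.trans (le_abs_self A))
      exact pow_le_pow_left₀ (by positivity) (by linarith [norm_nonneg (j - p)]) _
    have h0 : 0 < (1 + ‖p‖) ^ (2 * n) := by positivity
    rw [norm_smul, norm_cocycle, one_mul, ← div_eq_mul_inv, le_div_iff₀ h0]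
    have h3 := (c ξ p (j - p)).le_opNorm v
    calc ‖c ξ p (j - p) v‖ * (1 + ‖p‖) ^ (2 * n)
        ≤ ‖c ξ p (j - p)‖ * ‖v‖ * (1 + ‖p‖) ^ (2 * n) := by gcongr
      _ = (1 + ‖p‖) ^ (2 * n) * ‖c ξ p (j - p)‖ * ‖v‖ := by ring
      _ ≤ _ := by gcongr
  have hsum : Summable fun p : Idx n => |A| * ‖v‖ * ((1 + ‖p‖) ^ (2 * n))⁻¹ :=
    (summable_weight n).mul_left _
  have hqB : toCov q ∈ B := Metric.mem_closedBall_self (by positivity)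
  refine ⟨Summable.of_nonneg_of_le (fun _ => norm_nonneg _) (hA' _ hqB) hsum, fun m' => ?_⟩
  let m : ℕ → Idx n := fun k => (k : ℤ) • q + m'
  let ξ : ℕ → Cov n := fun k => toCov q + (k : ℝ)⁻¹ • toCov m'
  have hinv : Filter.Tendsto (fun k : ℕ => (k : ℝ)⁻¹) Filter.atTop (nhds 0) :=
    tendsto_inv_atTop_nhds_zero_nat
  have hξ : Filter.Tendsto ξ Filter.atTop (nhds (toCov q)) := by
    have h1 := (hinv.smul_const (toCov m')).const_add (toCov q)
    rwa [zero_smul, add_zero] at h1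
  have hξB : ∀ᶠ k in Filter.atTop, ξ k ∈ B :=
    hξ.eventually (Metric.closedBall_mem_nhds _ (by positivity))
  have hmξ : ∀ k : ℕ, 0 < k → toCov (m k) = (k : ℝ) • ξ k := fun k hk => by
    have hk' : (k : ℝ) ≠ 0 := by exact_mod_cast hk.ne'
    change toCov ((k : ℤ) • q + m') = (k : ℝ) • (toCov q + (k : ℝ)⁻¹ • toCov m')
    rw [toCov_add, toCov_smul, smul_add, smul_inv_smul₀ hk', Int.cast_natCast]
  have hratio : Filter.Tendsto (fun k : ℕ => ‖m k‖ / k) Filter.atTop (nhds ‖q‖) := by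
    rw [tendsto_iff_norm_sub_tendsto_zero]
    have h1 : Filter.Tendsto (fun k : ℕ => ‖m'‖ * (k : ℝ)⁻¹) Filter.atTop (nhds 0) := by
      simpa using hinv.const_mul ‖m'‖
    refine squeeze_zero' (Filter.Eventually.of_forall fun _ => norm_nonneg _) ?_ h1
    filter_upwards [Filter.eventually_gt_atTop 0] with k hk
    have hk' : (0 : ℝ) < k := by exact_mod_cast hk
    have h2 : ‖(k : ℤ) • q‖ = k * ‖q‖ := by
      rw [norm_smul]
      simp
    have h3 : ‖m k‖ / k - ‖q‖ = (‖m k‖ - ‖(k : ℤ) • q‖) * (k : ℝ)⁻¹ := by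
      rw [h2]
      field_simp
    rw [h3, norm_mul, Real.norm_of_nonneg (inv_nonneg.2 hk'.le)]
    refine mul_le_mul_of_nonneg_right ?_ (inv_nonneg.2 hk'.le)
    refine (abs_norm_sub_norm_le _ _).trans (le_of_eq ?_)
    congr 1
    exact add_sub_cancel_left _ _
  have hfirst : Filter.Tendsto (fun k => ∑' p, chr θ p (m k) •
      (cocycle θ p j • c (ξ k) p (j - p) v)) Filter.atTop (nhds 0) := by
    have hq1 : ‖q‖ ≠ 0 := norm_ne_zero_iff.2 hq
    have h1 : Filter.Tendsto (fun k : ℕ => C * ‖v‖ * ((‖m k‖ / k) ^ (r - 1) * (k : ℝ)⁻¹))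
        Filter.atTop (nhds 0) := by
      have h2 := ((hratio.zpow₀ (r - 1) (Or.inl hq1)).mul hinv).const_mul (C * ‖v‖)
      simpa using h2
    refine squeeze_zero_norm' ?_ h1
    filter_upwards [hξB, Filter.eventually_gt_atTop 0] with k hkB hk
    have hk' : (0 : ℝ) < k := by exact_mod_cast hk
    have hξ0 : ξ k ≠ 0 := hB0 hkB
    have hm0 : m k ≠ 0 := fun h0 => by
      have h2 := hmξ k hk
      rw [h0, toCov_zero] at h2
      exact smul_ne_zero hk'.ne' hξ0 h2.symm
    have h2 := h (m k) (m k + j) v hm0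
    rw [norm_symbolCoeff_add hθ] at h2
    have h3 : ∑' p, chr θ p (m k) • (cocycle θ p j • c (toCov (m k)) p (j - p) v) =
        ((k : ℝ) ^ r) • ∑' p, chr θ p (m k) • (cocycle θ p j • c (ξ k) p (j - p) v) := by
      rw [← tsum_const_smul'']
      refine tsum_congr fun p => ?_
      rw [hmξ k hk, hc.homogeneous _ hk' _ hξ0, smul_apply,
        smul_comm (cocycle θ p j), smul_comm (chr θ p (m k))]
    rw [h3, norm_smul, Real.norm_of_nonneg (by positivity)] at h2
    have h4 : (0 : ℝ) < (k : ℝ) ^ r := by positivity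
    rw [← le_div_iff₀' h4] at h2
    refine h2.trans (le_of_eq ?_)
    rw [div_zpow, zpow_sub_one₀ hk'.ne']
    field_simp
  have hsecond : Filter.Tendsto (fun k => ∑' p, chr θ p (m k) •
      (cocycle θ p j • c (toCov q) p (j - p) v - cocycle θ p j • c (ξ k) p (j - p) v))
      Filter.atTop (nhds 0) := by
    rw [← tsum_zero (α := Spin N) (β := Idx n)]
    refine tendsto_tsum_of_dominated_convergence (hsum.add hsum) (fun p => ?_) ?_
    · rw [tendsto_zero_iff_norm_tendsto_zero]
      simp only [norm_chr_smul]
      rw [← tendsto_zero_iff_norm_tendsto_zero]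
      have h1 : Filter.Tendsto (fun k => c (ξ k) p (j - p)) Filter.atTop
          (nhds (c (toCov q) p (j - p))) :=
        (hc.contDiffAt p (j - p) (hB0 hqB)).continuousAt.tendsto.comp hξ
      have h2 : Filter.Tendsto (fun k => c (ξ k) p (j - p) v) Filter.atTop
          (nhds (c (toCov q) p (j - p) v)) :=
        ((ContinuousLinearMap.apply ℂ (Spin N) v).continuous.tendsto _).comp h1
      have h3 := (h2.const_smul (cocycle θ p j)).const_sub
        (cocycle θ p j • c (toCov q) p (j - p) v)
      rwa [sub_self] at h3
    · filter_upwards [hξB] with k hk p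
      rw [norm_chr_smul]
      exact (norm_sub_le _ _).trans (add_le_add (hA' _ hqB p) (hA' _ hk p))
  have hadd := hfirst.add hsecond
  rw [add_zero] at hadd
  refine hadd.congr' ?_
  filter_upwards [hξB] with k hk
  have hs1 : Summable fun p => chr θ p (m k) • (cocycle θ p j • c (ξ k) p (j - p) v) :=
    Summable.of_norm_bounded hsum fun p => by
      rw [norm_chr_smul]
      exact hA' _ hk p
  have hs2 : Summable fun p => chr θ p (m k) •
      (cocycle θ p j • c (toCov q) p (j - p) v - cocycle θ p j • c (ξ k) p (j - p) v) :=
    Summable.of_norm_bounded (hsum.add hsum) fun p => by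
      rw [norm_chr_smul]
      exact (norm_sub_le _ _).trans (add_le_add (hA' _ hqB p) (hA' _ hk p))
  rw [← hs1.tsum_add hs2]
  refine tsum_congr fun p => ?_
  rw [← smul_add, add_sub_cancel]

theorem IsHomogeneousSymbol.eq_zero_of_lattice {r : ℤ} {c : Cov n → Idx n → Idx n → Mat N}
    (hc : IsHomogeneousSymbol r c) {p p' : Idx n} (h : ∀ q, q ≠ 0 → c (toCov q) p p' = 0)
    {ξ : Cov n} (hξ : ξ ≠ 0) : c ξ p p' = 0 := by
  let q : ℕ → Idx n := fun k i => ⌊(k : ℝ) * ξ i⌋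
  have hlim : Filter.Tendsto (fun k : ℕ => (k : ℝ)⁻¹ • toCov (q k)) Filter.atTop (nhds ξ) := by
    have h1 : Filter.Tendsto (fun k : ℕ => fun i => (k : ℝ)⁻¹ * (⌊(k : ℝ) * ξ i⌋ : ℝ))
        Filter.atTop (nhds (WithLp.ofLp ξ)) := by
      rw [tendsto_pi_nhds]
      intro i
      rw [tendsto_iff_norm_sub_tendsto_zero]
      refine squeeze_zero' (Filter.Eventually.of_forall fun _ => norm_nonneg _) ?_
        (tendsto_inv_atTop_nhds_zero_nat (𝕜 := ℝ))
      filter_upwards [Filter.eventually_gt_atTop 0] with k hk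
      have hk' : (0 : ℝ) < k := by exact_mod_cast hk
      have h2 : (k : ℝ)⁻¹ * (⌊(k : ℝ) * ξ i⌋ : ℝ) - ξ i =
          (k : ℝ)⁻¹ * ((⌊(k : ℝ) * ξ i⌋ : ℝ) - k * ξ i) := by
        field_simp
      rw [h2, norm_mul, Real.norm_of_nonneg (inv_nonneg.2 hk'.le)]
      refine mul_le_of_le_one_right (inv_nonneg.2 hk'.le) ?_
      rw [Real.norm_eq_abs, abs_le]
      constructor <;> linarith [Int.floor_le ((k : ℝ) * ξ i), Int.lt_floor_add_one ((k : ℝ) * ξ i)]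
    exact ((PiLp.continuous_toLp 2 (fun _ : Fin n => ℝ)).tendsto _).comp h1
  have h1 : Filter.Tendsto (fun k : ℕ => c ((k : ℝ)⁻¹ • toCov (q k)) p p') Filter.atTop
      (nhds (c ξ p p')) := (hc.contDiffAt p p' hξ).continuousAt.tendsto.comp hlim
  refine tendsto_nhds_unique (h1.congr' ?_) tendsto_const_nhds
  filter_upwards [Filter.eventually_gt_atTop 0, hlim.eventually_ne hξ] with k hk hk0
  have hk' : (0 : ℝ) < (k : ℝ)⁻¹ := by
    have : (0 : ℝ) < k := by exact_mod_cast hk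
    positivity
  have h2 : toCov (q k) ≠ 0 := fun h0 => hk0 (by rw [h0, smul_zero])
  have h3 : q k ≠ 0 := fun h0 => h2 (by rw [h0, toCov_zero])
  rw [hc.homogeneous _ hk' _ h2, h _ h3]
  exact ContinuousLinearMap.ext fun v => by
    change ((k : ℝ)⁻¹ ^ r) • (0 : Spin N) = 0
    rw [smul_zero]

theorem HasSymbol.eq_zero {θ : Matrix (Fin n) (Fin n) ℝ} (hθ : θ.transpose = -θ)
    (hirr : StrictlyIrrational θ) {d : ℤ} {σ : ℤ → Cov n → Idx n → Idx n → Mat N}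
    (h : HasSymbol θ (0 : Module.End ℂ (SmoothSpinor n N)) d σ) (r : ℤ) {ξ : Cov n} (hξ : ξ ≠ 0)
    (p q : Idx n) : σ r ξ p q = 0 := by
  suffices key : ∀ (j : ℕ) (r : ℤ), (d - r).toNat < j → ∀ ξ : Cov n, ξ ≠ 0 → ∀ p q,
      σ r ξ p q = 0 from key _ r (Nat.lt_succ_self _) ξ hξ p q
  intro j
  induction j with
  | zero => exact fun r hj => absurd hj (Nat.not_lt_zero _)
  | succ j ih =>
    intro r hj ξ hξ p q
    rcases lt_or_ge d r with hr | hr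
    · exact h.order r hr ξ p q
    obtain ⟨C, hC⟩ := h.expansion (r - 1) (by omega) 0
    have hbound : ∀ (m l : Idx n) (v : Spin N), m ≠ 0 →
        ‖symbolCoeff θ (σ r (toCov m)) m l v‖ ≤ C * ‖m‖ ^ (r - 1) * ‖v‖ := by
      intro m l v hm
      have h1 := hC m l v hm
      have h2 : ∑ i ∈ Finset.Ioc (r - 1) d, symbolCoeff θ (σ i (toCov m)) m l v =
          symbolCoeff θ (σ r (toCov m)) m l v := by
        refine Finset.sum_eq_single r (fun i hi hir => ?_) fun hi => ?_
        · rw [Finset.mem_Ioc] at hi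
          exact symbolCoeff_zero θ (fun p q => ih i (by omega) _ (toCov_ne_zero hm) p q) m l v
        · exact absurd (Finset.mem_Ioc.2 ⟨by omega, hr⟩) hi
      have h3 : ((0 : Module.End ℂ (SmoothSpinor n N)) (mono m v)).1 l = 0 := rfl
      rw [h2, h3, zero_sub, norm_neg, pow_zero, one_mul] at h1
      exact h1
    refine (h.homogeneous r).eq_zero_of_lattice (fun m hm => ContinuousLinearMap.ext fun v => ?_) hξ
    have h1 := (vanishAlong_of_bound hθ (h.homogeneous r) hbound hm (p + q) v).eq_zero hirr p
    rw [add_sub_cancel_left] at h1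
    exact (smul_eq_zero.1 h1).resolve_left (cocycle_ne_zero θ _ _)

theorem HasSymbol.of_le {θ : Matrix (Fin n) (Fin n) ℝ} {P : Module.End ℂ (SmoothSpinor n N)}
    {d d' : ℤ} (hd : d ≤ d') {σ : ℤ → Cov n → Idx n → Idx n → Mat N} (h : HasSymbol θ P d σ) :
    HasSymbol θ P d' σ where
  homogeneous := h.homogeneous
  order r hr := h.order r (hd.trans_lt hr)
  expansion r hr s := by
    have hvan : ∀ (i : ℤ) (m l : Idx n) (v : Spin N), d < i →
        symbolCoeff θ (σ i (toCov m)) m l v = 0 := fun i m l v hi =>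
      symbolCoeff_zero θ (fun p q => h.order i hi _ p q) m l v
    rcases le_or_gt r d with hrd | hrd
    · obtain ⟨C, hC⟩ := h.expansion r hrd s
      refine ⟨C, fun m l v hm => ?_⟩
      rw [← Finset.sum_subset (Finset.Ioc_subset_Ioc_right hd) fun i hi hi' => hvan i m l v ?_]
      · exact hC m l v hm
      · rw [Finset.mem_Ioc] at hi hi'
        omega
    · obtain ⟨C, hC⟩ := h.expansion d le_rfl s
      refine ⟨|C|, fun m l v hm => ?_⟩
      have h1 := hC m l v hm
      rw [Finset.Ioc_self, Finset.sum_empty] at h1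
      rw [Finset.sum_eq_zero fun i hi => hvan i m l v (hrd.trans (Finset.mem_Ioc.1 hi).1)]
      refine h1.trans (mul_le_mul_of_nonneg_right ?_ (norm_nonneg v))
      refine mul_le_mul (le_abs_self C) (zpow_le_zpow_right₀ ?_ hrd.le) (by positivity)
        (abs_nonneg C)
      exact one_le_norm_idx hm

theorem HasSymbol.unique {θ : Matrix (Fin n) (Fin n) ℝ} (hθ : θ.transpose = -θ)
    (hirr : StrictlyIrrational θ) {P : Module.End ℂ (SmoothSpinor n N)} {d d' : ℤ}
    {σ σ' : ℤ → Cov n → Idx n → Idx n → Mat N} (h : HasSymbol θ P d σ)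
    (h' : HasSymbol θ P d' σ') (r : ℤ) {ξ : Cov n} (hξ : ξ ≠ 0) (p q : Idx n) :
    σ r ξ p q = σ' r ξ p q := by
  have h1 := (h.of_le (le_max_left d d')).add ((h'.of_le (le_max_right d d')).smul (-1))
  have h0 : P + (-1 : ℂ) • P = 0 := LinearMap.ext fun f => Subtype.ext <| funext fun l => by
    change (P f).1 l + (-1 : ℂ) • (P f).1 l = 0
    rw [neg_one_smul ℂ, add_neg_cancel]
  rw [h0] at h1
  have h2 := h1.eq_zero hθ hirr r hξ p q
  refine ContinuousLinearMap.ext fun v => ?_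
  have h3 : σ r ξ p q v + (-1 : ℂ) • σ' r ξ p q v = 0 := congrArg (fun A : Mat N => A v) h2
  rw [neg_one_smul ℂ, ← sub_eq_add_neg] at h3
  exact sub_eq_zero.1 h3

end

section
variable {n N : ℕ}

theorem residue_eq_zero {σ : ℤ → Cov n → Idx n → Idx n → Mat N}
    (h : ∀ ξ : Cov n, ξ ≠ 0 → σ (-(n : ℤ)) ξ 0 0 = 0) : residue σ = 0 := by
  refine MeasureTheory.integral_eq_zero_of_ae (Filter.Eventually.of_forall fun ξ => ?_)
  have h1 : ξ.1 ≠ 0 := ne_zero_of_mem_unit_sphere ξ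
  change LinearMap.trace ℂ (Spin N) (σ (-(n : ℤ)) ξ.1 0 0).toLinearMap = 0
  rw [h ξ.1 h1]
  exact map_zero (LinearMap.trace ℂ (Spin N))

theorem diracK_of_isEmpty (θ : Matrix (Fin 0) (Fin 0) ℝ) (γ : Fin 0 → Mat N) (k : SmoothAlg 0) :
    diracK θ γ k = 0 := by
  rw [diracK, dirac, Fin.sum_univ_zero, mul_zero, zero_mul]

theorem isInvAbsPow_zero (t : ℕ) : IsInvAbsPow (0 : Module.End ℂ (SmoothSpinor n N)) t 0 where
  bounded := ⟨0, fun f => map_zero toL2⟩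
  eigen μ f hμ h := by
    have h1 : (μ : ℂ) • f = 0 := h.symm
    have h2 : f = 0 := (smul_eq_zero.1 h1).resolve_left (Complex.ofReal_ne_zero.2 hμ)
    rw [h2, smul_zero, map_zero]
  kernel _ _ := rfl

end

end NCTorus

end

theorem mainTheorem4 (n N : ℕ) (θ : Matrix (Fin n) (Fin n) ℝ) (hθ : θ.transpose = -θ)
    (hirr : NCTorus.StrictlyIrrational θ)
    (γ : Fin n → NCTorus.Mat N) (hγ : NCTorus.IsGamma γ)
    (k : NCTorus.SmoothAlg n) (hk : NCTorus.IsStrictlyPositive θ k) :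
    ∃ R : Module.End ℂ (NCTorus.SmoothSpinor n N),
      NCTorus.IsInvAbsPow (NCTorus.diracK θ γ k) n R ∧
      (∀ R', NCTorus.IsInvAbsPow (NCTorus.diracK θ γ k) n R' → R' = R) ∧
      ∀ T ∈ NCTorus.zeroOrder θ γ k,
        (∃ σ, NCTorus.HasSymbol θ (T * NCTorus.diracK θ γ k * R) (1 - (n : ℤ)) σ) ∧
        ∀ (d : ℤ) (σ : ℤ → NCTorus.Cov n → NCTorus.Idx n → NCTorus.Idx n → NCTorus.Mat N),
          NCTorus.HasSymbol θ (T * NCTorus.diracK θ γ k * R) d σ →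
            NCTorus.residue σ = 0 := by
  rcases Nat.eq_zero_or_pos n with rfl | hn
  · refine ⟨0, ?_, fun R' hR' => LinearMap.ext fun f => hR'.kernel f ?_, fun T _ =>
      ⟨⟨0, ?_⟩, fun d σ _ => NCTorus.residue_eq_zero fun ξ hξ => absurd (Subsingleton.elim ξ 0) hξ⟩⟩
    · rw [NCTorus.diracK_of_isEmpty]
      exact NCTorus.isInvAbsPow_zero 0
    · rw [NCTorus.diracK_of_isEmpty]
      rfl
    · rw [mul_zero]
      exact NCTorus.hasSymbol_zero θ _
  · let X : NCTorus.ConfData n N := ⟨θ, γ, k, hθ, hγ, hk⟩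
    have hR : NCTorus.IsInvAbsPow X.D n (X.QS ^ n) := X.isInvAbsPow_QS hn.ne'
    refine ⟨X.QS ^ n, hR, fun R' hR' => X.eq_of_isInvAbsPow hR hR', fun T hT => ?_⟩
    obtain ⟨σ₀, h₀, hz⟩ := X.exists_hasSymbol (X.zeroOrder_le_leftSpan hT)
    rw [← mul_assoc] at h₀
    refine ⟨⟨σ₀, h₀⟩, fun d σ h => NCTorus.residue_eq_zero fun ξ hξ => ?_⟩
    exact (h.unique hθ hirr h₀ _ hξ 0 0).trans (hz ξ)
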